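/- For a morphism of schemes $\pi: Y\to B$ let $\Omega_\pi$ be its sheaf of relative differentials and put $T^1_\pi := \mathcal{E}xt^1_{\mathcal{O}_Y}(\Omega_\pi,\mathcal{O}_Y)$, the sheaf associated with $V\mapsto \mathrm{Ext}^1_{\mathcal{O}_V}(\Omega_\pi|_V,\mathcal{O}_V)$. A morphism is called lci if it is of finite type and, locally on the source, factors as a regular embedding (a closed embedding whose ideal is locally generated by a regular sequence) followed by a smooth morphism of finite type. Theorem. Let $B$ be a Noetherian scheme, let $\pi:Y\to B$ be a flat lci morphism with generically smooth fibers (that is, for every $b\in B$ the fiber $Y_b$ contains a dense open subset which is smooth over the residue field of $b$), let $g: C\to B$ be a closed embedding, and let $X=Y\times_B C$, with projections $f:X\to Y$ and $p:X\to C$. Then $f^*T^1_\pi$ and $T^1_p$ are coherent and there is a natural isomorphism $$f^*T^1_\pi\;\cong\; T^1_p .$$ Explicitly, there is exactly one isomorphism $e:f^*T^1_\pi\to T^1_p$ with the following property. Let $\theta: T^1_\pi\to f_*T^1_p$ be the map adjoint to $e$. Let $V\subset Y$ be open, and let $0\to\mathcal{O}_V\to E\to\Omega_\pi|_V\to 0$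 and $0\to\mathcal{O}_{f^{-1}V}\to E'\to\Omega_p|_{f^{-1}V}\to 0$ be exact sequences of $\mathcal{O}_V$-modules and of $\mathcal{O}_{f^{-1}V}$-modules. If there is an $\mathcal{O}_V$-linear map $\varphi: E\to f_*E'$ which is compatible with the canonical maps $\mathcal{O}_V\to f_*\mathcal{O}_{f^{-1}V}$ and $\Omega_\pi|_V\to f_*\Omega_p|_{f^{-1}V}$, $da\mapsto d(f^\sharp a)$, then $\theta$ carries the section of $T^1_\pi$ over $V$ defined by the class of $E$ to the section of $T^1_p$ over $f^{-1}V$ defined by the class of $E'$. -/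

import Mathlib

open CategoryTheory Limits AlgebraicGeometry Opposite TopologicalSpace Abelian
universe w u
lemma CategoryTheory.Adjunction.exists_lift_of_square {A₁ A₂ A₃ A₄ : Type*} [Category* A₁]
    [Category* A₂] [Category* A₃] [Category* A₄] {f : A₁ ⥤ A₂} {p : A₁ ⥤ A₃} {π : A₂ ⥤ A₄}
    {g : A₃ ⥤ A₄} {π' : A₄ ⥤ A₂} {p' : A₃ ⥤ A₁} (adj : π' ⊣ π) (adj' : p' ⊣ p)
    (e : p ⋙ g ⟶ f ⋙ π) {X : A₁} {Y : A₂} {C : A₃} {B : A₄} {fc : Y ⟶ f.obj X} {pc : C ⟶ p.obj X}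
    {πc : B ⟶ π.obj Y} {gc : B ⟶ g.obj C} (h : πc ≫ π.map fc = gc ≫ g.map pc ≫ e.app X) :
    ∃ ψ : π'.obj B ⟶ f.obj (p'.obj C),
      (adj.homEquiv _ _).symm πc ≫ fc = ψ ≫ f.map ((adj'.homEquiv _ _).symm pc) := by
  obtain ⟨q, rfl⟩ := (adj'.homEquiv C X).surjective pc
  refine ⟨(adj.homEquiv _ _).symm (gc ≫ g.map (adj'.unit.app C) ≫ e.app (p'.obj C)), ?_⟩
  apply (adj.homEquiv _ _).injective
  rw [adj.homEquiv_naturality_right, adj.homEquiv_naturality_right, Equiv.apply_symm_apply,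
    Equiv.apply_symm_apply, h, Equiv.symm_apply_apply, adj'.homEquiv_unit, Functor.map_comp,
    Category.assoc, Category.assoc, Category.assoc]
  exact congrArg (fun z ↦ gc ≫ g.map (adj'.unit.app C) ≫ z) (e.naturality q)

namespace CategoryTheory.Abelian.Ext
section
variable {C D E : Type*} [Category* C] [Category* D] [Category* E]
  [Abelian C] [Abelian D] [Abelian E]
  [HasExt.{w} C] [HasExt.{w} D] [HasExt.{w} E] [EnoughInjectives C]

theorem exists_eq_comp_extClass {X Y : C} {n : ℕ} (x : Ext X Y (n + 1)) :
    ∃ (S : ShortComplex C) (hS : S.ShortExact) (e : S.X₁ = Y) (y : Ext X S.X₃ n),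
      x = e ▸ y.comp hS.extClass rfl := by
  let I : InjectivePresentation Y := Classical.arbitrary _
  let S := ShortComplex.mk _ _ (cokernel.condition I.f)
  have hS : S.ShortExact := { exact := ShortComplex.exact_cokernel I.f }
  have : Injective S.X₂ := I.injective
  obtain ⟨y, hy⟩ := covariant_sequence_exact₁ X hS x (eq_zero_of_injective _) rfl
  exact ⟨S, hS, rfl, y, hy.symm⟩

theorem mapExactFunctor_natTrans {Φ Ψ : C ⥤ D} [Φ.Additive] [Ψ.Additive]
    [PreservesFiniteLimits Φ] [PreservesFiniteColimits Φ] [PreservesFiniteLimits Ψ]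
    [PreservesFiniteColimits Ψ] (α : Φ ⟶ Ψ) {X Y : C} {n : ℕ} (x : Ext X Y n) :
    (x.mapExactFunctor Φ).comp (mk₀ (α.app Y)) (add_zero n) =
      (mk₀ (α.app X)).comp (x.mapExactFunctor Ψ) (zero_add n) := by
  induction n generalizing Y with
  | zero =>
    obtain ⟨f, rfl⟩ := (mk₀_bijective X Y).2 x
    simp [mapExactFunctor_mk₀]
  | succ n ih =>
    obtain ⟨S, hS, rfl, y, rfl⟩ := exists_eq_comp_extClass x
    have h : (hS.extClass.mapExactFunctor Φ).comp (mk₀ (α.app S.X₁)) (add_zero 1) =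
        (mk₀ (α.app S.X₃)).comp (hS.extClass.mapExactFunctor Ψ) (zero_add 1) := by
      rw [mapExactFunctor_extClass, mapExactFunctor_extClass]
      exact ShortComplex.ShortExact.extClass_naturality (hS.map_of_exact Φ)
        (hS.map_of_exact Ψ) (S.mapNatTrans α)
    simp only [mapExactFunctor_comp]
    rw [comp_assoc_of_third_deg_zero, h, ← comp_assoc_of_second_deg_zero, ih,
      comp_assoc _ _ _ (zero_add n) rfl (by lia)]

theorem mapExactFunctor_id {X Y : C} {n : ℕ} (x : Ext X Y n) : x.mapExactFunctor (𝟭 C) = x := by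
  induction n generalizing Y with
  | zero =>
    obtain ⟨f, rfl⟩ := (mk₀_bijective X Y).2 x
    simp [mapExactFunctor_mk₀]
  | succ n ih =>
    obtain ⟨S, hS, rfl, y, rfl⟩ := exists_eq_comp_extClass x
    dsimp
    rw [mapExactFunctor_comp, mapExactFunctor_extClass, ih]
    rfl

theorem mapExactFunctor_mapExactFunctor {Φ : C ⥤ D} {Ψ : D ⥤ E} [Φ.Additive] [Ψ.Additive]
    [PreservesFiniteLimits Φ] [PreservesFiniteColimits Φ] [PreservesFiniteLimits Ψ]
    [PreservesFiniteColimits Ψ] {X Y : C} {n : ℕ} (x : Ext X Y n) :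
    (x.mapExactFunctor Φ).mapExactFunctor Ψ = x.mapExactFunctor (Φ ⋙ Ψ) := by
  induction n generalizing Y with
  | zero =>
    obtain ⟨f, rfl⟩ := (mk₀_bijective X Y).2 x
    simp [mapExactFunctor_mk₀]
  | succ n ih =>
    obtain ⟨S, hS, rfl, y, rfl⟩ := exists_eq_comp_extClass x
    dsimp
    rw [mapExactFunctor_comp, mapExactFunctor_comp, mapExactFunctor_comp, ih,
      mapExactFunctor_extClass, mapExactFunctor_extClass]
    exact congrArg (fun z ↦ (y.mapExactFunctor (Φ ⋙ Ψ)).comp z rfl)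
      (mapExactFunctor_extClass Ψ (hS.map_of_exact Φ))

theorem mapExactFunctor_comp_eq {Φ : C ⥤ D} {Ψ : D ⥤ E} {Ξ : C ⥤ E} [Φ.Additive] [Ψ.Additive]
    [Ξ.Additive] [PreservesFiniteLimits Φ] [PreservesFiniteColimits Φ] [PreservesFiniteLimits Ψ]
    [PreservesFiniteColimits Ψ] [PreservesFiniteLimits Ξ] [PreservesFiniteColimits Ξ]
    (α : Φ ⋙ Ψ ⟶ Ξ) {A B : C} {A₁ B₁ : D} {A₂ B₂ : E} {n : ℕ} {x : Ext A B n}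
    {y : Ext A₁ B₁ n} {z : Ext A₂ B₂ n} {a₁ : Φ.obj A ⟶ A₁} {b₁ : Φ.obj B ⟶ B₁}
    {a : Ψ.obj A₁ ⟶ A₂} {b : Ψ.obj B₁ ⟶ B₂} {a' : Ξ.obj A ⟶ A₂} {b' : Ξ.obj B ⟶ B₂} [IsIso a₁]
    (hy : (x.mapExactFunctor Φ).comp (mk₀ b₁) (add_zero n) = (mk₀ a₁).comp y (zero_add n))
    (hz : (x.mapExactFunctor Ξ).comp (mk₀ b') (add_zero n) = (mk₀ a').comp z (zero_add n))
    (hB : α.app B ≫ b' = Ψ.map b₁ ≫ b) (hA : α.app A ≫ a' = Ψ.map a₁ ≫ a) :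
    (y.mapExactFunctor Ψ).comp (mk₀ b) (add_zero n) = (mk₀ a).comp z (zero_add n) := by
  have e₁ := congrArg (mapExactFunctor Ψ) hy
  rw [mapExactFunctor_comp, mapExactFunctor_comp, mapExactFunctor_mk₀,
    mapExactFunctor_mk₀, mapExactFunctor_mapExactFunctor] at e₁
  have e₃ := mapExactFunctor_natTrans α x
  have key : (mk₀ (Ψ.map a₁)).comp ((y.mapExactFunctor Ψ).comp (mk₀ b) (add_zero n))
      (zero_add n) = (mk₀ (Ψ.map a₁)).comp ((mk₀ a).comp z (zero_add n)) (zero_add n) := by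
    rw [← comp_assoc_of_third_deg_zero, ← e₁, comp_assoc_of_third_deg_zero, mk₀_comp_mk₀]
    erw [← hB]
    rw [← mk₀_comp_mk₀, ← comp_assoc_of_third_deg_zero]
    erw [e₃]
    rw [comp_assoc_of_third_deg_zero, hz, mk₀_comp_mk₀_assoc]
    erw [hA]
    exact (mk₀_comp_mk₀_assoc (Ψ.map a₁) a z).symm
  have h := congrArg (fun w ↦ (mk₀ (inv (Ψ.map a₁))).comp w (zero_add n)) key
  simpa only [mk₀_comp_mk₀_assoc, IsIso.inv_hom_id, mk₀_id_comp, IsIso.inv_hom_id_assoc] using h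

end
end CategoryTheory.Abelian.Ext

theorem SheafOfModules.isGrothendieckAbelian {C : Type u} [SmallCategory C]
    {J : GrothendieckTopology C} (R : Sheaf J RingCat.{u}) :
    IsGrothendieckAbelian.{u} (SheafOfModules.{u} R) where
  ab5OfSize := ⟨fun K _ _ ↦ by
    have : ReflectsFiniteLimits (PresheafOfModules.toPresheaf.{u} R.obj) :=
      ⟨fun _ _ _ ↦ inferInstance⟩
    have : HasExactColimitsOfShape K (PresheafOfModules.{u} R.obj) :=
      HasExactColimitsOfShape.domain_of_functor K (PresheafOfModules.toPresheaf.{u} R.obj)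
    exact (PresheafOfModules.sheafificationAdjunction (𝟙 R.obj)).hasExactColimitsOfShape K⟩
  hasSeparator := by
    let adj := PresheafOfModules.sheafificationAdjunction.{u} (𝟙 R.obj)
    let G : C → SheafOfModules.{u} R := fun U ↦
      (PresheafOfModules.sheafification (𝟙 R.obj)).obj
        ((PresheafOfModules.free R.obj).obj (yoneda.obj U))
    have hP : (ObjectProperty.ofObj G).IsSeparating := by
      intro M N f₁ f₂ h
      apply (SheafOfModules.forget R).map_injective
      apply PresheafOfModules.freeYoneda.isSeparating R.obj
      rintro _ ⟨U⟩ g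
      have e (f : M ⟶ N) : adj.homEquiv _ N ((adj.homEquiv _ M).symm g ≫ f) =
          g ≫ (SheafOfModules.forget R).map f :=
        (adj.homEquiv_naturality_right ((adj.homEquiv _ M).symm g) f).trans
          (congrArg (· ≫ (SheafOfModules.forget R).map f)
            ((adj.homEquiv _ M).apply_symm_apply g))
      exact (e f₁).symm.trans ((congrArg (adj.homEquiv _ N)
        (h _ ⟨U⟩ ((adj.homEquiv _ M).symm g))).trans (e f₂))
    exact ⟨_, hP.isSeparator_coproduct⟩

namespace AlgebraicGeometry.Scheme.Modules
variable {X Y : Scheme.{u}}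

instance (X : Scheme.{u}) : IsGrothendieckAbelian.{u} X.Modules :=
  SheafOfModules.isGrothendieckAbelian X.ringCatSheaf

noncomputable section

instance (f : X ⟶ Y) [IsOpenImmersion f] : PreservesFiniteLimits (restrictFunctor f) := by
  have h0 : PreservesFiniteLimits (toPresheaf Y) :=
    PreservesLimitsOfSize.preservesFiniteLimits.{u, u} (toPresheaf Y)
  have h1 : PreservesFiniteLimits
      ((Functor.whiskeringLeft _ _ Ab.{u}).obj f.opensFunctor.op) := ⟨fun _ _ _ ↦ inferInstance⟩
  have h2 : PreservesFiniteLimits (restrictFunctor f ⋙ toPresheaf X) :=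
    comp_preservesFiniteLimits (toPresheaf Y)
      ((Functor.whiskeringLeft _ _ Ab.{u}).obj f.opensFunctor.op)
  have h3 : PreservesFiniteLimits (toPresheaf X) :=
    PreservesLimitsOfSize.preservesFiniteLimits.{u, u} (toPresheaf X)
  have : ReflectsFiniteLimits (toPresheaf X) := ⟨fun _ _ _ ↦ inferInstance⟩
  exact preservesFiniteLimits_of_reflects_of_preserves _ (toPresheaf X)

instance (f : X ⟶ Y) [IsOpenImmersion f] : (restrictFunctor f).Additive where
  map_add := rfl


variable (X) in
def toOpens (U : X.Opens) : Γ(X, ⊤) ⟶ Γ(X, U) := X.presheaf.map (homOfLE le_top).op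

lemma map_toOpens {U V : X.Opens} (i : op U ⟶ op V) (r : Γ(X, ⊤)) :
   X.presheaf.map i (toOpens X U r) = toOpens X V r := by
  rw [toOpens, toOpens, ← CommRingCat.comp_apply, ← Functor.map_comp]
  rfl

def smulHom (r : Γ(X, ⊤)) (M : X.Modules) : M ⟶ M where
  val := PresheafOfModules.homMk (M₁ := M.val) (M₂ := M.val)
    { app := fun U ↦ M.smul (toOpens X U.unop r)
      naturality := by
        intro U V i
        ext x
        have := M.map_smul i.unop (toOpens X U.unop r) x
        rw [Quiver.Hom.op_unop] at this
        erw [map_toOpens i r] at this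
        exact this.symm }
    (fun U s x ↦ by 
      change toOpens X U.unop r • (show Γ(X, U.unop) from s) • (show Γ(M, U.unop) from x) = (show Γ(X, U.unop) from s) • toOpens X U.unop r • (show Γ(M, U.unop) from x) 
      exact smul_comm (M := Γ(X, U.unop)) (N := Γ(X, U.unop)) (α := Γ(M, U.unop)) _ _ _)

@[simp]
lemma smulHom_app_apply (r : Γ(X, ⊤)) (M : X.Modules) (U : X.Opens) (x : Γ(M, U)) :
   (smulHom r M).app U x = toOpens X U r • x := rfl

lemma comp_smulHom (r : Γ(X, ⊤)) {M N : X.Modules} (φ : M ⟶ N) :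
  φ ≫ smulHom r N = smulHom r M ≫ φ := by
  ext U x
  exact (φ.app_smul (toOpens X U r) x).symm

instance linear : Linear Γ(X, ⊤) X.Modules where
  homModule M N :=
    { smul r φ := φ ≫ smulHom r N 
      one_smul φ := by
        ext U x
        change toOpens X U 1 • φ.app U x = _
        rw [map_one, one_smul]
      mul_smul r s φ := by
        ext U x
        change toOpens X U (r * s) • φ.app U x = toOpens X U r • toOpens X U s • φ.app U x
        rw [map_mul, mul_smul]
      smul_zero r := by
        ext U x
        change toOpens X U r • (0 : Γ(N, U)) = 0
        rw [smul_zero]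
      smul_add r φ ψ := by
        ext U x
        change toOpens X U r • (φ.app U x + ψ.app U x) = toOpens X U r • φ.app U x + toOpens X U r • ψ.app U x
        rw [smul_add]
      zero_smul φ := by
        ext U x
        change toOpens X U 0 • φ.app U x = 0
        rw [map_zero, zero_smul]
      add_smul r s φ := by
        ext U x
        change toOpens X U (r + s) • φ.app U x = toOpens X U r • φ.app U x + toOpens X U s • φ.app U x
        rw [map_add, add_smul] }
  smul_comp L M N r φ ψ := by
    change (φ ≫ smulHom r M) ≫ ψ = (φ ≫ ψ) ≫ smulHom r N
    rw [Category.assoc, Category.assoc, comp_smulHom]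
  comp_smul L M N φ r ψ := by
    change φ ≫ (ψ ≫ smulHom r N) = (φ ≫ ψ) ≫ smulHom r N
    rw [Category.assoc]

lemma smul_def (r : Γ(X, ⊤)) {M N : X.Modules} (φ : M ⟶ N) : r • φ = φ ≫ smulHom r N := rfl


section RestrictComp

variable {X U V W : Scheme.{u}}

/-- The canonical isomorphism `(M|_U)|_V ≅ M|_V` for open immersions `V ⟶ U ⟶ X`. -/
def restrictComp {i : U ⟶ X} {j : V ⟶ U} {k : V ⟶ X} [IsOpenImmersion i] [IsOpenImmersion j]
    [IsOpenImmersion k] (h : j ≫ i = k) :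
    restrictFunctor i ⋙ restrictFunctor j ≅ restrictFunctor k :=
  (restrictFunctorComp j i).symm ≪≫ restrictFunctorCongr h

lemma le_image_image {i : U ⟶ X} {j : V ⟶ U} {k : V ⟶ X} [IsOpenImmersion i] [IsOpenImmersion j]
    [IsOpenImmersion k] (h : j ≫ i = k) (T : V.Opens) : k ''ᵁ T ≤ i ''ᵁ (j ''ᵁ T) := by
  subst h
  rw [Scheme.Hom.comp_image]

lemma restrictComp_hom_app_app {i : U ⟶ X} {j : V ⟶ U} {k : V ⟶ X} [IsOpenImmersion i]
    [IsOpenImmersion j] [IsOpenImmersion k] (h : j ≫ i = k) (M : X.Modules) (T : V.Opens) :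
    ((restrictComp h).hom.app M).app T = M.presheaf.map (homOfLE (le_image_image h T)).op := by
  change ((restrictFunctorComp j i).inv.app M).app T ≫
    ((restrictFunctorCongr h).hom.app M).app T = _
  rw [restrictFunctorComp_inv_app_app, restrictFunctorCongr_hom_app_app]
  exact (M.presheaf.map_comp _ _).symm

lemma restrictComp_comp {i : U ⟶ X} {j : V ⟶ U} {l : W ⟶ V} {k₁ : V ⟶ X} {k₂ : W ⟶ U} {k : W ⟶ X}
    [IsOpenImmersion i] [IsOpenImmersion j] [IsOpenImmersion l] [IsOpenImmersion k₁]
    [IsOpenImmersion k₂] [IsOpenImmersion k] (h₁ : j ≫ i = k₁) (h₂ : l ≫ j = k₂)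
    (h : l ≫ k₁ = k) (h' : k₂ ≫ i = k) (M : X.Modules) :
    (restrictComp h₂).hom.app (M.restrict i) ≫ (restrictComp h').hom.app M =
      (restrictFunctor l).map ((restrictComp h₁).hom.app M) ≫ (restrictComp h).hom.app M := by
  ext1 T
  have e₁ := restrictComp_hom_app_app h₂ (M.restrict i) T
  have e₂ := restrictComp_hom_app_app h' M T
  have e₃ := restrictComp_hom_app_app h₁ M (l ''ᵁ T)
  have e₄ := restrictComp_hom_app_app h M T
  refine (congrArg₂ (· ≫ ·) e₁ e₂).trans (Eq.trans ?_ (congrArg₂ (· ≫ ·) e₃ e₄).symm)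
  exact (M.presheaf.map_comp _ _).symm.trans (M.presheaf.map_comp
    (homOfLE (le_image_image h₁ (l ''ᵁ T))).op (homOfLE (le_image_image h T)).op)

lemma restrictComp_self {i : U ⟶ X} {j : U ⟶ U} [IsOpenImmersion i] [IsOpenImmersion j]
    (h : j ≫ i = i) (hj : j = 𝟙 U) (M : X.Modules) :
    (restrictComp h).hom.app M =
      ((restrictFunctorCongr hj).hom ≫ restrictFunctorId.hom).app (M.restrict i) := by
  ext1 T
  refine (restrictComp_hom_app_app h M T).trans ?_
  have e₁ := restrictFunctorCongr_hom_app_app (U := T) hj (M.restrict i)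
  have e₂ := restrictFunctorId_hom_app_app (U := T) (M := M.restrict i)
  refine Eq.trans ?_ (congrArg₂ (· ≫ ·) e₁ e₂).symm
  exact (M.restrict i).presheaf.map_comp _ _

end RestrictComp

section ExtRestrict

variable {X U V W : Scheme.{u}} (F G : X.Modules) (n : ℕ)

/-- Restriction of extension classes along open immersions `V ⟶ U ⟶ X`:
`Ext^n(F|_U, G|_U) → Ext^n(F|_V, G|_V)`. -/
def extRestrict {i : U ⟶ X} {j : V ⟶ U} {k : V ⟶ X} [IsOpenImmersion i] [IsOpenImmersion j]
    [IsOpenImmersion k] (h : j ≫ i = k) :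
    Ext (F.restrict i) (G.restrict i) n →+ Ext (F.restrict k) (G.restrict k) n where
  toFun x := (Ext.mk₀ ((restrictComp h).inv.app F)).comp
    ((x.mapExactFunctor (restrictFunctor j)).comp
      (Ext.mk₀ ((restrictComp h).hom.app G)) (add_zero n)) (zero_add n)
  map_zero' := by
    rw [Ext.mapExactFunctor_zero, Ext.zero_comp, Ext.comp_zero]
  map_add' x y := by
    rw [Ext.mapExactFunctor_add, Ext.add_comp, Ext.comp_add]

variable {F G n}

lemma extRestrict_eq_iff {i : U ⟶ X} {j : V ⟶ U} {k : V ⟶ X} [IsOpenImmersion i]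
    [IsOpenImmersion j] [IsOpenImmersion k] (h : j ≫ i = k)
    (x : Ext (F.restrict i) (G.restrict i) n) (y : Ext (F.restrict k) (G.restrict k) n) :
    extRestrict F G n h x = y ↔
      (x.mapExactFunctor (restrictFunctor j)).comp
        (Ext.mk₀ ((restrictComp h).hom.app G)) (add_zero n) =
      (Ext.mk₀ ((restrictComp h).hom.app F)).comp y (zero_add n) := by
  constructor
  · rintro rfl
    change _ = (Ext.mk₀ _).comp ((Ext.mk₀ _).comp _ (zero_add n)) (zero_add n)
    rw [Ext.mk₀_comp_mk₀_assoc, Iso.hom_inv_id_app]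
    exact (Ext.mk₀_id_comp _).symm
  · intro e
    change (Ext.mk₀ _).comp _ (zero_add n) = _
    rw [e, Ext.mk₀_comp_mk₀_assoc, Iso.inv_hom_id_app, Ext.mk₀_id_comp]

lemma extRestrict_self {i : U ⟶ X} {j : U ⟶ U} [IsOpenImmersion i] [IsOpenImmersion j]
    (h : j ≫ i = i) (hj : j = 𝟙 U) (x : Ext (F.restrict i) (G.restrict i) n) :
    extRestrict F G n h x = x := by
  rw [extRestrict_eq_iff, restrictComp_self h hj, restrictComp_self h hj]
  refine (Ext.mapExactFunctor_natTrans _ x).trans ?_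
  rw [Ext.mapExactFunctor_id]

lemma extRestrict_extRestrict {i : U ⟶ X} {j : V ⟶ U} {l : W ⟶ V} {k₁ : V ⟶ X} {k₂ : W ⟶ U}
    {k : W ⟶ X} [IsOpenImmersion i] [IsOpenImmersion j] [IsOpenImmersion l] [IsOpenImmersion k₁]
    [IsOpenImmersion k₂] [IsOpenImmersion k] (h₁ : j ≫ i = k₁) (h₂ : l ≫ j = k₂)
    (h : l ≫ k₁ = k) (h' : k₂ ≫ i = k) (x : Ext (F.restrict i) (G.restrict i) n) :
    extRestrict F G n h (extRestrict F G n h₁ x) = extRestrict F G n h' x := by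
  rw [extRestrict_eq_iff]
  exact Ext.mapExactFunctor_comp_eq (restrictComp h₂).hom ((extRestrict_eq_iff h₁ x _).1 rfl)
    ((extRestrict_eq_iff h' x _).1 rfl) (restrictComp_comp h₁ h₂ h h' G)
    (restrictComp_comp h₁ h₂ h h' F)

end ExtRestrict
section Scalars

variable {X U V : Scheme.{u}}

lemma appIso_inv_toOpens {i : U ⟶ X} {j : V ⟶ U} {k : V ⟶ X} [IsOpenImmersion i]
    [IsOpenImmersion j] [IsOpenImmersion k] (h : j ≫ i = k) (T : V.Opens) :
    toOpens U (j ''ᵁ T) ≫ (i.appIso (j ''ᵁ T)).inv ≫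
      X.presheaf.map (homOfLE (le_image_image h T)).op =
    j.appTop ≫ toOpens V T ≫ (k.appIso T).inv := by
  subst h
  rw [← cancel_mono ((j ≫ i).appIso T).hom]
  simp only [Category.assoc, Iso.inv_hom_id, Category.comp_id]
  rw [Scheme.Hom.appIso_hom', Scheme.Hom.map_appLE]
  have := Scheme.Hom.appLE_comp_appLE j i (i ''ᵁ (j ''ᵁ T)) (j ''ᵁ T) T
    (Scheme.Hom.preimage_image_eq i _).ge (Scheme.Hom.preimage_image_eq j _).ge
  rw [← this, Scheme.Hom.appIso_inv_appLE_assoc, toOpens, toOpens, Scheme.Hom.map_appLE,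
    Scheme.Hom.map_appLE]
  rfl

lemma restrict_smulHom {i : U ⟶ X} {j : V ⟶ U} {k : V ⟶ X} [IsOpenImmersion i]
    [IsOpenImmersion j] [IsOpenImmersion k] (h : j ≫ i = k) (r : Γ(U, ⊤)) (M : X.Modules) :
    (restrictFunctor j).map (smulHom r (M.restrict i)) ≫ (restrictComp h).hom.app M =
      (restrictComp h).hom.app M ≫ smulHom (j.appTop r) (M.restrict k) := by
  ext T x
  have e := restrictComp_hom_app_app h M T
  have e' (y) := congrArg (fun φ ↦ φ.hom y) e
  refine (e' _).trans (Eq.trans ?_ (congrArg (fun y ↦ toOpens V T (j.appTop r) • y) (e' x)).symm)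
  refine (M.map_smul (homOfLE (le_image_image h T))
    ((i.appIso (j ''ᵁ T)).inv (toOpens U (j ''ᵁ T) r)) x).trans ?_
  exact congrArg (fun s ↦ s • M.presheaf.map (homOfLE (le_image_image h T)).op x)
    (congrArg (fun φ ↦ φ.hom r) (appIso_inv_toOpens h T))

lemma extRestrict_smul {F G : X.Modules} {n : ℕ} {i : U ⟶ X} {j : V ⟶ U} {k : V ⟶ X}
    [IsOpenImmersion i] [IsOpenImmersion j] [IsOpenImmersion k] (h : j ≫ i = k) (r : Γ(U, ⊤))
    (x : Ext (F.restrict i) (G.restrict i) n) :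
    extRestrict F G n h (r • x) = j.appTop r • extRestrict F G n h x := by
  rw [extRestrict_eq_iff, Ext.comp_smul, ← (extRestrict_eq_iff h x _).1 rfl,
    Ext.smul_eq_comp_mk₀, Ext.smul_eq_comp_mk₀, smul_def, smul_def, Category.id_comp,
    Category.id_comp, Ext.mapExactFunctor_comp, Ext.mapExactFunctor_mk₀,
    Ext.comp_assoc_of_third_deg_zero, Ext.comp_assoc_of_third_deg_zero, Ext.mk₀_comp_mk₀,
    Ext.mk₀_comp_mk₀, ← restrict_smulHom]

end Scalars

section SheafExt

variable {X : Scheme.{u}}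

lemma homOfLE_appTop_topIso_inv {U V : X.Opens} (h : V ≤ U) :
    U.topIso.inv ≫ (X.homOfLE h).appTop = X.presheaf.map (homOfLE h).op ≫ V.topIso.inv := by
  rw [Scheme.homOfLE_appTop, Scheme.Opens.topIso_inv, Scheme.Opens.topIso_inv]
  exact (X.presheaf.map_comp _ _).symm.trans
    (X.presheaf.map_comp (homOfLE h).op (eqToHom V.ι_image_top).op)

/-- Restriction of extension classes to smaller opens. -/
def extRes (n : ℕ) (F G : X.Modules) {U V : X.Opens} (h : V ≤ U) :
    Ext.{u} (F.restrict U.ι) (G.restrict U.ι) n →+ Ext.{u} (F.restrict V.ι) (G.restrict V.ι) n :=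
  extRestrict F G n (j := X.homOfLE h) (X.homOfLE_ι h)

lemma extRes_self {n : ℕ} {F G : X.Modules} {U : X.Opens} (h : U ≤ U)
    (x : Ext.{u} (F.restrict U.ι) (G.restrict U.ι) n) : extRes n F G h x = x :=
  extRestrict_self (i := U.ι) (j := X.homOfLE h) _ (X.homOfLE_rfl U) x

lemma extRes_extRes {n : ℕ} {F G : X.Modules} {U V W : X.Opens} (h₁ : V ≤ U) (h₂ : W ≤ V)
    (x : Ext.{u} (F.restrict U.ι) (G.restrict U.ι) n) :
    extRes n F G h₂ (extRes n F G h₁ x) = extRes n F G (h₂.trans h₁) x :=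
  extRestrict_extRestrict (i := U.ι) (j := X.homOfLE h₁) (l := X.homOfLE h₂) (k₁ := V.ι)
    (k₂ := X.homOfLE (h₂.trans h₁)) (k := W.ι) _ (X.homOfLE_homOfLE h₂ h₁) _ _ x

/-- The abelian presheaf `U ↦ Ext^n(F|_U, G|_U)`. -/
def extAbPresheaf (n : ℕ) (F G : X.Modules) : X.Opensᵒᵖ ⥤ Ab.{u} where
  obj U := .of (Ext.{u} (F.restrict U.unop.ι) (G.restrict U.unop.ι) n)
  map h := AddCommGrpCat.ofHom (extRes n F G (leOfHom h.unop))
  map_id _ := AddCommGrpCat.ext fun x ↦ extRes_self _ x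
  map_comp h₁ h₂ := AddCommGrpCat.ext fun x ↦
    (extRes_extRes (leOfHom h₁.unop) (leOfHom h₂.unop) x).symm

/-- `Ext^n(F|_U, G|_U)` is a `Γ(X, U)`-module: `r` acts by composition with the homothety of ratio
`r` of `G|_U`. -/
instance extModule (n : ℕ) (F G : X.Modules) (U : X.Opens) :
    Module Γ(X, U) (Ext.{u} (F.restrict U.ι) (G.restrict U.ι) n) :=
  letI : Module Γ((U : Scheme.{u}), ⊤) (Ext.{u} (F.restrict U.ι) (G.restrict U.ι) n) := inferInstance
  Module.compHom _ U.topIso.inv.hom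

lemma ext_smul_def {n : ℕ} {F G : X.Modules} {U : X.Opens} (r : Γ(X, U))
    (x : Ext.{u} (F.restrict U.ι) (G.restrict U.ι) n) : r • x = U.topIso.inv r • x := rfl

lemma extRes_smul {n : ℕ} {F G : X.Modules} {U V : X.Opens} (h : V ≤ U) (r : Γ(X, U))
    (x : Ext.{u} (F.restrict U.ι) (G.restrict U.ι) n) :
    extRes n F G h (r • x) = X.presheaf.map (homOfLE h).op r • extRes n F G h x := by
  rw [ext_smul_def, ext_smul_def]
  refine (extRestrict_smul (X.homOfLE_ι h) (U.topIso.inv r) x).trans ?_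
  exact congrArg (fun s : Γ((V : Scheme.{u}), ⊤) ↦ s • extRes n F G h x)
    (congrArg (fun φ ↦ φ.hom r) (homOfLE_appTop_topIso_inv h))

instance (n : ℕ) (F G : X.Modules) (U : X.Opensᵒᵖ) :
    Module (X.ringCatSheaf.obj.obj U) ((extAbPresheaf n F G).obj U) :=
  extModule n F G U.unop

/-- The presheaf of modules `U ↦ Ext^n(F|_U, G|_U)`. -/
def extPresheaf (n : ℕ) (F G : X.Modules) : X.PresheafOfModules :=
  PresheafOfModules.ofPresheaf (extAbPresheaf n F G)
    (fun _ _ h r x ↦ extRes_smul (leOfHom h.unop) r x)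

/-- The sheaf `𝓔xt^n(F, G)`, the sheaf associated with `U ↦ Ext^n(F|_U, G|_U)`. -/
def sheafExt (n : ℕ) (F G : X.Modules) : X.Modules :=
  (PresheafOfModules.sheafification (𝟙 X.ringCatSheaf.obj)).obj (extPresheaf n F G)

/-- The section of `𝓔xt^n(F, G)` over `U` defined by a class in `Ext^n(F|_U, G|_U)`. -/
def extSection {n : ℕ} {F G : X.Modules} (U : X.Opens)
    (x : Ext.{u} (F.restrict U.ι) (G.restrict U.ι) n) : Γ(sheafExt n F G, U) :=
  (((PresheafOfModules.sheafificationAdjunction (𝟙 X.ringCatSheaf.obj)).unit.app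
    (extPresheaf n F G)).app (op U)).hom
    (show ((extPresheaf n F G).obj (op U) : Type u) from x)

end SheafExt

section Differentials

variable {X Y B C : Scheme.{u}}

/-- The presheaf inverse image `π⁻¹ 𝒪_B` on `Y`. -/
abbrev inverseImage (π : Y ⟶ B) : TopCat.Presheaf CommRingCat.{u} Y :=
  (TopCat.Presheaf.pullback CommRingCat.{u} π.base).obj B.presheaf

/-- The morphism `π⁻¹ 𝒪_B ⟶ 𝒪_Y` adjoint to `𝒪_B ⟶ π_* 𝒪_Y`. -/
def inverseImageHom (π : Y ⟶ B) : inverseImage π ⟶ Y.presheaf :=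
  ((TopCat.Presheaf.pullbackPushforwardAdjunction CommRingCat.{u} π.base).homEquiv _ _).symm π.c

/-- The presheaf of relative differentials `U ↦ Ω_{𝒪_Y(U) / (π⁻¹ 𝒪_B)(U)}`. -/
def kaehlerPresheaf (π : Y ⟶ B) : Y.PresheafOfModules :=
  _root_.PresheafOfModules.DifferentialsConstruction.relativeDifferentials' (inverseImageHom π)

/-- The sheaf of relative differentials `Ω_π`. -/
def kaehler (π : Y ⟶ B) : Y.Modules :=
  (PresheafOfModules.sheafification (𝟙 Y.ringCatSheaf.obj)).obj (kaehlerPresheaf π)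

/-- The canonical map from the presheaf of relative differentials to its associated sheaf. -/
def toKaehler (π : Y ⟶ B) : kaehlerPresheaf π ⟶ (toPresheafOfModules Y).obj (kaehler π) :=
  (PresheafOfModules.sheafificationAdjunction (𝟙 Y.ringCatSheaf.obj)).unit.app (kaehlerPresheaf π)

/-- The universal derivation `d : 𝒪_Y ⟶ Ω_π`. -/
def kaehlerD (π : Y ⟶ B) : _root_.PresheafOfModules.Derivation'
    ((toPresheafOfModules Y).obj (kaehler π)) (inverseImageHom π) :=
  (_root_.PresheafOfModules.DifferentialsConstruction.derivation' (inverseImageHom π)).postcomp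
    (toKaehler π)

/-- The natural transformation `g_* p_* ⟶ π_* f_*` of a commutative square. -/
def pushforwardSquare {f : X ⟶ Y} {p : X ⟶ C} {π : Y ⟶ B} {g : C ⟶ B} (w : f ≫ π = p ≫ g) :
    TopCat.Presheaf.pushforward CommRingCat.{u} p.base ⋙
        TopCat.Presheaf.pushforward CommRingCat.{u} g.base ⟶
      TopCat.Presheaf.pushforward CommRingCat.{u} f.base ⋙
        TopCat.Presheaf.pushforward CommRingCat.{u} π.base where
  app F :=
    { app U := F.map (eqToHom (show (f ≫ π) ⁻¹ᵁ U.unop = (p ≫ g) ⁻¹ᵁ U.unop by rw [w])).op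
      naturality U V i := (F.map_comp _ _).symm.trans (F.map_comp
        (eqToHom (show (f ≫ π) ⁻¹ᵁ U.unop = (p ≫ g) ⁻¹ᵁ U.unop by rw [w])).op
        ((Opens.map f.base).op.map ((Opens.map π.base).op.map i))) }
  naturality F G φ := by
    refine NatTrans.ext (funext fun U ↦ ?_)
    exact (φ.naturality (eqToHom (show (f ≫ π) ⁻¹ᵁ U.unop = (p ≫ g) ⁻¹ᵁ U.unop by rw [w])).op).symm

lemma exists_inverseImage_lift {f : X ⟶ Y} {p : X ⟶ C} {π : Y ⟶ B} {g : C ⟶ B} (w : f ≫ π = p ≫ g) :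
    ∃ ψ : inverseImage π ⟶ (TopCat.Presheaf.pushforward CommRingCat.{u} f.base).obj (inverseImage p),
      inverseImageHom π ≫ f.c =
        ψ ≫ (TopCat.Presheaf.pushforward CommRingCat.{u} f.base).map (inverseImageHom p) := by
  refine Adjunction.exists_lift_of_square
    (TopCat.Presheaf.pullbackPushforwardAdjunction CommRingCat.{u} π.base)
    (TopCat.Presheaf.pullbackPushforwardAdjunction CommRingCat.{u} p.base)
    (pushforwardSquare w) (gc := g.c) (NatTrans.ext (funext fun U ↦ ?_))
  have h := Scheme.Hom.congr_app w U.unop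
  rw [Scheme.Hom.comp_app, Scheme.Hom.comp_app] at h
  change π.app U.unop ≫ f.app (π ⁻¹ᵁ U.unop) = g.app U.unop ≫ p.app (g ⁻¹ᵁ U.unop) ≫
    X.presheaf.map (eqToHom (show (f ≫ π) ⁻¹ᵁ U.unop = (p ≫ g) ⁻¹ᵁ U.unop by rw [w])).op
  exact h.trans (Category.assoc (g.app U.unop) (p.app (g ⁻¹ᵁ U.unop)) (X.presheaf.map _))

/-- The universal derivation on sections. -/
def dSection (π : Y ⟶ B) (U : Y.Opens) : Γ(Y, U) →+ Γ(kaehler π, U) := (kaehlerD π).d (X := op U)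

lemma dSection_mul (π : Y ⟶ B) (U : Y.Opens) (a b : Γ(Y, U)) :
    dSection π U (a * b) = a • dSection π U b + b • dSection π U a :=
  (kaehlerD π).d_mul (X := op U) a b

lemma dSection_map (π : Y ⟶ B) {U V : Y.Opens} (i : U ⟶ V) (a : Γ(Y, V)) :
    dSection π U (Y.presheaf.map i.op a) = (kaehler π).presheaf.map i.op (dSection π V a) :=
  (kaehlerD π).d_map i.op a

lemma dSection_inverseImageHom (π : Y ⟶ B) (U : Y.Opens) (s : (inverseImage π).obj (op U)) :
    dSection π U ((inverseImageHom π).app (op U) s) = 0 :=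
  (kaehlerD π).d_app (X := op U) s

section

variable {f : X ⟶ Y} {p : X ⟶ C} {π : Y ⟶ B} {g : C ⟶ B}

variable (f p) in
/-- The map `a ↦ d (f^♯ a)`. -/
def dMap (U : Y.Opens) : Γ(Y, U) →+ Γ((pushforward f).obj (kaehler p), U) :=
  (dSection p (f ⁻¹ᵁ U)).comp (f.app U).hom.toAddMonoidHom

lemma dMap_mul (U : Y.Opens) (a b : Γ(Y, U)) :
    dMap f p U (a * b) = a • dMap f p U b + b • dMap f p U a := by
  change dSection p (f ⁻¹ᵁ U) (f.app U (a * b)) = _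
  rw [map_mul, dSection_mul]
  rfl

lemma dMap_map {U V : Y.Opens} (i : U ⟶ V) (a : Γ(Y, V)) :
    dMap f p U (Y.presheaf.map i.op a) =
      ((pushforward f).obj (kaehler p)).presheaf.map i.op (dMap f p V a) := by
  have h : f.app U (Y.presheaf.map i.op a) =
      X.presheaf.map ((Opens.map f.base).map i).op (f.app V a) :=
    congrArg (fun φ ↦ φ.hom a) (f.naturality i.op)
  refine (congrArg (dSection p (f ⁻¹ᵁ U)) h).trans ?_
  exact dSection_map p ((Opens.map f.base).map i) (f.app V a)

lemma dMap_inverseImageHom (w : f ≫ π = p ≫ g) (U : Y.Opens) (s : (inverseImage π).obj (op U)) :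
    dMap f p U ((inverseImageHom π).app (op U) s) = 0 := by
  obtain ⟨ψ, hψ⟩ := exists_inverseImage_lift w
  have h : f.app U ((inverseImageHom π).app (op U) s) =
      (inverseImageHom p).app (op (f ⁻¹ᵁ U)) (ψ.app (op U) s) :=
    congrArg (fun φ ↦ φ.hom s) (NatTrans.congr_app hψ (op U))
  refine (congrArg (dSection p (f ⁻¹ᵁ U)) h).trans ?_
  exact dSection_inverseImageHom p (f ⁻¹ᵁ U) (ψ.app (op U) s)

/-- For a commutative square `f ≫ π = p ≫ g`, the derivation `a ↦ d (f^♯ a)` of `𝒪_Y` with values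
in `f_* Ω_p`. -/
def kaehlerMapDerivation (w : f ≫ π = p ≫ g) : _root_.PresheafOfModules.Derivation'
    ((toPresheafOfModules Y).obj ((pushforward f).obj (kaehler p))) (inverseImageHom π) where
  d {U} := dMap f p U.unop
  d_mul {U} a b := dMap_mul U.unop a b
  d_map i a := dMap_map i.unop a
  d_app {U} a := dMap_inverseImageHom w U.unop a

end

/-- For a commutative square `f ≫ π = p ≫ g`, the canonical map `Ω_π ⟶ f_* Ω_p`, `d a ↦ d (f^♯ a)`,
which corresponds to the canonical map `f^* Ω_π ⟶ Ω_p`. -/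
def kaehlerMap {f : X ⟶ Y} {p : X ⟶ C} {π : Y ⟶ B} {g : C ⟶ B} (w : f ≫ π = p ≫ g) :
    kaehler π ⟶ (pushforward f).obj (kaehler p) :=
  ((PresheafOfModules.sheafificationAdjunction (𝟙 Y.ringCatSheaf.obj)).homEquiv _ _).symm
    ((_root_.PresheafOfModules.DifferentialsConstruction.isUniversal' (inverseImageHom π)).desc
      (kaehlerMapDerivation w))

end Differentials

section TOne

variable {X Y B C : Scheme.{u}}

variable (X) in
/-- The structure sheaf `𝒪_X` as an `𝒪_X`-module. -/
abbrev structureSheaf : X.Modules := SheafOfModules.unit X.ringCatSheaf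

/-- The map `f^♯ : 𝒪_Y ⟶ f_* 𝒪_X`. -/
def sharp (f : X ⟶ Y) : structureSheaf Y ⟶ (pushforward f).obj (structureSheaf X) :=
  SheafOfModules.unitToPushforwardObjUnit f.toRingCatSheafHom

lemma sharp_app (f : X ⟶ Y) (U : Y.Opens) (a : Γ(Y, U)) :
    (sharp f).app U a = f.app U a := rfl

lemma kaehlerMap_app_dSection {f : X ⟶ Y} {p : X ⟶ C} {π : Y ⟶ B} {g : C ⟶ B} 
    (w : f ≫ π = p ≫ g) (U : Y.Opens) (a : Γ(Y, U)) :
    (kaehlerMap w).app U (dSection π U a) = dSection p (f ⁻¹ᵁ U) (f.app U a) := by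
  have h₁ := ((PresheafOfModules.sheafificationAdjunction (𝟙 Y.ringCatSheaf.obj)).homEquiv_unit
    (f := kaehlerMap w)).symm.trans (Equiv.apply_symm_apply _ _)
  have h₂ := congrArg (fun φ ↦ (φ.app (op U)).hom (CommRingCat.KaehlerDifferential.d a)) h₁
  refine h₂.trans ?_
  exact ModuleCat.Derivation.desc_d ((kaehlerMapDerivation w).app (op U)) a

/-- The restriction `M|_V ⟶ (f|_V)_* (N|_{f⁻¹ V})` of a map `M ⟶ f_* N` to an open `V`. -/
def restrictMap (f : X ⟶ Y) {M : Y.Modules} {N : X.Modules} (κ : M ⟶ (pushforward f).obj N)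
    (V : Y.Opens) :
    M.restrict V.ι ⟶ (pushforward (f ∣_ V)).obj (N.restrict (f ⁻¹ᵁ V).ι) :=
  ((restrictAdjunction V.ι).homEquiv _ _).symm
    (κ ≫ (pushforward f).map ((restrictAdjunction (f ⁻¹ᵁ V).ι).unit.app N) ≫
      (pushforwardComp (f ⁻¹ᵁ V).ι f).hom.app _ ≫
      (pushforwardCongr (morphismRestrict_ι f V).symm).hom.app _ ≫
      (pushforwardComp (f ∣_ V) V.ι).inv.app _)

/-- The sheaf `T¹_π = 𝓔xt¹(Ω_π, 𝒪_Y)`. -/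
def tOne (π : Y ⟶ B) : Y.Modules := sheafExt 1 (kaehler π) (structureSheaf Y)

/-- Coherence, for modules on locally noetherian schemes. -/
abbrev IsCoherent (M : X.Modules) : Prop := SheafOfModules.IsFinitePresentation M

/-- An extension `0 ⟶ 𝒪_V ⟶ E ⟶ Ω_π|_V ⟶ 0` of `𝒪_V`-modules on an open `V`. -/
structure KaehlerExtension (π : Y ⟶ B) (V : Y.Opens) where
  E : (V : Scheme.{u}).Modules
  i : (structureSheaf Y).restrict V.ι ⟶ E
  q : E ⟶ (kaehler π).restrict V.ι
  w : i ≫ q = 0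
  shortExact : (ShortComplex.mk i q w).ShortExact

/-- The section of `T¹_π` over `V` defined by the class of an extension in `Ext¹(Ω_π|_V, 𝒪_V)`. -/
def KaehlerExtension.toSection {π : Y ⟶ B} {V : Y.Opens} (E : KaehlerExtension π V) :
    Γ(tOne π, V) :=
  extSection V E.shortExact.extClass

/-- For a commutative square `f ≫ π = p ≫ g`, a map `θ : f^* T¹_π ⟶ T¹_p` is the base change map if
it carries the class of an extension `E` of `Ω_π` by `𝒪_Y` on an open `V` to the class of an
extension `E'` of `Ω_p` by `𝒪_X` on `f⁻¹ V` whenever there is a map `φ : E ⟶ f_* E'` which fits in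
a morphism of extensions with the canonical maps `f^♯ : 𝒪_Y ⟶ f_* 𝒪_X` and `Ω_π ⟶ f_* Ω_p`. -/
def IsBaseChangeMap {f : X ⟶ Y} {p : X ⟶ C} {π : Y ⟶ B} {g : C ⟶ B} (w : f ≫ π = p ≫ g)
    (θ : (pullback f).obj (tOne π) ⟶ tOne p) : Prop :=
  ∀ (V : Y.Opens) (E : KaehlerExtension π V) (E' : KaehlerExtension p (f ⁻¹ᵁ V))
    (φ : E.E ⟶ (pushforward (f ∣_ V)).obj E'.E),
    E.i ≫ φ = restrictMap f (sharp f) V ≫ (pushforward (f ∣_ V)).map E'.i →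
    φ ≫ (pushforward (f ∣_ V)).map E'.q = E.q ≫ restrictMap f (kaehlerMap w) V →
    ((pullbackPushforwardAdjunction f).homEquiv _ _ θ).app V E.toSection = E'.toSection

end TOne

end

end AlgebraicGeometry.Scheme.Modules

namespace AlgebraicGeometry

/-- A closed immersion `i : Z ⟶ M` is a regular embedding if every point of `Z` has an affine open
neighbourhood `U` in `M` on which the ideal of `Z` is generated by a regular sequence. -/
def IsRegularEmbedding {Z M : Scheme.{u}} (i : Z ⟶ M) : Prop :=
  IsClosedImmersion i ∧ ∀ z : Z, ∃ U : M.Opens, IsAffineOpen U ∧ i z ∈ U ∧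
    ∃ rs : List Γ(M, U), RingTheory.Sequence.IsRegular Γ(M, U) rs ∧
      RingHom.ker (i.app U).hom = Ideal.ofList rs

/-- A morphism is lci (a local complete intersection) if it is of finite type and, locally on the
source, factors as a regular embedding followed by a smooth morphism of finite type. -/
structure IsLCI {Z W : Scheme.{u}} (q : Z ⟶ W) : Prop where
  locallyOfFiniteType : LocallyOfFiniteType q
  quasiCompact : QuasiCompact q
  exists_factorization (z : Z) : ∃ U : Z.Opens, z ∈ U ∧
    ∃ (M : Scheme.{u}) (i : (U : Scheme.{u}) ⟶ M) (s : M ⟶ W), IsRegularEmbedding i ∧ Smooth s ∧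
      QuasiCompact s ∧ i ≫ s = U.ι ≫ q

/-- A morphism is generically smooth if it is smooth on a dense open subset of the source. -/
def GenericallySmooth {Z W : Scheme.{u}} (q : Z ⟶ W) : Prop :=
  ∃ U : Z.Opens, Dense (U : Set Z) ∧ Smooth (U.ι ≫ q)

/-- Every fibre of the morphism is generically smooth over the residue field. -/
def HasGenericallySmoothFibers {Z W : Scheme.{u}} (q : Z ⟶ W) : Prop :=
  ∀ b : W, GenericallySmooth (q.fiberToSpecResidueField b)

end AlgebraicGeometry

set_option linter.unusedSectionVars false

/-! Locally `π` is `Spec A → Spec R` with `A = P / (f₁, …, f_r)`, where `P` is standard smooth over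
`R` and the `f_i` form a regular sequence. So `Ω_π` is the cokernel of the Jacobian matrix `A^r →
A^n`. Everything rests on this: the matrix is injective, and it stays injective after base change to
any finite `R`-algebra `E`. Given this, `Ω_π` and (for `E = Γ(C, g⁻¹W)`) also `Ω_p` have free
resolutions of length one, given by the same matrix (`hasCompatiblePres_kaehlerMap`). On both sides
`T¹` is the cokernel of the transposed matrix, and cokernels commute with pullback.

Injectivity of the Jacobian. Since `A` is flat over `R`, a prime filtration of `E` reduces the claim
to `E = R/𝔭`, and then to the fibre over `κ(𝔭)` because `R/𝔭` embeds in `κ(𝔭)`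
(`Matrix.HasIndependentRows.of_fiber`). On a fibre the sequence `f` is still regular at the points
of its zero locus, again by flatness of `A` (`IsWeaklyRegular.localization_tensorProduct`). A smooth
algebra over a field is Cohen–Macaulay, so a complete intersection in it has no embedded primes. At
the minimal primes the fibre is smooth, so the conormal map `I/I² → A ⊗ Ω` is split injective, and
`I/I²` is free on the `f_i`. Hence the coefficients of a relation between the rows vanish at every
associated prime, and so vanish (`Algebra.IsStandardSmooth.mem_of_sum_smul_D_mem`).

The global map. As `f` is a closed immersion, `f_*` is exact. A class `x` on `V` and a class `y` on
`f⁻¹V` can therefore be compared in `Ext¹(Ω_π|_V, f_* 𝒪)`; they are partners if they agree there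
(`ExtRel`, `OpenRel`). The compatible resolutions show that every class has a partner locally, in
both directions, and that a partner of `0` is locally `0`. So the assignment `x ↦ y` glues to `θ :
T¹_π ⟶ f_* T¹_p` (`exists_baseChange`). It is an epimorphism, and a section in its kernel is locally
a combination of classes with coefficients killed by `f^♯`, so every map to a direct image kills it.
As `f_*` is fully faithful, the adjoint of `θ` is an isomorphism (`isIso_baseChange`).

Uniqueness. Partners obtained from compatible resolutions are classes of pushout extensions `E`,
`E'` joined by a map `φ : E ⟶ f_* E'` (`exists_kaehlerExtension`), and locally every section of
`T¹_π` is of this kind. -/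

namespace AlgebraicGeometry.Scheme.Modules
noncomputable section

/-! ### Sections of sheaves of modules; exactness of direct image along a closed immersion -/

section Sections

variable {X Y : Scheme.{u}}

/-- Restriction of functions to a smaller open. -/
def resO {U V : X.Opens} (h : V ≤ U) : Γ(X, U) →+* Γ(X, V) := (X.presheaf.map (homOfLE h).op).hom

/-- Restriction of sections of a module to a smaller open. -/
def res (M : X.Modules) {U V : X.Opens} (h : V ≤ U) : Γ(M, U) →+ Γ(M, V) :=
  (M.presheaf.map (homOfLE h).op).hom

lemma resO_resO {U V W : X.Opens} (h : V ≤ U) (h' : W ≤ V) (r : Γ(X, U)) :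
    resO h' (resO h r) = resO (h'.trans h) r :=
  (congrArg (fun φ ↦ φ.hom r) (X.presheaf.map_comp (homOfLE h).op (homOfLE h').op)).symm

lemma resO_self {U : X.Opens} (h : U ≤ U) (r : Γ(X, U)) : resO h r = r :=
  congrArg (fun φ ↦ φ.hom r) (X.presheaf.map_id (op U))

variable (M : X.Modules) {N : X.Modules}

lemma res_res {U V W : X.Opens} (h : V ≤ U) (h' : W ≤ V) (s : Γ(M, U)) :
    M.res h' (M.res h s) = M.res (h'.trans h) s :=
  (congrArg (fun φ ↦ φ.hom s) (M.presheaf.map_comp (homOfLE h).op (homOfLE h').op)).symm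

lemma res_self {U : X.Opens} (h : U ≤ U) (s : Γ(M, U)) : M.res h s = s :=
  congrArg (fun φ ↦ φ.hom s) (M.presheaf.map_id (op U))

lemma res_smul {U V : X.Opens} (h : V ≤ U) (r : Γ(X, U)) (s : Γ(M, U)) :
    M.res h (r • s) = resO h r • M.res h s := M.map_smul (homOfLE h) r s

variable {M}

lemma Hom.app_res (φ : M ⟶ N) {U V : X.Opens} (h : V ≤ U) (s : Γ(M, U)) :
    φ.app V (M.res h s) = N.res h (φ.app U s) :=
  congrArg (fun φ ↦ φ.hom s) (φ.mapPresheaf.naturality (homOfLE h).op)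

lemma section_ext {U : X.Opens} {s t : Γ(M, U)}
    (h : ∀ x ∈ U, ∃ (V : X.Opens) (hV : V ≤ U), x ∈ V ∧ M.res hV s = M.res hV t) : s = t := by
  let F : TopCat.Sheaf Ab.{u} X := ⟨M.presheaf, M.isSheaf⟩
  choose V hV hx e using h
  refine TopCat.Sheaf.eq_of_locally_eq' F (fun x : U ↦ V x.1 x.2) U
    (fun x ↦ homOfLE (hV x.1 x.2)) (fun x hxU ↦ Opens.mem_iSup.2 ⟨⟨x, hxU⟩, hx x hxU⟩) s t ?_
  intro x
  exact e x.1 x.2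

lemma exists_glue {U : X.Opens} {V : U → X.Opens} (hV : ∀ x, V x ≤ U) (hx : ∀ x : U, x.1 ∈ V x)
    (s : ∀ x, Γ(M, V x)) (hs : ∀ x y, M.res inf_le_left (s x) =
      M.res (inf_le_right : V x ⊓ V y ≤ V y) (s y)) :
    ∃ t : Γ(M, U), ∀ x, M.res (hV x) t = s x := by
  let F : TopCat.Sheaf Ab.{u} X := ⟨M.presheaf, M.isSheaf⟩
  obtain ⟨t, ht, -⟩ := TopCat.Sheaf.existsUnique_gluing' F V U (fun x ↦ homOfLE (hV x))
    (fun x hxU ↦ Opens.mem_iSup.2 ⟨⟨x, hxU⟩, hx ⟨x, hxU⟩⟩) s (fun x y ↦ hs x y)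
  exact ⟨t, ht⟩

lemma hom_ext_apply {φ ψ : M ⟶ N} (h : ∀ U (s : Γ(M, U)), φ.app U s = ψ.app U s) : φ = ψ := by
  ext U s
  exact h U s

lemma hom_ext_locally {φ ψ : M ⟶ N} (h : ∀ U (s : Γ(M, U)), ∀ x ∈ U, ∃ (V : X.Opens) (hV : V ≤ U),
    x ∈ V ∧ φ.app V (M.res hV s) = ψ.app V (M.res hV s)) : φ = ψ := by
  refine hom_ext_apply fun U s ↦ section_ext fun x hx ↦ ?_
  obtain ⟨V, hV, hxV, e⟩ := h U s x hx
  exact ⟨V, hV, hxV, by rw [← φ.app_res, ← ψ.app_res, e]⟩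

lemma epi_of_locally_surjective (φ : M ⟶ N) (h : ∀ U (t : Γ(N, U)), ∀ x ∈ U,
    ∃ (V : X.Opens) (hV : V ≤ U) (s : Γ(M, V)), x ∈ V ∧ φ.app V s = N.res hV t) : Epi φ where
  left_cancellation _ _ e := by
    refine hom_ext_locally fun U t x hx ↦ ?_
    obtain ⟨V, hV, s, hxV, hs⟩ := h U t x hx
    refine ⟨V, hV, hxV, ?_⟩
    rw [← hs]
    exact congrArg (fun ψ ↦ ψ.app V s) e

lemma mono_of_injective (φ : M ⟶ N) (h : ∀ U, Function.Injective (φ.app U)) : Mono φ where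
  right_cancellation _ _ e := hom_ext_apply fun U s ↦ h U (congrArg (fun ψ ↦ ψ.app U s) e)

/-- The sheaf of modules associated with a presheaf of modules. -/
abbrev sheafOf (P : X.PresheafOfModules) : X.Modules :=
  (PresheafOfModules.sheafification (𝟙 X.ringCatSheaf.obj)).obj P

/-- The value on sections of the canonical map from a presheaf to its associated sheaf. -/
def toSheafOf (P : X.PresheafOfModules) (U : X.Opens) :
    P.obj (op U) →ₗ[X.ringCatSheaf.obj.obj (op U)] (sheafOf P).val.obj (op U) :=
  (((PresheafOfModules.sheafificationAdjunction (𝟙 X.ringCatSheaf.obj)).unit.app P).app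
        (op U)).hom

lemma toSheafOf_res (P : X.PresheafOfModules) {U V : X.Opens} (h : V ≤ U) (s : P.obj (op U)) :
    toSheafOf P V ((P.map (homOfLE h).op).hom s) =
      res (sheafOf P) h (toSheafOf P U s) :=
  PresheafOfModules.naturality_apply
    ((PresheafOfModules.sheafificationAdjunction (𝟙 X.ringCatSheaf.obj)).unit.app P)
    (homOfLE h).op s

/-- Sections of the sheafification are locally sections of the presheaf. -/
lemma exists_toSheafOf (P : X.PresheafOfModules) {U : X.Opens} (s : Γ(sheafOf P, U)) {x : X}
    (hx : x ∈ U) : ∃ (V : X.Opens) (hV : V ≤ U) (t : P.obj (op V)), x ∈ V ∧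
      toSheafOf P V t = res (sheafOf P) hV s := by
  have h : PresheafOfModules.IsLocallySurjective (Opens.grothendieckTopology X)
    ((PresheafOfModules.sheafificationAdjunction (𝟙 X.ringCatSheaf.obj)).unit.app P) := by
    dsimp only [PresheafOfModules.IsLocallySurjective]
    rw [PresheafOfModules.toPresheaf_map_sheafificationAdjunction_unit_app]
    let Q : (Opens X)ᵒᵖ ⥤ AddCommGrpCat.{u} := P.presheaf
    change Presheaf.IsLocallySurjective (Opens.grothendieckTopology X)
      (toSheafify (Opens.grothendieckTopology X) Q)
    infer_instance
  obtain ⟨V, f, ⟨t, ht⟩, hxV⟩ := h.imageSieve_mem (U := U) s x hx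
  exact ⟨V, leOfHom f, t, hxV, ht⟩

/-- Sections of the presheaf which agree in the sheafification agree locally. -/
lemma exists_map_eq_of_toSheafOf_eq (P : X.PresheafOfModules) {U : X.Opens}
    {s t : P.obj (op U)} (h : toSheafOf P U s = toSheafOf P U t) {x : X} (hx : x ∈ U) :
    ∃ (V : X.Opens) (hV : V ≤ U), x ∈ V ∧
      (P.map (homOfLE hV).op).hom s = (P.map (homOfLE hV).op).hom t := by
  have h' : PresheafOfModules.IsLocallyInjective (Opens.grothendieckTopology X)
    ((PresheafOfModules.sheafificationAdjunction (𝟙 X.ringCatSheaf.obj)).unit.app P) := by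
    dsimp only [PresheafOfModules.IsLocallyInjective]
    rw [PresheafOfModules.toPresheaf_map_sheafificationAdjunction_unit_app]
    let Q : (Opens X)ᵒᵖ ⥤ AddCommGrpCat.{u} := P.presheaf
    change Presheaf.IsLocallyInjective (Opens.grothendieckTopology X)
      (toSheafify (Opens.grothendieckTopology X) Q)
    infer_instance
  obtain ⟨V, f, hf, hxV⟩ := h'.equalizerSieve_mem (X := op U) s t h x hx
  exact ⟨V, leOfHom f, hxV, hf⟩

/-- The map `ψ` from `N` to the sheafified presheaf cokernel satisfies `φ ≫ ψ = 0`, hence `ψ = 0`.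
So the class of `t` in the presheaf cokernel dies on a neighbourhood of `x`, and there `t` has a
preimage. -/
lemma exists_app_eq_of_epi (φ : M ⟶ N) [Epi φ] {U : X.Opens} (t : Γ(N, U)) {x : X} (hx : x ∈ U) :
    ∃ (V : X.Opens) (hV : V ≤ U) (s : Γ(M, V)), x ∈ V ∧ φ.app V s = N.res hV t := by
  let φ' : M.val ⟶ N.val := (toPresheafOfModules X).map φ
  let P := cokernel φ'
  let c : N.val ⟶ P := cokernel.π φ'
  let ψ : N ⟶ sheafOf P :=
    ⟨c ≫ (PresheafOfModules.sheafificationAdjunction (𝟙 X.ringCatSheaf.obj)).unit.app P⟩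
  have hψ (U : X.Opens) (t : Γ(N, U)) :
      ψ.app U t = toSheafOf P U ((c.app (op U)).hom t) := rfl
  have hc (U : X.Opens) (s : Γ(M, U)) : (c.app (op U)).hom (φ.app U s) = 0 :=
    congrArg (fun χ ↦ (PresheafOfModules.Hom.app χ (op U)).hom s) (cokernel.condition φ')
  have h0 : φ ≫ ψ = φ ≫ 0 := hom_ext_apply fun U s ↦ by
    refine (hψ U (φ.app U s)).trans ?_
    rw [hc, map_zero, comp_zero]
    rfl
  rw [cancel_epi] at h0
  have h1 : toSheafOf P U ((c.app (op U)).hom t) = toSheafOf P U 0 := by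
    rw [map_zero]
    exact congrArg (fun χ : N ⟶ sheafOf P ↦ χ.app U t) h0
  obtain ⟨V, hV, hxV, e⟩ := exists_map_eq_of_toSheafOf_eq P h1 hx
  have h2 : (c.app (op V)).hom (N.res hV t) = 0 := by
    refine Eq.trans ?_ (e.trans (map_zero _))
    exact (PresheafOfModules.naturality_apply c (homOfLE hV).op t)
  have ex := (ShortComplex.exact_cokernel φ').map (PresheafOfModules.evaluation _ (op V))
  rw [ShortComplex.moduleCat_exact_iff] at ex
  obtain ⟨s, hs⟩ := ex (N.res hV t) h2
  exact ⟨V, hV, s, hxV, hs⟩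

lemma app_injective_of_mono (φ : M ⟶ N) [Mono φ] (U : X.Opens) :
    Function.Injective (φ.app U) := by
  have : Mono ((toPresheafOfModules X).map φ) := inferInstance
  exact PresheafOfModules.injective_of_mono ((toPresheafOfModules X).map φ) (op U)

/-- Opens of `X` are traces of opens of `Y`, so a lift near `x` lives on the preimage of a
neighbourhood of `f x`. A point outside the closed image has a neighbourhood with empty preimage,
where all sections of a direct image vanish. -/
lemma pushforward_epi (f : X ⟶ Y) [IsClosedImmersion f] (φ : M ⟶ N) [Epi φ] :
    Epi ((pushforward f).map φ) := by
  refine epi_of_locally_surjective _ fun U t y hy ↦ ?_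
  by_cases hyf : y ∈ Set.range f
  · obtain ⟨x, rfl⟩ := hyf
    obtain ⟨V, hV, s, hxV, hs⟩ := exists_app_eq_of_epi φ (U := f ⁻¹ᵁ U) t hy
    obtain ⟨W, hW, hWV⟩ := f.isEmbedding.isInducing.isOpen_iff.1 V.2
    have h : f ⁻¹ᵁ (⟨W, hW⟩ ⊓ U) ≤ V := fun z hz ↦ by
      have : z ∈ f ⁻¹' W := hz.1
      rwa [hWV] at this
    refine ⟨⟨W, hW⟩ ⊓ U, inf_le_right, M.res h s, ⟨?_, hy⟩, ?_⟩
    · have : x ∈ f ⁻¹' W := hWV ▸ hxV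
      exact this
    · refine (φ.app_res h s).trans ?_
      rw [hs]
      exact res_res _ _ _ _
  · let W : Y.Opens := ⟨(Set.range f)ᶜ, f.isClosedEmbedding.isClosed_range.isOpen_compl⟩ ⊓ U
    refine ⟨W, inf_le_right, 0, ⟨hyf, hy⟩, ?_⟩
    exact section_ext (M := N) (U := f ⁻¹ᵁ W) fun x hx ↦ (hx.1 ⟨x, rfl⟩).elim

instance (f : X ⟶ Y) : PreservesFiniteLimits (pushforward f) :=
  PreservesLimitsOfSize.preservesFiniteLimits.{u, u} _

/-- Pushforward along a closed immersion is exact. -/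
instance (f : X ⟶ Y) [IsClosedImmersion f] : PreservesFiniteColimits (pushforward f) := by
  have : (pushforward f).PreservesEpimorphisms := ⟨fun φ _ ↦ pushforward_epi f φ⟩
  have := Functor.preservesHomology_of_preservesEpis_and_kernels (pushforward f)
  exact Functor.preservesFiniteColimits_of_preservesHomology _

end Sections

end
end AlgebraicGeometry.Scheme.Modules

namespace AlgebraicGeometry.Scheme.Modules
noncomputable section

/-! ### Sections of `𝓔xt` defined by extension classes -/

section ExtSection

variable {X : Scheme.{u}} {n : ℕ} {F G : X.Modules}

lemma extSection_add {U : X.Opens} (x y : Ext.{u} (F.restrict U.ι) (G.restrict U.ι) n) :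
    extSection U (x + y) = extSection U x + extSection U y :=
  map_add (toSheafOf (extPresheaf n F G) U) x y

lemma extSection_zero {U : X.Opens} :
    extSection U (0 : Ext.{u} (F.restrict U.ι) (G.restrict U.ι) n) = 0 :=
  map_zero (toSheafOf (extPresheaf n F G) U)

lemma extSection_smul {U : X.Opens} (r : Γ(X, U))
    (x : Ext.{u} (F.restrict U.ι) (G.restrict U.ι) n) :
    extSection U (r • x) = r • extSection U x :=
  (toSheafOf (extPresheaf n F G) U).map_smul r x

lemma extSection_sum {U : X.Opens} {ι : Type*} (s : Finset ι)
    (x : ι → Ext.{u} (F.restrict U.ι) (G.restrict U.ι) n) :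
    extSection U (∑ i ∈ s, x i) = ∑ i ∈ s, extSection U (x i) :=
  map_sum (toSheafOf (extPresheaf n F G) U) x s

lemma extSection_extRes {U V : X.Opens} (h : V ≤ U)
    (x : Ext.{u} (F.restrict U.ι) (G.restrict U.ι) n) :
    extSection V (extRes n F G h x) = res (sheafExt n F G) h (extSection U x) :=
  toSheafOf_res (extPresheaf n F G) h x

lemma exists_extSection {U : X.Opens} (s : Γ(sheafExt n F G, U)) {x : X} (hx : x ∈ U) :
    ∃ (V : X.Opens) (hV : V ≤ U) (y : Ext.{u} (F.restrict V.ι) (G.restrict V.ι) n), x ∈ V ∧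
      extSection V y = res (sheafExt n F G) hV s :=
  exists_toSheafOf (extPresheaf n F G) s hx

lemma exists_extRes_eq_zero {U : X.Opens} {y : Ext.{u} (F.restrict U.ι) (G.restrict U.ι) n}
    (h : extSection U y = 0) {x : X} (hx : x ∈ U) :
    ∃ (V : X.Opens) (hV : V ≤ U), x ∈ V ∧ extRes n F G hV y = 0 := by
  obtain ⟨V, hV, hxV, e⟩ := exists_map_eq_of_toSheafOf_eq (extPresheaf n F G) (s := y) (t := 0)
    (h.trans (map_zero (toSheafOf (extPresheaf n F G) U)).symm) hx
  refine ⟨V, hV, hxV, e.trans (map_zero _)⟩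

end ExtSection

/-! ### Restriction of maps `M ⟶ f_* N` along squares of open immersions -/

section RestrictMap

variable {X Y U U' V V' : Scheme.{u}} {f : X ⟶ Y} {i : U ⟶ Y} {i' : U' ⟶ X} {φ : U' ⟶ U}
  [IsOpenImmersion i] [IsOpenImmersion i']
  {M : Y.Modules} {N : X.Modules}

lemma image_preimage_le_of_comm (w : φ ≫ i = i' ≫ f) (T : U.Opens) :
    i' ''ᵁ (φ ⁻¹ᵁ T) ≤ f ⁻¹ᵁ (i ''ᵁ T) := by
  rintro _ ⟨x, hx, rfl⟩
  refine ⟨φ x, hx, ?_⟩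
  exact congrArg (fun g : U' ⟶ Y ↦ g x) w

lemma preimage_preimage_of_comm (w : φ ≫ i = i' ≫ f) (T : Y.Opens) :
    i' ⁻¹ᵁ (f ⁻¹ᵁ T) = φ ⁻¹ᵁ (i ⁻¹ᵁ T) := by
  change (i' ≫ f) ⁻¹ᵁ T = (φ ≫ i) ⁻¹ᵁ T
  rw [w]

/-- The map `M ⟶ i_* φ_* (N|_{U'})` induced by a map `M ⟶ f_* N`. -/
def restrictMapAlongAux (w : φ ≫ i = i' ≫ f) (κ : M ⟶ (pushforward f).obj N) :
    M ⟶ (pushforward i).obj ((pushforward φ).obj (N.restrict i')) :=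
  κ ≫ (pushforward f).map ((restrictAdjunction i').unit.app N) ≫
      (pushforwardComp i' f).hom.app _ ≫
      (pushforwardCongr w.symm).hom.app _ ≫
      (pushforwardComp φ i).inv.app _

lemma restrictMapAlongAux_app (w : φ ≫ i = i' ≫ f) (κ : M ⟶ (pushforward f).obj N) (T : Y.Opens)
    (s : Γ(M, T)) : (restrictMapAlongAux w κ).app T s =
      N.res ((Scheme.Hom.image_mono i' (preimage_preimage_of_comm w T).ge).trans
        (i'.image_preimage_le _)) (κ.app T s) := by
  have h1 := restrictAdjunction_unit_app_app i' N (f ⁻¹ᵁ T)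
  have h2 := pushforwardCongr_hom_app_app w.symm T (M := N.restrict i')
  refine (congrArg₂ (fun a b ↦ b.hom (a.hom (κ.app T s))) h1 h2).trans ?_
  exact N.res_res _ _ _

/-- The map `M|_U ⟶ φ_* (N|_{U'})` induced by a map `M ⟶ f_* N`. -/
def restrictMapAlong (w : φ ≫ i = i' ≫ f)
    (κ : M ⟶ (pushforward f).obj N) : M.restrict i ⟶ (pushforward φ).obj (N.restrict i') :=
  ((restrictAdjunction i).homEquiv _ _).symm (restrictMapAlongAux w κ)

/-- The compatibilities below are checked on sections through this formula. For the square of `f ∣_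
V` the map is `restrictMap f κ V` by definition. -/
lemma restrictMapAlong_app (w : φ ≫ i = i' ≫ f)
    (κ : M ⟶ (pushforward f).obj N) (T : U.Opens) (s : Γ(M, i ''ᵁ T)) :
    (restrictMapAlong w κ).app T s =
      N.res (image_preimage_le_of_comm w T) (κ.app (i ''ᵁ T) s) := by
  rw [restrictMapAlong, Adjunction.homEquiv_counit]
  have h1 := restrictAdjunction_counit_app_app i ((pushforward φ).obj (N.restrict i')) T
  have h2 := restrictMapAlongAux_app w κ (i ''ᵁ T) s
  refine (congrArg₂ (fun a b ↦ a.hom b) h1 h2).trans ?_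
  exact N.res_res _ _ _

end RestrictMap

end
end AlgebraicGeometry.Scheme.Modules

namespace AlgebraicGeometry.Scheme.Modules
noncomputable section

/-! ### Compatibility of extension classes on `Y` and on `X` -/

section ExtRel

variable {X Y U U' V V' : Scheme.{u}} {f : X ⟶ Y} {i : U ⟶ Y} {i' : U' ⟶ X} {φ : U' ⟶ U}
  [IsOpenImmersion i] [IsOpenImmersion i']

lemma restrictMapAlong_comp (w : φ ≫ i = i' ≫ f) {L M : Y.Modules} {N : X.Modules} (χ : L ⟶ M)
    (κ : M ⟶ (pushforward f).obj N) :
    restrictMapAlong w (χ ≫ κ) = (restrictFunctor i).map χ ≫ restrictMapAlong w κ :=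
  hom_ext_apply fun T s ↦ (restrictMapAlong_app w (χ ≫ κ) T s).trans
    (restrictMapAlong_app w κ T (χ.app (i ''ᵁ T) s)).symm

lemma restrictMapAlong_comp_map (w : φ ≫ i = i' ≫ f) {M : Y.Modules} {N N' : X.Modules}
    (κ : M ⟶ (pushforward f).obj N) (χ : N ⟶ N') :
    restrictMapAlong w (κ ≫ (pushforward f).map χ) =
      restrictMapAlong w κ ≫ (pushforward φ).map ((restrictFunctor i').map χ) :=
  hom_ext_apply fun T s ↦ (restrictMapAlong_app w _ T s).trans <|
    (χ.app_res (image_preimage_le_of_comm w T) (κ.app (i ''ᵁ T) s)).symm.trans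
      (congrArg (χ.app (i' ''ᵁ (φ ⁻¹ᵁ T))) (restrictMapAlong_app w κ T s).symm)

lemma restrictMapAlong_id_naturality (w : φ ≫ i = i' ≫ f) {N N' : X.Modules} (χ : N ⟶ N') :
    (restrictFunctor i).map ((pushforward f).map χ) ≫ restrictMapAlong w (𝟙 ((pushforward f).obj N')) =
      restrictMapAlong w (𝟙 ((pushforward f).obj N)) ≫
        (pushforward φ).map ((restrictFunctor i').map χ) := by
  rw [← restrictMapAlong_comp, ← restrictMapAlong_comp_map, Category.comp_id, Category.id_comp]

/-- The base change map from the restriction of a direct image to the direct image of a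
restriction. -/
def pushforwardRestrict (w : φ ≫ i = i' ≫ f) :
    pushforward f ⋙ restrictFunctor i ⟶ restrictFunctor i' ⋙ pushforward φ := by
  refine NatTrans.mk (fun N ↦ (show (restrictFunctor i).obj ((pushforward f).obj N) ⟶
    (pushforward φ).obj ((restrictFunctor i').obj N) from
      restrictMapAlong w (𝟙 ((pushforward f).obj N)))) ?_
  intro N N' χ
  exact restrictMapAlong_id_naturality w χ

/-- On sections both sides are `κ` followed by one restriction of `N`. This transitivity lets the
relation between Ext classes pass to smaller opens. -/
lemma restrictComp_restrictMapAlong {j : V ⟶ U} {k : V ⟶ Y} {j' : V' ⟶ U'} {k' : V' ⟶ X}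
    {ψ : V' ⟶ V} [IsOpenImmersion j] [IsOpenImmersion k] [IsOpenImmersion j'] [IsOpenImmersion k']
    (w : φ ≫ i = i' ≫ f) (wj : ψ ≫ j = j' ≫ φ) (wk : ψ ≫ k = k' ≫ f) (h : j ≫ i = k)
    (h' : j' ≫ i' = k') {M : Y.Modules} {N : X.Modules} (κ : M ⟶ (pushforward f).obj N) :
    (restrictComp h).hom.app M ≫ restrictMapAlong wk κ =
      (restrictFunctor j).map (restrictMapAlong w κ) ≫
        (pushforwardRestrict wj).app (N.restrict i') ≫
          (pushforward ψ).map ((restrictComp h').hom.app N) := by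
  refine hom_ext_apply fun T s ↦ ?_
  have e₁ := congrArg (fun z ↦ z.hom s) (restrictComp_hom_app_app h M T)
  have e₂ (t) := congrArg (fun z ↦ z.hom t) (restrictComp_hom_app_app h' N (ψ ⁻¹ᵁ T))
  have e₃ := restrictMapAlong_app w κ (j ''ᵁ T) s
  have e₄ (t) := restrictMapAlong_app (M := (pushforward φ).obj (N.restrict i')) (N := N.restrict i') wj (𝟙 ((pushforward φ).obj (N.restrict i'))) T t
  have e₅ (t) := restrictMapAlong_app wk κ T t
  refine (congrArg ((restrictMapAlong wk κ).app T) e₁).trans ?_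
  refine (e₅ _).trans ?_
  refine Eq.trans ?_ (e₂ _).symm
  refine Eq.trans ?_ (congrArg (N.presheaf.map _).hom
    ((e₄ _).trans (congrArg (res (N.restrict i') _) e₃)).symm)
  refine (congrArg (N.res _) (κ.app_res (le_image_image h T) s)).trans ?_
  refine (N.res_res _ _ _).trans ?_
  symm
  refine (N.res_res (V := i' ''ᵁ (j' ''ᵁ (ψ ⁻¹ᵁ T))) _ _ _).trans ?_
  exact (N.res_res _ _ _)

lemma sharp_smulHom (r : Γ(Y, ⊤)) {M : Y.Modules} {N : X.Modules} (κ : M ⟶ (pushforward f).obj N) :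
    smulHom r M ≫ κ = κ ≫ (pushforward f).map (smulHom (f.appTop r) N) := by
  rw [← comp_smulHom]
  congr 1
  refine hom_ext_apply fun T s ↦ ?_
  have h : f.app T (toOpens Y T r) = toOpens X (f ⁻¹ᵁ T) (f.appTop r) :=
    congrArg (fun φ : Γ(Y, ⊤) ⟶ Γ(X, f ⁻¹ᵁ T) ↦ φ.hom r) (f.naturality (homOfLE le_top).op)
  exact congrArg (fun a : Γ(X, f ⁻¹ᵁ T) ↦ a • (show Γ(N, f ⁻¹ᵁ T) from s)) h

variable [IsClosedImmersion φ] {F G : Y.Modules} {F' G' : X.Modules}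
  {κ : F ⟶ (pushforward f).obj F'} {σ : G ⟶ (pushforward f).obj G'} {n : ℕ}

/-- Given maps `F ⟶ f_* F'` and `G ⟶ f_* G'`, the classes `x` of an extension of `F|_U` by `G|_U`
and `y` of an extension of `F'|_{U'}` by `G'|_{U'}` are compatible if they agree in
`Ext(F|_U, φ_* G'|_{U'})`. -/
def ExtRel (w : φ ≫ i = i' ≫ f) (κ : F ⟶ (pushforward f).obj F') (σ : G ⟶ (pushforward f).obj G')
    (x : Ext.{u} (F.restrict i) (G.restrict i) n) (y : Ext.{u} (F'.restrict i') (G'.restrict i') n) :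
    Prop :=
  x.comp (Ext.mk₀ (restrictMapAlong w σ)) (add_zero n) =
    (Ext.mk₀ (restrictMapAlong w κ)).comp (y.mapExactFunctor (pushforward φ)) (zero_add n)

namespace ExtRel

variable {w : φ ≫ i = i' ≫ f} {x x₁ x₂ : Ext.{u} (F.restrict i) (G.restrict i) n}
  {y y₁ y₂ : Ext.{u} (F'.restrict i') (G'.restrict i') n}

lemma add (h₁ : ExtRel w κ σ x₁ y₁) (h₂ : ExtRel w κ σ x₂ y₂) :
    ExtRel w κ σ (x₁ + x₂) (y₁ + y₂) := by
  rw [ExtRel] at *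
  rw [Ext.add_comp, Ext.mapExactFunctor_add, Ext.comp_add, h₁, h₂]

lemma smul (h : ExtRel w κ σ x y) (r : Γ(U, ⊤)) : ExtRel w κ σ (r • x) (φ.appTop r • y) := by
  rw [ExtRel] at *
  rw [Ext.smul_eq_comp_mk₀, Ext.smul_eq_comp_mk₀, smul_def, smul_def, Category.id_comp,
    Category.id_comp, Ext.mapExactFunctor_comp, Ext.mapExactFunctor_mk₀,
    Ext.comp_assoc_of_third_deg_zero, Ext.mk₀_comp_mk₀, sharp_smulHom, ← Ext.mk₀_comp_mk₀,
    ← Ext.comp_assoc_of_third_deg_zero, h, Ext.comp_assoc_of_third_deg_zero]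

lemma restrict {j : V ⟶ U} {k : V ⟶ Y} {j' : V' ⟶ U'} {k' : V' ⟶ X} {ψ : V' ⟶ V}
    [IsOpenImmersion j] [IsOpenImmersion k] [IsOpenImmersion j'] [IsOpenImmersion k']
    [IsClosedImmersion ψ] (hr : ExtRel w κ σ x y) (wj : ψ ≫ j = j' ≫ φ) (wk : ψ ≫ k = k' ≫ f)
    (h : j ≫ i = k) (h' : j' ≫ i' = k') :
    ExtRel wk κ σ (extRestrict F G n h x) (extRestrict F' G' n h' y) := by
  have hx := (extRestrict_eq_iff h x _).1 rfl
  have hy := (extRestrict_eq_iff h' y _).1 rfl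
  -- The hypothesis is restricted along `j`, and the defining relation of the restriction of `y` is
  -- pushed forward along `ψ`. Naturality of Ext in the transformation `pushforwardRestrict` links
  -- the two.
  have e₁ := congrArg (Ext.mapExactFunctor (restrictFunctor j)) hr
  rw [Ext.mapExactFunctor_comp, Ext.mapExactFunctor_comp, Ext.mapExactFunctor_mk₀,
    Ext.mapExactFunctor_mk₀, Ext.mapExactFunctor_mapExactFunctor] at e₁
  have e₂ := congrArg (Ext.mapExactFunctor (pushforward ψ)) hy
  rw [Ext.mapExactFunctor_comp, Ext.mapExactFunctor_comp, Ext.mapExactFunctor_mk₀,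
    Ext.mapExactFunctor_mk₀, Ext.mapExactFunctor_mapExactFunctor] at e₂
  have e₃ := Ext.mapExactFunctor_natTrans (pushforwardRestrict wj) y
  have key : (Ext.mk₀ ((restrictComp h).hom.app F)).comp
      ((extRestrict F G n h x).comp (Ext.mk₀ (restrictMapAlong wk σ)) (add_zero n)) (zero_add n) =
      (Ext.mk₀ ((restrictComp h).hom.app F)).comp ((Ext.mk₀ (restrictMapAlong wk κ)).comp
        ((extRestrict F' G' n h' y).mapExactFunctor (pushforward ψ)) (zero_add n)) (zero_add n) := by
    rw [← Ext.comp_assoc_of_third_deg_zero, ← hx, Ext.comp_assoc_of_third_deg_zero,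
      Ext.mk₀_comp_mk₀, Ext.mk₀_comp_mk₀_assoc, restrictComp_restrictMapAlong w wj wk h h',
      restrictComp_restrictMapAlong w wj wk h h', ← Ext.mk₀_comp_mk₀, ← Ext.mk₀_comp_mk₀,
      ← Ext.comp_assoc_of_third_deg_zero, ← Ext.comp_assoc_of_third_deg_zero, e₁,
      ← Ext.mk₀_comp_mk₀_assoc, ← Ext.mk₀_comp_mk₀_assoc]
    erw [← e₂]
    rw [Ext.comp_assoc_of_third_deg_zero, Ext.comp_assoc_of_third_deg_zero]
    congr 1
    erw [← Ext.comp_assoc_of_third_deg_zero, e₃]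
    exact Ext.comp_assoc_of_third_deg_zero _ _ _ _
  have := congrArg (fun w ↦ (Ext.mk₀ ((restrictComp h).inv.app F)).comp w (zero_add n)) key
  rw [ExtRel]
  simpa only [Ext.mk₀_comp_mk₀_assoc, Iso.inv_hom_id_app_assoc, Iso.inv_hom_id_app,
    Ext.mk₀_id_comp] using this

/-- A morphism of short exact sequences identifies the two images of the extension classes. This
turns the map of extensions in `IsBaseChangeMap` into the relation `ExtRel`. -/
lemma of_extension {E : U.Modules} {E' : U'.Modules} {a : G.restrict i ⟶ E} {b : E ⟶ F.restrict i}
    {a' : G'.restrict i' ⟶ E'} {b' : E' ⟶ F'.restrict i'} {wE : a ≫ b = 0} {wE' : a' ≫ b' = 0}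
    (hE : (ShortComplex.mk a b wE).ShortExact) (hE' : (ShortComplex.mk a' b' wE').ShortExact)
    (χ : E ⟶ (pushforward φ).obj E')
    (h₁ : a ≫ χ = restrictMapAlong w σ ≫ (pushforward φ).map a')
    (h₂ : χ ≫ (pushforward φ).map b' = b ≫ restrictMapAlong w κ) :
    ExtRel w κ σ hE.extClass hE'.extClass := by
  rw [ExtRel, Ext.mapExactFunctor_extClass]
  exact ShortComplex.ShortExact.extClass_naturality hE (hE'.map_of_exact (pushforward φ))
    { τ₁ := restrictMapAlong w σ, τ₂ := χ, τ₃ := restrictMapAlong w κ, comm₁₂ := h₁.symm, comm₂₃ := h₂ }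

end ExtRel

end ExtRel

end
end AlgebraicGeometry.Scheme.Modules

namespace AlgebraicGeometry.Scheme.Modules
noncomputable section

/-! ### Free modules, by their universal property -/

section Free

variable {U V : Scheme.{u}}

/-- A module is free on a family of global sections if homomorphisms out of it are uniquely
determined by arbitrary values on the family. -/
def IsFreeOn (E : U.Modules) {ι : Type*} (e : ι → Γ(E, ⊤)) : Prop :=
  ∀ (M : U.Modules) (m : ι → Γ(M, ⊤)), ∃! φ : E ⟶ M, ∀ i, φ.app ⊤ (e i) = m i

namespace IsFreeOn

variable {E : U.Modules} {ι : Type*} {e : ι → Γ(E, ⊤)} (h : IsFreeOn E e)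
include h

lemma exists_hom {M : U.Modules} (m : ι → Γ(M, ⊤)) : ∃ φ : E ⟶ M, ∀ i, φ.app ⊤ (e i) = m i :=
  (h M m).exists

lemma hom_ext {M : U.Modules} {φ ψ : E ⟶ M} (w : ∀ i, φ.app ⊤ (e i) = ψ.app ⊤ (e i)) : φ = ψ :=
  (h M fun i ↦ ψ.app ⊤ (e i)).unique w fun _ ↦ rfl

/-- Maps out of the restriction correspond, by the adjunction of restriction and direct image along
`j`, to maps `E ⟶ j_* M`, and the global sections of `j_* M` are those of `M`. -/
lemma restrict (j : V ⟶ U) [IsOpenImmersion j] :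
    IsFreeOn (E.restrict j) (fun i ↦ (show Γ(E.restrict j, ⊤) from E.res le_top (e i))) := by
  intro M m
  have key (φ : E.restrict j ⟶ M) (i : ι) :
      ((restrictAdjunction j).homEquiv _ _ φ).app ⊤ (e i) =
        φ.app ⊤ (show Γ(E.restrict j, ⊤) from E.res le_top (e i)) := by
    rw [Adjunction.homEquiv_unit]
    exact congrArg (fun z ↦ φ.app ⊤ (z.hom (e i))) (restrictAdjunction_unit_app_app j E ⊤)
  obtain ⟨ψ, hψ, hu⟩ := h ((pushforward j).obj M) m
  refine ⟨((restrictAdjunction j).homEquiv _ _).symm ψ, fun i ↦ ?_, fun φ hφ ↦ ?_⟩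
  · rw [← key, Equiv.apply_symm_apply, hψ]
  · refine ((restrictAdjunction j).homEquiv _ _).injective ?_
    rw [Equiv.apply_symm_apply]
    exact hu _ fun i ↦ (key φ i).trans (hφ i)

end IsFreeOn

end Free

/-! ### Free presentations of length one and their extension classes -/

section FreePres

variable {X Y U U' V V' : Scheme.{u}}

/-- A presentation `0 ⟶ E₁ ⟶ E₀ ⟶ F|_U ⟶ 0` with free modules `E₁`, `E₀` of ranks `r`, `n`. -/
structure FreePres (F : X.Modules) (i : U ⟶ X) [IsOpenImmersion i] (r n : ℕ) where
  {E₁ E₀ : U.Modules}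
  a : E₁ ⟶ E₀
  b : E₀ ⟶ F.restrict i
  w : a ≫ b = 0
  shortExact : (ShortComplex.mk a b w).ShortExact
  e₁ : Fin r → Γ(E₁, ⊤)
  e₀ : Fin n → Γ(E₀, ⊤)
  free₁ : IsFreeOn E₁ e₁
  free₀ : IsFreeOn E₀ e₀

namespace FreePres

variable {F G : X.Modules} {i : U ⟶ X} [IsOpenImmersion i] {r n : ℕ} (P : FreePres F i r n)

/-- The extension class of a presentation. -/
def cls : Ext.{u} (F.restrict i) P.E₁ 1 := P.shortExact.extClass

/-- The extension class of `F|_U` by `M` obtained by pushing out a presentation. -/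
def ext {M : U.Modules} (m : P.E₁ ⟶ M) : Ext.{u} (F.restrict i) M 1 :=
  P.cls.comp (Ext.mk₀ m) (add_zero 1)

lemma ext_add {M : U.Modules} (m m' : P.E₁ ⟶ M) : P.ext (m + m') = P.ext m + P.ext m' := by
  rw [ext, Ext.mk₀_add, Ext.comp_add]
  rfl

lemma ext_sum {M : U.Modules} {ι : Type*} (s : Finset ι) (m : ι → (P.E₁ ⟶ M)) :
    P.ext (∑ i ∈ s, m i) = ∑ i ∈ s, P.ext (m i) :=
  map_sum (AddMonoidHom.mk' (P.ext (M := M)) P.ext_add) m s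

lemma ext_smul {M : U.Modules} (r : Γ(U, ⊤)) (m : P.E₁ ⟶ M) : P.ext (r • m) = r • P.ext m := by
  rw [ext, Ext.mk₀_smul, Ext.comp_smul]
  rfl

lemma ext_comp {M N : U.Modules} (m : P.E₁ ⟶ M) (φ : M ⟶ N) :
    P.ext (m ≫ φ) = (P.ext m).comp (Ext.mk₀ φ) (add_zero 1) := by
  rw [ext, ext, Ext.comp_assoc_of_third_deg_zero, Ext.mk₀_comp_mk₀]

/-- This is exactness of `Hom(E₀, M) → Hom(E₁, M) → Ext¹(F, M)` in the middle: the classes pushed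
out of the presentation are the maps on `E₁` modulo those that extend to `E₀`. -/
lemma ext_eq_zero_iff {M : U.Modules} (m : P.E₁ ⟶ M) :
    P.ext m = 0 ↔ ∃ c : P.E₀ ⟶ M, P.a ≫ c = m := by
  constructor
  · intro h
    obtain ⟨c, hc⟩ := Ext.contravariant_sequence_exact₁ P.shortExact M (Ext.mk₀ m) rfl h
    obtain ⟨c, rfl⟩ := (Ext.mk₀_bijective _ _).2 c
    rw [Ext.mk₀_comp_mk₀] at hc
    exact ⟨c, (Ext.mk₀_bijective _ _).1 hc⟩
  · rintro ⟨c, rfl⟩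
    rw [ext, ← Ext.mk₀_comp_mk₀, ← Ext.comp_assoc_of_third_deg_zero]
    have : P.cls.comp (Ext.mk₀ P.a) (add_zero 1) = 0 :=
      P.shortExact.extClass_comp
    rw [this, Ext.zero_comp]

/-- The restriction of a presentation. -/
def restrict {j : V ⟶ U} {k : V ⟶ X} [IsOpenImmersion j] [IsOpenImmersion k] (h : j ≫ i = k) :
    FreePres F k r n where
  a := (restrictFunctor j).map P.a
  b := (restrictFunctor j).map P.b ≫ (restrictComp h).hom.app F
  w := by rw [← Category.assoc, ← Functor.map_comp, P.w, Functor.map_zero, zero_comp]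
  shortExact := ShortComplex.shortExact_of_iso
    (ShortComplex.isoMk (S₁ := (ShortComplex.mk P.a P.b P.w).map (restrictFunctor j))
      (Iso.refl _) (Iso.refl _) ((restrictComp h).app F)
      ((Category.id_comp _).trans (Category.comp_id _).symm) (Category.id_comp _)) (P.shortExact.map_of_exact (restrictFunctor j))
  e₁ t := P.E₁.res le_top (P.e₁ t)
  e₀ t := P.E₀.res le_top (P.e₀ t)
  free₁ := P.free₁.restrict j
  free₀ := P.free₀.restrict j

lemma cls_restrict {j : V ⟶ U} {k : V ⟶ X} [IsOpenImmersion j] [IsOpenImmersion k]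
    (h : j ≫ i = k) : P.cls.mapExactFunctor (restrictFunctor j) =
      (Ext.mk₀ ((restrictComp h).hom.app F)).comp (P.restrict h).cls (zero_add 1) := by
  have e := ShortComplex.ShortExact.extClass_naturality
    (P.shortExact.map_of_exact (restrictFunctor j)) (P.restrict h).shortExact
    { τ₁ := 𝟙 _
      τ₂ := 𝟙 _
      τ₃ := (restrictComp h).hom.app F
      comm₁₂ := (Category.id_comp _).trans (Category.comp_id _).symm
      comm₂₃ := Category.id_comp _ }
  exact (Ext.mapExactFunctor_extClass _ P.shortExact).trans ((Ext.comp_mk₀_id _).symm.trans e)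

lemma extRestrict_ext {j : V ⟶ U} {k : V ⟶ X} [IsOpenImmersion j] [IsOpenImmersion k]
    (h : j ≫ i = k) (m : P.E₁ ⟶ G.restrict i) :
    extRestrict F G 1 h (P.ext m) =
      (P.restrict h).ext ((restrictFunctor j).map m ≫ (restrictComp h).hom.app G) := by
  rw [extRestrict_eq_iff, ext, Ext.mapExactFunctor_comp, Ext.mapExactFunctor_mk₀,
    Ext.comp_assoc_of_third_deg_zero, Ext.mk₀_comp_mk₀]
  refine (congrArg (fun z ↦ z.comp (Ext.mk₀ ((restrictFunctor j).map m ≫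
    (restrictComp h).hom.app G)) (add_zero 1)) (cls_restrict P h)).trans ?_
  exact Ext.comp_assoc_of_third_deg_zero _ _ _ _

end FreePres

lemma restrictMapAlong_app_res_top {φ : U' ⟶ U} {j : V ⟶ U} {j' : V' ⟶ U'} {ψ : V' ⟶ V}
    [IsOpenImmersion j] [IsOpenImmersion j'] (wj : ψ ≫ j = j' ≫ φ) {E : U.Modules} {E' : U'.Modules}
    (τ : E ⟶ (pushforward φ).obj E') {t : Γ(E, ⊤)} {t' : Γ(E', ⊤)} (h : τ.app ⊤ t = t') :
    (restrictMapAlong wj τ).app ⊤ (show Γ(E.restrict j, ⊤) from E.res le_top t) =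
      (show Γ(E'.restrict j', ⊤) from E'.res le_top t') := by
  refine (restrictMapAlong_app wj τ ⊤ _).trans ?_
  refine (congrArg (E'.res _) ((τ.app_res _ _).trans (congrArg _ h))).trans ?_
  exact E'.res_res _ _ _

/-- Needed for the right-hand square of a morphism of presentations and, with `sharp f` as `κ`, for
pairs of compatible linear forms. -/
lemma restrictMapAlong_square {f : X ⟶ Y} {i : U ⟶ Y} {i' : U' ⟶ X} {φ : U' ⟶ U} [IsOpenImmersion i]
    [IsOpenImmersion i'] (w : φ ≫ i = i' ≫ f) {j : V ⟶ U} {k : V ⟶ Y} {j' : V' ⟶ U'} {k' : V' ⟶ X}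
    {ψ : V' ⟶ V} [IsOpenImmersion j] [IsOpenImmersion k] [IsOpenImmersion j'] [IsOpenImmersion k']
    (wj : ψ ≫ j = j' ≫ φ) (wk : ψ ≫ k = k' ≫ f) (h : j ≫ i = k) (h' : j' ≫ i' = k')
    {F : Y.Modules} {F' : X.Modules} {κ : F ⟶ (pushforward f).obj F'} {E : U.Modules}
    {E' : U'.Modules} {τ : E ⟶ (pushforward φ).obj E'} {b : E ⟶ F.restrict i}
    {b' : E' ⟶ F'.restrict i'} (e : τ ≫ (pushforward φ).map b' = b ≫ restrictMapAlong w κ) :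
    restrictMapAlong wj τ ≫
        (pushforward ψ).map ((restrictFunctor j').map b' ≫ (restrictComp h').hom.app F') =
      ((restrictFunctor j).map b ≫ (restrictComp h).hom.app F) ≫ restrictMapAlong wk κ := by
  have e₁ := restrictMapAlong_comp_map wj τ b'
  rw [e, restrictMapAlong_comp] at e₁
  have e₂ := restrictComp_restrictMapAlong w wj wk h h' κ
  have e₃ : restrictMapAlong wj (restrictMapAlong w κ) =
      (restrictFunctor j).map (restrictMapAlong w κ) ≫
        (pushforwardRestrict wj).app (F'.restrict i') := by
    refine (congrArg (restrictMapAlong wj) (Category.comp_id _).symm).trans ?_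
    exact restrictMapAlong_comp wj _ _
  rw [e₃] at e₁
  refine (congrArg (restrictMapAlong wj τ ≫ ·) ((pushforward ψ).map_comp
    ((restrictFunctor j').map b') ((restrictComp h').hom.app F'))).trans ?_
  refine (Category.assoc _ _ _).symm.trans ?_
  refine (congrArg (· ≫ (pushforward ψ).map ((restrictComp h').hom.app F')) e₁.symm).trans ?_
  refine Eq.trans ?_ ((congrArg ((restrictFunctor j).map b ≫ ·) e₂.symm).trans
    (Category.assoc _ _ _).symm)
  simp only [Category.assoc]

/-- A morphism of presentations over a map `κ : F ⟶ f_* F'`, mapping bases to bases. -/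
structure FreePresHom {f : X ⟶ Y} {i : U ⟶ Y} {i' : U' ⟶ X} {φ : U' ⟶ U} [IsOpenImmersion i]
    [IsOpenImmersion i'] (w : φ ≫ i = i' ≫ f) {F : Y.Modules} {F' : X.Modules}
    (κ : F ⟶ (pushforward f).obj F') {r n : ℕ} (P : FreePres F i r n) (P' : FreePres F' i' r n) where
  τ₁ : P.E₁ ⟶ (pushforward φ).obj P'.E₁
  τ₀ : P.E₀ ⟶ (pushforward φ).obj P'.E₀
  comm₁ : P.a ≫ τ₀ = τ₁ ≫ (pushforward φ).map P'.a
  comm₀ : τ₀ ≫ (pushforward φ).map P'.b = P.b ≫ restrictMapAlong w κ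
  τ₁_e₁ (t) : τ₁.app ⊤ (P.e₁ t) = P'.e₁ t
  τ₀_e₀ (t) : τ₀.app ⊤ (P.e₀ t) = P'.e₀ t

namespace FreePresHom

variable {f : X ⟶ Y} {i : U ⟶ Y} {i' : U' ⟶ X} {φ : U' ⟶ U} [IsOpenImmersion i]
    [IsOpenImmersion i'] {w : φ ≫ i = i' ≫ f} {F G : Y.Modules} {F' G' : X.Modules}
    {κ : F ⟶ (pushforward f).obj F'} {σ : G ⟶ (pushforward f).obj G'}
    {r n : ℕ} {P : FreePres F i r n} {P' : FreePres F' i' r n}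

/-- The restriction of a morphism of presentations. -/
def restrict (T : FreePresHom w κ P P') {j : V ⟶ U} {k : V ⟶ Y} {j' : V' ⟶ U'} {k' : V' ⟶ X}
    {ψ : V' ⟶ V} [IsOpenImmersion j] [IsOpenImmersion k] [IsOpenImmersion j'] [IsOpenImmersion k']
    (wj : ψ ≫ j = j' ≫ φ) (wk : ψ ≫ k = k' ≫ f) (h : j ≫ i = k) (h' : j' ≫ i' = k') :
    FreePresHom wk κ (P.restrict h) (P'.restrict h') where
  τ₁ := restrictMapAlong wj T.τ₁
  τ₀ := restrictMapAlong wj T.τ₀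
  comm₁ := by
    refine (restrictMapAlong_comp wj P.a T.τ₀).symm.trans ?_
    rw [T.comm₁]
    exact restrictMapAlong_comp_map wj T.τ₁ P'.a
  comm₀ := restrictMapAlong_square w wj wk h h' T.comm₀
  τ₁_e₁ t := restrictMapAlong_app_res_top wj T.τ₁ (T.τ₁_e₁ t)
  τ₀_e₀ t := restrictMapAlong_app_res_top wj T.τ₀ (T.τ₀_e₀ t)

variable [IsClosedImmersion φ]

lemma cls_naturality (T : FreePresHom w κ P P') : P.cls.comp (Ext.mk₀ T.τ₁) (add_zero 1) =
    (Ext.mk₀ (restrictMapAlong w κ)).comp (P'.cls.mapExactFunctor (pushforward φ)) (zero_add 1) := by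
  have e := ShortComplex.ShortExact.extClass_naturality P.shortExact
    (P'.shortExact.map_of_exact (pushforward φ))
    { τ₁ := T.τ₁, τ₂ := T.τ₀, τ₃ := restrictMapAlong w κ, comm₁₂ := T.comm₁.symm, comm₂₃ := T.comm₀ }
  exact e.trans (congrArg (fun z ↦ (Ext.mk₀ (restrictMapAlong w κ)).comp z (zero_add 1))
    (Ext.mapExactFunctor_extClass (pushforward φ) P'.shortExact).symm)

/-- The classes of the two presentations already agree in `Ext¹(F|_U, φ_* P'.E₁)` by
`cls_naturality`; composing with `m'` carries this over to the pushed out classes. -/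
lemma extRel (T : FreePresHom w κ P P') {m : P.E₁ ⟶ G.restrict i} {m' : P'.E₁ ⟶ G'.restrict i'}
    (h : m ≫ restrictMapAlong w σ = T.τ₁ ≫ (pushforward φ).map m') :
    ExtRel w κ σ (P.ext m) (P'.ext m') := by
  rw [ExtRel, ← P.ext_comp, h, P.ext_comp, FreePres.ext, FreePres.ext, Ext.mapExactFunctor_comp,
    Ext.mapExactFunctor_mk₀, ← Ext.comp_assoc_of_third_deg_zero, cls_naturality]

end FreePresHom

end FreePres

end
end AlgebraicGeometry.Scheme.Modules

namespace AlgebraicGeometry.Scheme.Modules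
noncomputable section

/-! ### Local vanishing of `Ext¹` out of a free module -/

section LocalVanishing

variable {X U V : Scheme.{u}}

/-- Dimension shifting writes `z` as a map `ψ : E ⟶ S.X₃` composed with the class of a short exact
sequence. Near `x` the finitely many values of `ψ` on the basis lift through the epimorphism `S.g`,
so `ψ` factors through `S.g` there and the composite vanishes. -/
lemma IsFreeOn.exists_mapExactFunctor_eq_zero {E : U.Modules} {ι : Type*} [Finite ι]
    {e : ι → Γ(E, ⊤)} (he : IsFreeOn E e) {M : U.Modules} (z : Ext.{u} E M 1) (x : U) :
    ∃ W : U.Opens, x ∈ W ∧ ∀ {V : Scheme.{u}} (j : V ⟶ U) [IsOpenImmersion j], j ''ᵁ ⊤ ≤ W →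
      z.mapExactFunctor (restrictFunctor j) = 0 := by
  obtain ⟨S, hS, rfl, y, rfl⟩ := Ext.exists_eq_comp_extClass z
  obtain ⟨ψ, rfl⟩ := (Ext.mk₀_bijective _ _).2 y
  have := hS.epi_g
  have h (t : ι) := exists_app_eq_of_epi S.g (ψ.app ⊤ (e t)) (x := x) trivial
  choose W hW s hx hs using h
  refine ⟨⟨_, isOpen_iInter_of_finite fun t ↦ (W t).2⟩, Set.mem_iInter.2 hx, fun {V} j _ hj ↦ ?_⟩
  have hj' (t : ι) : j ''ᵁ ⊤ ≤ W t := hj.trans fun y hy ↦ Set.mem_iInter.1 hy t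
  obtain ⟨ℓ, hℓ⟩ := (he.restrict j).exists_hom (M := S.X₂.restrict j)
    fun t ↦ (show Γ(S.X₂.restrict j, ⊤) from S.X₂.res (hj' t) (s t))
  have key : ℓ ≫ (restrictFunctor j).map S.g = (restrictFunctor j).map ψ := by
    refine (he.restrict j).hom_ext fun t ↦ ?_
    refine (congrArg (((restrictFunctor j).map S.g).app ⊤) (hℓ t)).trans ?_
    refine (S.g.app_res (hj' t) (s t)).trans ?_
    rw [hs]
    refine (S.X₃.res_res _ _ _).trans ?_
    exact (ψ.app_res le_top (e t)).symm
  change ((Ext.mk₀ ψ).comp hS.extClass rfl).mapExactFunctor (restrictFunctor j) = 0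
  rw [Ext.mapExactFunctor_comp, Ext.mapExactFunctor_mk₀, ← key, ← Ext.mk₀_comp_mk₀,
    Ext.comp_assoc_of_second_deg_zero, Ext.mapExactFunctor_extClass]
  refine (congrArg (fun z ↦ (Ext.mk₀ ℓ).comp z (zero_add 1))
    (hS.map_of_exact (restrictFunctor j)).comp_extClass).trans ?_
  exact Ext.comp_zero (Ext.mk₀ ℓ) _ 1 1 (zero_add 1)

namespace FreePres

variable {F G : X.Modules} {i : U ⟶ X} [IsOpenImmersion i] {r n : ℕ} (P : FreePres F i r n)

lemma exists_ext_eq_of_comp_eq_zero {M : U.Modules} (x : Ext.{u} (F.restrict i) M 1)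
    (h : (Ext.mk₀ P.b).comp x (zero_add 1) = 0) : ∃ m : P.E₁ ⟶ M, x = P.ext m := by
  obtain ⟨m, hm⟩ := Ext.contravariant_sequence_exact₃ P.shortExact M x h (n₀ := 0) rfl
  obtain ⟨m, rfl⟩ := (Ext.mk₀_bijective _ _).2 m
  exact ⟨m, hm.symm⟩

/-- Extension classes of `F` are locally pushed out of a presentation of `F`. -/
lemma exists_extRestrict_eq_ext (x : Ext.{u} (F.restrict i) (G.restrict i) 1) (y : U) :
    ∃ W : U.Opens, y ∈ W ∧ ∀ {V : Scheme.{u}} (j : V ⟶ U) (k : V ⟶ X) [IsOpenImmersion j]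
      [IsOpenImmersion k] (h : j ≫ i = k), j ''ᵁ ⊤ ≤ W →
      ∃ m : (P.restrict h).E₁ ⟶ G.restrict k, extRestrict F G 1 h x = (P.restrict h).ext m := by
  -- The obstruction to pushing `x` out of the presentation is its pullback to `Ext¹(E₀, G|_U)`,
  -- which vanishes near `y` because `E₀` is free.
  obtain ⟨W, hy, hW⟩ := P.free₀.exists_mapExactFunctor_eq_zero
    ((Ext.mk₀ P.b).comp x (zero_add 1)) y
  refine ⟨W, hy, fun {V} j k _ _ h hj ↦ exists_ext_eq_of_comp_eq_zero _ _ ?_⟩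
  have e := hW j hj
  rw [Ext.mapExactFunctor_comp, Ext.mapExactFunctor_mk₀] at e
  have e' := (extRestrict_eq_iff h x _).1 rfl
  have e'' := congrArg (fun z ↦ z.comp (Ext.mk₀ ((restrictComp h).hom.app G)) (add_zero 1)) e
  replace e'' := (Ext.comp_assoc_of_third_deg_zero _ _ _ _).symm.trans
    (e''.trans (Ext.zero_comp _ _ _ _ _))
  refine Eq.trans ?_ e''
  refine Eq.trans ?_ (congrArg (fun z ↦ (Ext.mk₀ ((restrictFunctor j).map P.b)).comp z
    (zero_add 1)) e').symm
  exact (Ext.mk₀_comp_mk₀_assoc ((restrictFunctor j).map P.b) ((restrictComp h).hom.app F) _).symm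

end FreePres

end LocalVanishing

end
end AlgebraicGeometry.Scheme.Modules

namespace AlgebraicGeometry.Scheme.Modules
noncomputable section

/-! ### Lifting along a closed immersion, and compatible presentations -/

section BaseChange

variable {X Y : Scheme.{u}}

lemma homOfLE_image_top_le {U V : X.Opens} (h : V ≤ U) {W : (U : Scheme.{u}).Opens}
    (hV : V ≤ U.ι ''ᵁ W) : X.homOfLE h ''ᵁ ⊤ ≤ W := by
  rintro _ ⟨z, -, rfl⟩
  have e : U.ι (X.homOfLE h z) = V.ι z := congrArg (fun φ : (V : Scheme.{u}) ⟶ X ↦ φ z) (X.homOfLE_ι h)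
  have hz : V.ι z ∈ V := z.2
  obtain ⟨w, hw, hw'⟩ := hV hz
  have : w = X.homOfLE h z := U.ι.isOpenEmbedding.injective (hw'.trans e.symm)
  exact this ▸ hw

variable (f : X ⟶ Y)

lemma preimage_mono {V W : Y.Opens} (h : W ≤ V) : f ⁻¹ᵁ W ≤ f ⁻¹ᵁ V := fun _ hx ↦ h hx

lemma morphismRestrict_homOfLE {V W : Y.Opens} (h : W ≤ V) :
    f ∣_ W ≫ Y.homOfLE h = X.homOfLE (preimage_mono f h) ≫ f ∣_ V := by
  rw [← cancel_mono V.ι, Category.assoc, Category.assoc, Y.homOfLE_ι, morphismRestrict_ι,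
    morphismRestrict_ι, X.homOfLE_ι_assoc]

lemma exists_preimage_le [IsClosedImmersion f] {V : Y.Opens} {U : X.Opens} {x : X} (hx : x ∈ U)
    (hxV : f x ∈ V) : ∃ W ≤ V, f x ∈ W ∧ f ⁻¹ᵁ W ≤ U := by
  obtain ⟨W, hW, hWU⟩ := f.isEmbedding.isInducing.isOpen_iff.1 U.2
  refine ⟨⟨W, hW⟩ ⊓ V, inf_le_right, ⟨?_, hxV⟩, fun z hz ↦ ?_⟩
  · have : x ∈ f ⁻¹' W := hWU ▸ hx
    exact this
  · have : z ∈ f ⁻¹' W := hz.1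
    rwa [hWU] at this

/-- A closed immersion is surjective on functions over affine opens of the target, so it suffices to
shrink to one. -/
lemma exists_lift_section [IsClosedImmersion f] {V : Y.Opens} (a : Γ(X, f ⁻¹ᵁ V)) {x : X}
    (hx : f x ∈ V) : ∃ (W : Y.Opens) (hW : W ≤ V) (b : Γ(Y, W)), f x ∈ W ∧
      f.app W b = resO (preimage_mono f hW) a := by
  obtain ⟨_, ⟨W, hW, rfl⟩, hxW, hWV⟩ :=
    Y.isBasis_affineOpens.exists_subset_of_mem_open hx V.2
  obtain ⟨b, hb⟩ := f.app_surjective W hW (resO (preimage_mono f hWV) a)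
  exact ⟨W, hWV, b, hxW, hb⟩

lemma exists_lift_sections [IsClosedImmersion f] {V : Y.Opens} {ι : Type*} [Finite ι]
    (a : ι → Γ(X, f ⁻¹ᵁ V)) {x : X} (hx : f x ∈ V) :
    ∃ (W : Y.Opens) (hW : W ≤ V) (b : ι → Γ(Y, W)), f x ∈ W ∧
      ∀ i, f.app W (b i) = resO (preimage_mono f hW) (a i) := by
  choose W hW b hx' hb using fun i ↦ exists_lift_section f (a i) hx
  have h : (⟨_, isOpen_iInter_of_finite fun i ↦ (W i).2⟩ : Y.Opens) ⊓ V ≤ V := inf_le_right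
  have h' (i) : (⟨_, isOpen_iInter_of_finite fun i ↦ (W i).2⟩ : Y.Opens) ⊓ V ≤ W i :=
    fun y hy ↦ Set.mem_iInter.1 hy.1 i
  refine ⟨_, h, fun i ↦ resO (h' i) (b i), ⟨Set.mem_iInter.2 hx', hx⟩, fun i ↦ ?_⟩
  refine (congrArg (fun φ ↦ φ.hom (b i)) (f.naturality (homOfLE (h' i)).op)).trans ?_
  refine (congrArg (resO (preimage_mono f (h' i))) (hb i)).trans ?_
  exact resO_resO _ _ _

variable {f}

variable {F : Y.Modules} {F' : X.Modules} (κ : F ⟶ (pushforward f).obj F')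

/-- Compatibility of a class in `Ext¹(F|_V, 𝒪_V)` with a class in `Ext¹(F'|_{f⁻¹ V}, 𝒪_{f⁻¹ V})`. -/
def OpenRel [IsClosedImmersion f] {V : Y.Opens}
    (x : Ext.{u} (F.restrict V.ι) ((structureSheaf Y).restrict V.ι) 1)
    (y : Ext.{u} (F'.restrict (f ⁻¹ᵁ V).ι) ((structureSheaf X).restrict (f ⁻¹ᵁ V).ι) 1) : Prop :=
  ExtRel (morphismRestrict_ι f V) κ (sharp f) x y

/-- Locally, there are compatible presentations of `F` and `F'` by free modules. -/
def HasCompatiblePres : Prop :=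
  ∀ y : Y, ∃ V : Y.Opens, y ∈ V ∧ ∃ (r n : ℕ) (P : FreePres F V.ι r n)
    (P' : FreePres F' (f ⁻¹ᵁ V).ι r n), Nonempty (FreePresHom (morphismRestrict_ι f V) κ P P')

variable {κ}

/-- The restriction of a morphism of presentations to a smaller open. -/
def FreePresHom.res {V W : Y.Opens} {r n : ℕ} {P : FreePres F V.ι r n}
    {P' : FreePres F' (f ⁻¹ᵁ V).ι r n} (T : FreePresHom (morphismRestrict_ι f V) κ P P')
    (h : W ≤ V) : FreePresHom (morphismRestrict_ι f W) κ (P.restrict (Y.homOfLE_ι h))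
      (P'.restrict (X.homOfLE_ι (preimage_mono f h))) :=
  T.restrict (morphismRestrict_homOfLE f h) _ _ _

lemma HasCompatiblePres.exists_le (hκ : HasCompatiblePres κ) {U : Y.Opens} {y : Y} (hy : y ∈ U) :
    ∃ V ≤ U, y ∈ V ∧ ∃ (r n : ℕ) (P : FreePres F V.ι r n)
      (P' : FreePres F' (f ⁻¹ᵁ V).ι r n), Nonempty (FreePresHom (morphismRestrict_ι f V) κ P P') := by
  obtain ⟨V, hV, r, n, P, P', ⟨T⟩⟩ := hκ y
  exact ⟨V ⊓ U, inf_le_right, ⟨hV, hy⟩, r, n, _, _, ⟨T.res inf_le_left⟩⟩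

variable {V : Y.Opens} {r n : ℕ} {P : FreePres F V.ι r n} {P' : FreePres F' (f ⁻¹ᵁ V).ι r n}

/-- As `P'.E₁` is free, `m'` may be prescribed to take on the basis the images under `f^♯` of the
values of `m`; and `τ₁` matches the bases. -/
lemma FreePresHom.exists_compatible (T : FreePresHom (morphismRestrict_ι f V) κ P P')
    (m : P.E₁ ⟶ (structureSheaf Y).restrict V.ι) :
    ∃ m' : P'.E₁ ⟶ (structureSheaf X).restrict (f ⁻¹ᵁ V).ι,
      m ≫ restrictMapAlong (morphismRestrict_ι f V) (sharp f) =
        T.τ₁ ≫ (pushforward (f ∣_ V)).map m' := by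
  obtain ⟨m', hm'⟩ := P'.free₁.exists_hom fun t ↦
    (restrictMapAlong (morphismRestrict_ι f V) (sharp f)).app ⊤ (m.app ⊤ (P.e₁ t))
  refine ⟨m', P.free₁.hom_ext fun t ↦ (hm' t).symm.trans ?_⟩
  exact congrArg (m'.app ⊤) (T.τ₁_e₁ t).symm

/-- As `τ₀` matches bases, a map from `P.E₀` to `f_* 𝒪_X` is the same as a map from `P'.E₀` to
`𝒪_X`. An extension of the composite to `P.E₀` therefore yields an extension of `m'` to `P'.E₀`.
This injectivity is what makes the base change map well defined. -/
lemma FreePresHom.ext_eq_zero (T : FreePresHom (morphismRestrict_ι f V) κ P P')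
    {m' : P'.E₁ ⟶ (structureSheaf X).restrict (f ⁻¹ᵁ V).ι}
    (h : P.ext (T.τ₁ ≫ (pushforward (f ∣_ V)).map m') = 0) : P'.ext m' = 0 := by
  obtain ⟨c, hc⟩ := (P.ext_eq_zero_iff _).1 h
  obtain ⟨c', hc'⟩ := P'.free₀.exists_hom fun t ↦ c.app ⊤ (P.e₀ t)
  refine (P'.ext_eq_zero_iff _).2 ⟨c', P'.free₁.hom_ext fun t ↦ ?_⟩
  have e : T.τ₀ ≫ (pushforward (f ∣_ V)).map c' = c := P.free₀.hom_ext fun t ↦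
    (congrArg (c'.app ⊤) (T.τ₀_e₀ t)).trans (hc' t)
  rw [← e, ← Category.assoc, T.comm₁, Category.assoc, ← Functor.map_comp] at hc
  rw [← T.τ₁_e₁]
  exact congrArg (fun z ↦ z.app ⊤ (P.e₁ t)) hc

lemma restrict_map_comp_app_top {G : X.Modules} {U U' : Scheme.{u}} {i : U ⟶ X} [IsOpenImmersion i]
    {j : U' ⟶ U} {k : U' ⟶ X} [IsOpenImmersion j] [IsOpenImmersion k] (h : j ≫ i = k)
    {E : U.Modules} (m : E ⟶ G.restrict i) (hk : k ''ᵁ ⊤ ≤ i ''ᵁ ⊤) (t : Γ(E, ⊤)) :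
    ((restrictFunctor j).map m ≫ (restrictComp h).hom.app G).app ⊤ (E.res le_top t) =
      G.res hk (m.app ⊤ t) := by
  have e₂ := m.app_res (le_top : j ''ᵁ ⊤ ≤ ⊤) t
  have e₁ := congrArg (fun φ ↦ φ.hom (m.app (j ''ᵁ ⊤) (E.res le_top t)))
    (restrictComp_hom_app_app h G ⊤)
  have e₃ := G.res_res (Scheme.Hom.image_mono i (le_top : j ''ᵁ ⊤ ≤ ⊤)) (le_image_image h ⊤)
    (m.app ⊤ t)
  have e₄ := congrArg (G.res (le_image_image h ⊤)) e₂
  exact e₁.trans (e₄.trans e₃)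

lemma le_ι_image_top (U : X.Opens) : U ≤ U.ι ''ᵁ ⊤ := fun z hz ↦ ⟨⟨z, hz⟩, trivial, rfl⟩

lemma ι_image_top_le (U : X.Opens) : U.ι ''ᵁ ⊤ ≤ U := by
  rintro _ ⟨z, -, rfl⟩
  exact z.2

/-- A homomorphism downstairs can be restricted and lifted if its values on the basis can. -/
lemma IsFreeOn.exists_lift_of_section {E : (V : Scheme.{u}).Modules}
    {E' : (f ⁻¹ᵁ V : Scheme.{u}).Modules} {ι : Type*} {e : ι → Γ(E, ⊤)} (he : IsFreeOn E e)
    {e' : ι → Γ(E', ⊤)} (τ : E ⟶ (pushforward (f ∣_ V)).obj E') (hτ : ∀ t, τ.app ⊤ (e t) = e' t)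
    {G : Y.Modules} {G' : X.Modules} (σ : G ⟶ (pushforward f).obj G')
    (m' : E' ⟶ G'.restrict (f ⁻¹ᵁ V).ι) {W : Y.Opens} (h : W ≤ V) (b : ι → Γ(G, W))
    (hb : ∀ t, σ.app W (b t) =
      G'.res ((preimage_mono f h).trans (le_ι_image_top _)) (m'.app ⊤ (e' t))) :
    ∃ m : E.restrict (Y.homOfLE h) ⟶ G.restrict W.ι,
      m ≫ restrictMapAlong (morphismRestrict_ι f W) σ =
        restrictMapAlong (morphismRestrict_homOfLE f h) τ ≫
          (pushforward (f ∣_ W)).map ((restrictFunctor (X.homOfLE (preimage_mono f h))).map m' ≫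
            (restrictComp (X.homOfLE_ι (preimage_mono f h))).hom.app G') := by
  obtain ⟨m, hm⟩ := (he.restrict (Y.homOfLE h)).exists_hom fun t ↦
    (show Γ(G.restrict W.ι, ⊤) from G.res (ι_image_top_le W) (b t))
  refine ⟨m, (he.restrict (Y.homOfLE h)).hom_ext fun t ↦ ?_⟩
  have a₁ := restrictMapAlong_app (morphismRestrict_ι f W) σ ⊤
    (show Γ(G.restrict W.ι, ⊤) from G.res (ι_image_top_le W) (b t))
  have a₂ := σ.app_res (ι_image_top_le W) (b t)
  rw [hb t] at a₂
  have a₃ := G'.res_res ((preimage_mono f h).trans (le_ι_image_top _))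
    (preimage_mono f (ι_image_top_le W)) (m'.app ⊤ (e' t))
  have a₄ := G'.res_res (((preimage_mono f h).trans (le_ι_image_top _)).trans' (preimage_mono f
    (ι_image_top_le W))) (image_preimage_le_of_comm (morphismRestrict_ι f W) ⊤) (m'.app ⊤ (e' t))
  have a₅ := congrArg (G'.res (image_preimage_le_of_comm (morphismRestrict_ι f W) ⊤)) (a₂.trans a₃)
  have a₆ := (congrArg ((restrictMapAlong (morphismRestrict_ι f W) σ).app ⊤) (hm t)).trans
    (a₁.trans (a₅.trans a₄))
  have e := restrict_map_comp_app_top (X.homOfLE_ι (preimage_mono f h)) m'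
    (((ι_image_top_le _).trans (preimage_mono f h)).trans (le_ι_image_top _)) (e' t)
  have e₁ := congrArg (((restrictFunctor (X.homOfLE (preimage_mono f h))).map m' ≫
    (restrictComp (X.homOfLE_ι (preimage_mono f h))).hom.app G').app ⊤)
      (restrictMapAlong_app_res_top (morphismRestrict_homOfLE f h) τ (hτ t))
  exact a₆.trans (e₁.trans e).symm

/-- Homomorphisms downstairs locally lift. -/
lemma IsFreeOn.exists_lift [IsClosedImmersion f] {E : (V : Scheme.{u}).Modules}
    {E' : (f ⁻¹ᵁ V : Scheme.{u}).Modules} {ι : Type*} [Finite ι] {e : ι → Γ(E, ⊤)}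
    (he : IsFreeOn E e) {e' : ι → Γ(E', ⊤)} (τ : E ⟶ (pushforward (f ∣_ V)).obj E')
    (hτ : ∀ t, τ.app ⊤ (e t) = e' t) (m' : E' ⟶ (structureSheaf X).restrict (f ⁻¹ᵁ V).ι) {x : X}
    (hx : f x ∈ V) : ∃ (W : Y.Opens) (h : W ≤ V), f x ∈ W ∧
      ∃ m : E.restrict (Y.homOfLE h) ⟶ (structureSheaf Y).restrict W.ι,
        m ≫ restrictMapAlong (morphismRestrict_ι f W) (sharp f) =
          restrictMapAlong (morphismRestrict_homOfLE f h) τ ≫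
          (pushforward (f ∣_ W)).map ((restrictFunctor (X.homOfLE (preimage_mono f h))).map m' ≫
            (restrictComp (X.homOfLE_ι (preimage_mono f h))).hom.app (structureSheaf X)) := by
  obtain ⟨W, h, b, hxW, hb⟩ := exists_lift_sections f (fun t ↦
    (show Γ(X, f ⁻¹ᵁ V) from (structureSheaf X).res (le_ι_image_top _) (m'.app ⊤ (e' t)))) hx
  refine ⟨W, h, hxW, he.exists_lift_of_section τ hτ (sharp f) m' h b fun t ↦ (hb t).trans ?_⟩
  exact (structureSheaf X).res_res _ _ _

variable [IsClosedImmersion f]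

namespace OpenRel

variable {V : Y.Opens} {x x₁ x₂ : Ext.{u} (F.restrict V.ι) ((structureSheaf Y).restrict V.ι) 1}
    {y y₁ y₂ : Ext.{u} (F'.restrict (f ⁻¹ᵁ V).ι) ((structureSheaf X).restrict (f ⁻¹ᵁ V).ι) 1}

lemma add (h₁ : OpenRel κ x₁ y₁) (h₂ : OpenRel κ x₂ y₂) : OpenRel κ (x₁ + x₂) (y₁ + y₂) :=
  ExtRel.add h₁ h₂

lemma smul (h : OpenRel κ x y) (r : Γ(Y, V)) : OpenRel κ (r • x) (f.app V r • y) := by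
  have := ExtRel.smul h (V.topIso.inv r)
  rw [OpenRel, ext_smul_def, ext_smul_def]
  convert this using 2
  have e : (f.app V) ≫ (f ⁻¹ᵁ V).topIso.inv = V.topIso.inv ≫ (f ∣_ V).appTop := by
    rw [morphismRestrict_appTop, Scheme.Opens.topIso_inv, Scheme.Opens.topIso_inv]
    have n := f.naturality (eqToHom V.ι_image_top).op
    refine Eq.symm ((Category.assoc _ _ _).symm.trans ((congrArg (· ≫ X.presheaf.map _) n).trans
      ((Category.assoc _ _ _).trans (congrArg (f.app V ≫ ·) (X.presheaf.map_comp _ _).symm))))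
  exact congrArg (fun φ ↦ φ.hom r) e

lemma sub (h₁ : OpenRel κ x₁ y₁) (h₂ : OpenRel κ x₂ y₂) : OpenRel κ (x₁ - x₂) (y₁ - y₂) := by
  have := h₂.smul (-1)
  rw [map_neg, map_one, neg_one_smul, neg_one_smul] at this
  rw [sub_eq_add_neg, sub_eq_add_neg]
  exact h₁.add this

lemma res {W : Y.Opens} (h : OpenRel κ x y) (hW : W ≤ V) :
    OpenRel κ (extRes 1 _ _ hW x) (extRes 1 _ _ (preimage_mono f hW) y) :=
  ExtRel.restrict h (morphismRestrict_homOfLE f hW) _ _ _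

end OpenRel

end BaseChange

end
end AlgebraicGeometry.Scheme.Modules

namespace AlgebraicGeometry.Scheme.Modules
noncomputable section

/-! ### Construction of the base change map on `𝓔xt¹` -/

section BaseChangeMap

variable {X Y : Scheme.{u}} {f : X ⟶ Y} [IsClosedImmersion f] {F : Y.Modules} {F' : X.Modules}
  {κ : F ⟶ (pushforward f).obj F'}

variable (κ) in
/-- The classes `x`, `y` are pushed out of compatible presentations along compatible maps. -/
def PresRel {V : Y.Opens} (x : Ext.{u} (F.restrict V.ι) ((structureSheaf Y).restrict V.ι) 1)
    (y : Ext.{u} (F'.restrict (f ⁻¹ᵁ V).ι) ((structureSheaf X).restrict (f ⁻¹ᵁ V).ι) 1) : Prop :=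
  ∃ (r n : ℕ) (P : FreePres F V.ι r n) (P' : FreePres F' (f ⁻¹ᵁ V).ι r n)
    (T : FreePresHom (morphismRestrict_ι f V) κ P P') (m : P.E₁ ⟶ (structureSheaf Y).restrict V.ι)
    (m' : P'.E₁ ⟶ (structureSheaf X).restrict (f ⁻¹ᵁ V).ι),
    m ≫ restrictMapAlong (morphismRestrict_ι f V) (sharp f) = T.τ₁ ≫ (pushforward (f ∣_ V)).map m' ∧
      x = P.ext m ∧ y = P'.ext m'

lemma PresRel.openRel {V : Y.Opens} {x : Ext.{u} (F.restrict V.ι) ((structureSheaf Y).restrict V.ι) 1}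
    {y : Ext.{u} (F'.restrict (f ⁻¹ᵁ V).ι) ((structureSheaf X).restrict (f ⁻¹ᵁ V).ι) 1}
    (h : PresRel κ x y) : OpenRel κ x y := by
  obtain ⟨r, n, P, P', T, m, m', h, rfl, rfl⟩ := h
  exact T.extRel h

/-- Since `0` is a partner of `y`, the image of `y` in `Ext¹(F|_V, f_* 𝒪_X)` is zero, and by
`FreePresHom.ext_eq_zero` a class pushed out of the presentation with zero image is zero. -/
lemma PresRel.eq_zero {V : Y.Opens} {x : Ext.{u} (F.restrict V.ι) ((structureSheaf Y).restrict V.ι) 1}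
    {y : Ext.{u} (F'.restrict (f ⁻¹ᵁ V).ι) ((structureSheaf X).restrict (f ⁻¹ᵁ V).ι) 1}
    (h : PresRel κ x y) (h₀ : OpenRel κ 0 y) : y = 0 := by
  obtain ⟨r, n, P, P', T, m, m', h, rfl, rfl⟩ := h
  refine T.ext_eq_zero ?_
  have e₁ : ExtRel (morphismRestrict_ι f V) κ (sharp f) (P.ext m) (P'.ext m') := T.extRel h
  rw [OpenRel, ExtRel, Ext.zero_comp] at h₀
  rw [ExtRel, ← h₀, ← P.ext_comp] at e₁
  rw [← h, e₁]

lemma PresRel.res {V W : Y.Opens} {x : Ext.{u} (F.restrict V.ι) ((structureSheaf Y).restrict V.ι) 1}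
    {y : Ext.{u} (F'.restrict (f ⁻¹ᵁ V).ι) ((structureSheaf X).restrict (f ⁻¹ᵁ V).ι) 1}
    (h : PresRel κ x y) (hW : W ≤ V) :
    PresRel κ (extRes 1 _ _ hW x) (extRes 1 _ _ (preimage_mono f hW) y) := by
  obtain ⟨r, n, P, P', T, m, m', h, rfl, rfl⟩ := h
  exact ⟨r, n, _, _, T.res hW, _, _,
    (restrictMapAlong_square _ (morphismRestrict_homOfLE f hW) _ (Y.homOfLE_ι hW)
      (X.homOfLE_ι (preimage_mono f hW)) h.symm).symm,
    P.extRestrict_ext _ m, P'.extRestrict_ext _ m'⟩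

variable (hκ : HasCompatiblePres κ)
include hκ

/-- After shrinking, `x` is pushed out of the presentation along some `m`, and freeness transports
`m` to a compatible `m'`. -/
lemma HasCompatiblePres.exists_source {V : Y.Opens}
    (x : Ext.{u} (F.restrict V.ι) ((structureSheaf Y).restrict V.ι) 1) {v : Y} (hv : v ∈ V) :
    ∃ (W : Y.Opens) (h : W ≤ V), v ∈ W ∧ ∃ y, PresRel κ (extRes 1 _ _ h x) y := by
  obtain ⟨V₁, h₁, hv₁, r, n, P, P', ⟨T⟩⟩ := hκ.exists_le hv
  obtain ⟨W, hW, hm⟩ := P.exists_extRestrict_eq_ext (extRes 1 _ _ h₁ x) ⟨v, hv₁⟩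
  have h₂ : V₁.ι ''ᵁ W ≤ V₁ := by
    rintro _ ⟨z, -, rfl⟩
    exact z.2
  obtain ⟨m, hm⟩ := hm (Y.homOfLE h₂) (V₁.ι ''ᵁ W).ι (Y.homOfLE_ι h₂) (homOfLE_image_top_le h₂ le_rfl)
  obtain ⟨m', hm'⟩ := (T.res h₂).exists_compatible m
  exact ⟨_, h₂.trans h₁, ⟨_, hW, rfl⟩, _, r, n, _, _, T.res h₂, m, m', hm',
    (extRes_extRes h₁ h₂ x).symm.trans hm, rfl⟩

/-- Beyond the choice of presentations, two shrinkings in `Y` are needed: one makes `y` a class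
pushed out along some `m'`, the other lets the values of `m'` on the basis lift along `f^♯`. Both
are possible only near points of the image of `f`. -/
lemma HasCompatiblePres.exists_target {V : Y.Opens}
    (y : Ext.{u} (F'.restrict (f ⁻¹ᵁ V).ι) ((structureSheaf X).restrict (f ⁻¹ᵁ V).ι) 1) {v : X}
    (hv : f v ∈ V) : ∃ (W : Y.Opens) (h : W ≤ V), f v ∈ W ∧
      ∃ x, PresRel κ x (extRes 1 _ _ (preimage_mono f h) y) := by
  obtain ⟨V₁, h₁, hv₁, r, n, P, P', ⟨T⟩⟩ := hκ.exists_le hv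
  obtain ⟨W, hW, hm⟩ := P'.exists_extRestrict_eq_ext (extRes 1 _ _ (preimage_mono f h₁) y) ⟨v, hv₁⟩
  obtain ⟨V₂, h₂, hv₂, hV₂⟩ := exists_preimage_le f (U := (f ⁻¹ᵁ V₁).ι ''ᵁ W) ⟨_, hW, rfl⟩ hv₁
  obtain ⟨m', hm'⟩ := hm (X.homOfLE (preimage_mono f h₂)) (f ⁻¹ᵁ V₂).ι
    (X.homOfLE_ι (preimage_mono f h₂)) (homOfLE_image_top_le _ hV₂)
  obtain ⟨V₃, h₃, hv₃, m, hm₃⟩ := (P.restrict (Y.homOfLE_ι h₂)).free₁.exists_lift (T.res h₂).τ₁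
    (T.res h₂).τ₁_e₁ m' hv₂
  refine ⟨V₃, (h₃.trans h₂).trans h₁, hv₃, _, r, n, _, _, (T.res h₂).res h₃, m, _, hm₃, rfl, ?_⟩
  refine Eq.trans ?_ (FreePres.extRestrict_ext _ (X.homOfLE_ι (preimage_mono f h₃)) m')
  rw [← hm']
  refine (extRes_extRes (preimage_mono f h₁) (preimage_mono f (h₃.trans h₂)) y).symm.trans ?_
  exact (extRes_extRes (preimage_mono f h₂) (preimage_mono f h₃) _).symm

lemma HasCompatiblePres.extSection_eq_zero {V : Y.Opens}
    {y : Ext.{u} (F'.restrict (f ⁻¹ᵁ V).ι) ((structureSheaf X).restrict (f ⁻¹ᵁ V).ι) 1}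
    (h : OpenRel κ 0 y) : extSection (f ⁻¹ᵁ V) y = 0 := by
  refine section_ext fun v hv ↦ ?_
  obtain ⟨W, hW, hvW, x, hx⟩ := hκ.exists_target y (show f v ∈ V from hv)
  refine ⟨f ⁻¹ᵁ W, preimage_mono f hW, hvW, ?_⟩
  have h' := h.res hW
  rw [map_zero] at h'
  rw [← extSection_extRes, hx.eq_zero h', extSection_zero, map_zero]

lemma HasCompatiblePres.extSection_eq {V : Y.Opens}
    {x : Ext.{u} (F.restrict V.ι) ((structureSheaf Y).restrict V.ι) 1}
    {y₁ y₂ : Ext.{u} (F'.restrict (f ⁻¹ᵁ V).ι) ((structureSheaf X).restrict (f ⁻¹ᵁ V).ι) 1}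
    (h₁ : OpenRel κ x y₁) (h₂ : OpenRel κ x y₂) :
    extSection (f ⁻¹ᵁ V) y₁ = extSection (f ⁻¹ᵁ V) y₂ := by
  have h := h₁.sub h₂
  rw [sub_self] at h
  rw [← sub_eq_zero, ← hκ.extSection_eq_zero h]
  exact (map_sub (toSheafOf (extPresheaf 1 F' (structureSheaf X)) (f ⁻¹ᵁ V)) y₁ y₂).symm

/-- The partners that exist locally glue, because two partners of one class define the same section.
Prescribing the values for all partners on all smaller opens makes the section unique, and this
uniqueness later gives compatibility with restriction. -/
lemma HasCompatiblePres.existsUnique_section {V : Y.Opens}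
    (x : Ext.{u} (F.restrict V.ι) ((structureSheaf Y).restrict V.ι) 1) :
    ∃! s : Γ((pushforward f).obj (sheafExt 1 F' (structureSheaf X)), V),
      ∀ (W : Y.Opens) (h : W ≤ V) y, OpenRel κ (extRes 1 _ _ h x) y →
        res ((pushforward f).obj (sheafExt 1 F' (structureSheaf X))) h s =
          extSection (f ⁻¹ᵁ W) y := by
  choose W hW hvW y hy using fun v : V ↦ hκ.exists_source x v.2
  obtain ⟨s, hs⟩ := exists_glue (M := (pushforward f).obj (sheafExt 1 F' (structureSheaf X)))
    hW hvW (fun v ↦ extSection (f ⁻¹ᵁ W v) (y v)) (fun v v' ↦ by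
      have h₁ := (hy v).openRel.res (inf_le_left : W v ⊓ W v' ≤ W v)
      have h₂ := (hy v').openRel.res (inf_le_right : W v ⊓ W v' ≤ W v')
      rw [extRes_extRes] at h₁ h₂
      have h₃ := hκ.extSection_eq h₁ h₂
      rw [extSection_extRes, extSection_extRes] at h₃
      exact h₃)
  refine ⟨s, fun W' h y' hy' ↦ section_ext fun v hv ↦ ?_, fun t ht ↦ section_ext fun v hv ↦ ?_⟩
  · refine ⟨W ⟨v, h hv⟩ ⊓ W', inf_le_right, ⟨hvW _, hv⟩, ?_⟩
    have h₁ := (hy ⟨v, h hv⟩).openRel.res (inf_le_left : W ⟨v, h hv⟩ ⊓ W' ≤ _)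
    have h₂ := hy'.res (inf_le_right : W ⟨v, h hv⟩ ⊓ W' ≤ W')
    rw [extRes_extRes] at h₁ h₂
    have h₃ := hκ.extSection_eq h₁ h₂
    rw [extSection_extRes, extSection_extRes] at h₃
    refine Eq.trans ?_ h₃
    refine (res_res _ _ _ _).trans ((res_res _ _ _ _).symm.trans (congrArg
      (res ((pushforward f).obj (sheafExt 1 F' (structureSheaf X))) inf_le_left) (hs ⟨v, h hv⟩)))
  · exact ⟨W ⟨v, hv⟩, hW _, hvW _, (ht _ (hW ⟨v, hv⟩) _ (hy ⟨v, hv⟩).openRel).trans (hs _).symm⟩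

lemma HasCompatiblePres.exists_baseChange :
    ∃ θ : sheafExt 1 F (structureSheaf Y) ⟶ (pushforward f).obj (sheafExt 1 F' (structureSheaf X)),
      ∀ (V : Y.Opens) x y, OpenRel κ x y → θ.app V (extSection V x) = extSection (f ⁻¹ᵁ V) y := by
  let T' := (pushforward f).obj (sheafExt 1 F' (structureSheaf X))
  choose s hs hu using fun V : Y.Opens ↦ fun x ↦ hκ.existsUnique_section (V := V) x
  have hadd (V : Y.Opens) (x₁ x₂) : s V (x₁ + x₂) = s V x₁ + s V x₂ := section_ext fun v hv ↦ by
    obtain ⟨W₁, h₁, hv₁, y₁, hy₁⟩ := hκ.exists_source x₁ hv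
    obtain ⟨W₂, h₂, hv₂, y₂, hy₂⟩ := hκ.exists_source x₂ hv
    have r₁ := hy₁.openRel.res (inf_le_left : W₁ ⊓ W₂ ≤ W₁)
    have r₂ := hy₂.openRel.res (inf_le_right : W₁ ⊓ W₂ ≤ W₂)
    rw [extRes_extRes] at r₁ r₂
    refine ⟨W₁ ⊓ W₂, inf_le_left.trans h₁, ⟨hv₁, hv₂⟩, ?_⟩
    rw [map_add, hs V x₁ _ _ _ r₁, hs V x₂ _ _ _ r₂]
    refine (hs V (x₁ + x₂) _ _ _ (by rw [map_add]; exact r₁.add r₂)).trans ?_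
    exact extSection_add _ _
  have hsmul (V : Y.Opens) (r : Γ(Y, V)) (x) : s V (r • x) = r • s V x := section_ext fun v hv ↦ by
    obtain ⟨W, h, hvW, y, hy⟩ := hκ.exists_source x hv
    refine ⟨W, h, hvW, ?_⟩
    rw [res_smul, hs V x _ _ _ hy.openRel]
    refine (hs V (r • x) _ _ _ (by rw [extRes_smul]; exact hy.openRel.smul _)).trans ?_
    exact extSection_smul _ _
  have hres (V W : Y.Opens) (h : W ≤ V) (x) : s W (extRes 1 _ _ h x) = T'.res h (s V x) := by
    refine (hu W (extRes 1 _ _ h x) (T'.res h (s V x)) fun W' h' y' hy' ↦ ?_).symm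
    rw [extRes_extRes] at hy'
    exact (res_res _ _ _ _).trans (hs V x _ _ _ hy')
  let t : extPresheaf 1 F (structureSheaf Y) ⟶ T'.val :=
    PresheafOfModules.homMk
      { app U := AddCommGrpCat.ofHom (AddMonoidHom.mk' (s U.unop) (hadd U.unop))
        naturality U V i := by
          ext x
          exact hres _ _ (leOfHom i.unop) x }
      (fun U r x ↦ hsmul U.unop r x)
  refine ⟨((PresheafOfModules.sheafificationAdjunction (𝟙 Y.ringCatSheaf.obj)).homEquiv _ _).symm t,
    fun V x y h ↦ ?_⟩
  have e := ((PresheafOfModules.sheafificationAdjunction (𝟙 Y.ringCatSheaf.obj)).homEquiv_unit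
    (f := ((PresheafOfModules.sheafificationAdjunction (𝟙 Y.ringCatSheaf.obj)).homEquiv
      (extPresheaf 1 F (structureSheaf Y)) T').symm t)).symm.trans (Equiv.apply_symm_apply _ t)
  refine (congrArg (fun φ ↦ (φ.app (op V)).hom x) e).trans ?_
  have := hs V x V le_rfl y (by rwa [extRes_self])
  rwa [res_self] at this

end BaseChangeMap

end
end AlgebraicGeometry.Scheme.Modules

namespace AlgebraicGeometry.Scheme.Modules
noncomputable section

/-! ### Full faithfulness of direct image along a closed immersion -/

section Full

variable {X Y : Scheme.{u}} (f : X ⟶ Y)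

lemma pushforward_app_smul {M N : X.Modules} (ρ : (pushforward f).obj M ⟶ (pushforward f).obj N)
    {V : Y.Opens} (b : Γ(Y, V)) (s : Γ(M, f ⁻¹ᵁ V)) :
    ρ.app V (show Γ((pushforward f).obj M, V) from f.app V b • s) =
      (show Γ((pushforward f).obj N, V) from f.app V b • (show Γ(N, f ⁻¹ᵁ V) from ρ.app V s)) :=
  ρ.app_smul b s

variable [IsClosedImmersion f]

/-- The largest open of the target with given preimage. -/
def largestOpen (U : X.Opens) : Y.Opens :=
  ⟨(f '' (U : Set X)ᶜ)ᶜ, (f.isClosedEmbedding.isClosedMap _ U.2.isClosed_compl).isOpen_compl⟩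

lemma preimage_largestOpen_le (U : X.Opens) : f ⁻¹ᵁ largestOpen f U ≤ U := fun x hx ↦ by
  by_contra h
  exact hx ⟨x, h, rfl⟩

lemma le_preimage_largestOpen (U : X.Opens) : U ≤ f ⁻¹ᵁ largestOpen f U := by
  rintro x hx ⟨z, hz, e⟩
  exact hz (f.isEmbedding.injective e ▸ hx)

lemma le_largestOpen {V : Y.Opens} {U : X.Opens} (h : f ⁻¹ᵁ V ≤ U) : V ≤ largestOpen f U := by
  rintro y hy ⟨z, hz, rfl⟩
  exact hz (h hy)

/-- The values of a map between direct images on the opens of the closed subscheme. -/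
def unpushApp {M N : X.Modules} (ρ : (pushforward f).obj M ⟶ (pushforward f).obj N) (U : X.Opens) :
    Γ(M, U) →+ Γ(N, U) :=
  (N.res (le_preimage_largestOpen f U)).comp
    ((ρ.app (largestOpen f U)).hom.comp (M.res (preimage_largestOpen_le f U)))

/-- The preimage of `largestOpen f U` is exactly `U`, which defines the map on every open of `X`.
Any `V` with preimage inside `U` lies in `largestOpen f U`, so naturality of `ρ` gives the
comparison. -/
lemma unpushApp_res {M N : X.Modules} (ρ : (pushforward f).obj M ⟶ (pushforward f).obj N)
    {U : X.Opens} {V : Y.Opens} (h : f ⁻¹ᵁ V ≤ U) (s : Γ(M, U)) :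
    N.res h (unpushApp f ρ U s) = ρ.app V (M.res h s) := by
  have e₁ := N.res_res (le_preimage_largestOpen f U) h
    (ρ.app (largestOpen f U) (M.res (preimage_largestOpen_le f U) s))
  have e₂ := ρ.app_res (le_largestOpen f h) (M.res (preimage_largestOpen_le f U) s)
  have e₃ := congrArg (ρ.app V) (M.res_res (preimage_largestOpen_le f U)
    (preimage_mono f (le_largestOpen f h)) s)
  exact e₁.trans (e₂.symm.trans e₃)

lemma unpushApp_naturality {M N : X.Modules} (ρ : (pushforward f).obj M ⟶ (pushforward f).obj N)
    {U U' : X.Opens} (h : U' ≤ U) (s : Γ(M, U)) :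
    unpushApp f ρ U' (M.res h s) = N.res h (unpushApp f ρ U s) := by
  refine section_ext fun x hx ↦ ⟨f ⁻¹ᵁ largestOpen f U', preimage_largestOpen_le f U',
    le_preimage_largestOpen f U' hx, ?_⟩
  rw [unpushApp_res, res_res, res_res, unpushApp_res]

/-- `ρ` is linear only over functions on `Y`. Functions on `X` lift to `Y` locally, and linearity
may be checked locally. -/
lemma unpushApp_smul {M N : X.Modules} (ρ : (pushforward f).obj M ⟶ (pushforward f).obj N)
    {U : X.Opens} (r : Γ(X, U)) (s : Γ(M, U)) :
    unpushApp f ρ U (r • s) = r • unpushApp f ρ U s := by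
  refine section_ext fun x hx ↦ ?_
  obtain ⟨W, hW, b, hxW, hb⟩ := exists_lift_section f (resO (preimage_largestOpen_le f U) r)
    (show f x ∈ largestOpen f U from le_preimage_largestOpen f U hx)
  have h : f ⁻¹ᵁ W ≤ U := (preimage_mono f hW).trans (preimage_largestOpen_le f U)
  rw [resO_resO] at hb
  refine ⟨f ⁻¹ᵁ W, h, hxW, ?_⟩
  rw [unpushApp_res, res_smul, res_smul, unpushApp_res, ← hb]
  exact pushforward_app_smul f ρ b _

instance : (pushforward f).Full where
  map_surjective {M N} ρ := by
    refine ⟨⟨PresheafOfModules.homMk (M₁ := M.val) (M₂ := N.val)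
      { app U := AddCommGrpCat.ofHom (unpushApp f ρ U.unop)
        naturality U V i := by
          ext s
          exact unpushApp_naturality f ρ (leOfHom i.unop) s }
      (fun U r s ↦ unpushApp_smul f ρ (show Γ(X, U.unop) from r) s)⟩, hom_ext_apply fun V s ↦ ?_⟩
    refine Eq.trans ?_ ((unpushApp_res f ρ (le_refl (f ⁻¹ᵁ V)) s).trans ?_)
    · exact (N.res_self (le_refl (f ⁻¹ᵁ V)) _).symm
    · exact congrArg (ρ.app V) (M.res_self _ s)

instance : (pushforward f).Faithful where
  map_injective {M N} α β h := by
    have key (γ : M ⟶ N) {U : X.Opens} (s : Γ(M, U)) :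
        N.res (preimage_largestOpen_le f U) (γ.app U s) =
          ((pushforward f).map γ).app (largestOpen f U) (M.res (preimage_largestOpen_le f U) s) :=
      (γ.app_res _ s).symm
    refine hom_ext_apply fun U s ↦ section_ext fun x hx ↦ ⟨f ⁻¹ᵁ largestOpen f U,
      preimage_largestOpen_le f U, le_preimage_largestOpen f U hx, ?_⟩
    rw [key, key, h]

end Full

end
end AlgebraicGeometry.Scheme.Modules

namespace AlgebraicGeometry.Scheme.Modules
noncomputable section

/-! ### The adjoint of the base change map is an isomorphism -/

section BaseChangeIso

variable {X Y : Scheme.{u}} {f : X ⟶ Y} [IsClosedImmersion f] {F : Y.Modules} {F' : X.Modules}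
  {κ : F ⟶ (pushforward f).obj F'}

-- A point off the closed image has a neighbourhood with empty preimage, so only the points `f x`
-- matter.
variable (f) in
lemma pushforward_section_ext {N : X.Modules} {V : Y.Opens} {s t : Γ((pushforward f).obj N, V)}
    (h : ∀ x : X, f x ∈ V → ∃ (W : Y.Opens) (hW : W ≤ V), f x ∈ W ∧
      ((pushforward f).obj N).res hW s = ((pushforward f).obj N).res hW t) : s = t := by
  refine section_ext fun y hy ↦ ?_
  by_cases hyf : y ∈ Set.range f
  · obtain ⟨x, rfl⟩ := hyf
    exact h x hy
  · let W : Y.Opens := ⟨(Set.range f)ᶜ, f.isClosedEmbedding.isClosed_range.isOpen_compl⟩ ⊓ V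
    refine ⟨W, inf_le_right, ⟨hyf, hy⟩, ?_⟩
    exact section_ext (M := N) (U := f ⁻¹ᵁ W) fun x hx ↦ (hx.1 ⟨x, rfl⟩).elim

variable (f) in
lemma epi_of_locally_surjective_on_range {M : Y.Modules} {N : X.Modules}
    (φ : M ⟶ (pushforward f).obj N) (h : ∀ (V : Y.Opens) (t : Γ(N, f ⁻¹ᵁ V)) (x : X), f x ∈ V →
      ∃ (W : Y.Opens) (hW : W ≤ V) (s : Γ(M, W)), f x ∈ W ∧
        φ.app W s = N.res (preimage_mono f hW) t) : Epi φ := by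
  refine epi_of_locally_surjective _ fun V t y hy ↦ ?_
  by_cases hyf : y ∈ Set.range f
  · obtain ⟨x, rfl⟩ := hyf
    obtain ⟨W, hW, s, hx, e⟩ := h V t x hy
    exact ⟨W, hW, s, hx, e⟩
  · let W : Y.Opens := ⟨(Set.range f)ᶜ, f.isClosedEmbedding.isClosed_range.isOpen_compl⟩ ⊓ V
    refine ⟨W, inf_le_right, 0, ⟨hyf, hy⟩, ?_⟩
    exact section_ext (M := N) (U := f ⁻¹ᵁ W) fun x hx ↦ (hx.1 ⟨x, rfl⟩).elim

lemma app_sum {M N : X.Modules} {ι : Type*} (S : Finset ι) (φ : ι → (M ⟶ N)) (U : X.Opens)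
    (s : Γ(M, U)) : (∑ t ∈ S, φ t).app U s = ∑ t ∈ S, (φ t).app U s :=
  map_sum (AddMonoidHom.mk' (fun φ : M ⟶ N ↦ φ.app U s) fun _ _ ↦ rfl) φ S

lemma smul_structureSheaf_restrict (U : X.Opens) (a : Γ(X, U))
    (s : Γ((structureSheaf X).restrict U.ι, ⊤)) :
    (show Γ((U : Scheme.{u}), ⊤) from toOpens (U : Scheme.{u}) ⊤ (U.topIso.inv a)) • s =
      (show Γ((structureSheaf X).restrict U.ι, ⊤) from
        (show Γ(X, U.ι ''ᵁ ⊤) from resO (ι_image_top_le U) a * (show Γ(X, U.ι ''ᵁ ⊤) from s))) := by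
  have h : (U.ι.appIso ⊤).inv (toOpens (U : Scheme.{u}) ⊤ (U.topIso.inv a)) =
      resO (ι_image_top_le U) a := by
    rw [Scheme.Opens.ι_appIso, Scheme.Opens.topIso_inv]
    exact (congrArg (fun φ ↦ φ.hom a) (X.presheaf.map_comp (eqToHom U.ι_image_top).op
      ((U.ι.opensFunctor.map (homOfLE (le_refl (⊤ : (U : Scheme.{u}).Opens)))).op))).symm
  exact congrArg (fun b : Γ(X, U.ι ''ᵁ ⊤) ↦ b * (show Γ(X, U.ι ''ᵁ ⊤) from s)) h

/-- The class attached to a map out of a free module is a combination of the classes attached to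
the coordinate functions. -/
lemma FreePres.exists_ext_eq_sum {V : X.Opens} {F : X.Modules} {r n : ℕ} (P : FreePres F V.ι r n)
    (v : P.E₁ ⟶ (structureSheaf X).restrict V.ι) :
    ∃ x : Fin r → Ext.{u} (F.restrict V.ι) ((structureSheaf X).restrict V.ι) 1,
      P.ext v = ∑ t, (show Γ(X, V) from (structureSheaf X).res (le_ι_image_top V)
        (v.app ⊤ (P.e₁ t))) • x t := by
  choose ε hε using fun t : Fin r ↦ P.free₁.exists_hom (M := (structureSheaf X).restrict V.ι)
    (fun s ↦ if s = t then (show Γ(X, V.ι ''ᵁ ⊤) from 1) else 0)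
  refine ⟨fun t ↦ P.ext (ε t), ?_⟩
  have : v = ∑ t, V.topIso.inv (show Γ(X, V) from (structureSheaf X).res (le_ι_image_top V)
      (v.app ⊤ (P.e₁ t))) • ε t := by
    refine P.free₁.hom_ext fun s ↦ ?_
    rw [app_sum]
    have h (t) := smul_structureSheaf_restrict V (show Γ(X, V) from
      (structureSheaf X).res (le_ι_image_top V) (v.app ⊤ (P.e₁ t))) ((ε t).app ⊤ (P.e₁ s))
    refine Eq.trans ?_ (Finset.sum_congr rfl fun t _ ↦ (h t).symm)
    rw [Finset.sum_eq_single s]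
    · refine Eq.trans ?_ (congrArg (fun z : Γ(X, V.ι ''ᵁ ⊤) ↦ resO (ι_image_top_le V)
        (show Γ(X, V) from (structureSheaf X).res (le_ι_image_top V) (v.app ⊤ (P.e₁ s))) * z)
        ((hε s s).trans (if_pos rfl))).symm
      refine Eq.trans ?_ (mul_one (resO (ι_image_top_le V) (show Γ(X, V) from
        (structureSheaf X).res (le_ι_image_top V) (v.app ⊤ (P.e₁ s))))).symm
      exact (((structureSheaf X).res_res _ _ _).trans ((structureSheaf X).res_self _ _)).symm
    · intro t _ hts
      refine (congrArg (fun z : Γ(X, V.ι ''ᵁ ⊤) ↦ resO (ι_image_top_le V)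
        (show Γ(X, V) from (structureSheaf X).res (le_ι_image_top V) (v.app ⊤ (P.e₁ t))) * z)
        ((hε t s).trans (if_neg hts.symm))).trans ?_
      exact mul_zero _
    · exact fun h ↦ (h (Finset.mem_univ s)).elim
  conv_lhs => rw [this]
  rw [P.ext_sum]
  exact Finset.sum_congr rfl fun t _ ↦ P.ext_smul _ _

/-- As the partner `P'.ext m'` is zero, `m'` extends to `P'.E₀`, and this extension lifts locally to
a form on `P.E₀`. Subtracting the lift from `m` does not change the class and leaves a form whose
coordinates are killed by `f^♯`. The class is thus a combination whose coefficients act as zero on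
any direct image. -/
lemma PresRel.map_extSection_eq_zero {V : Y.Opens}
    {x : Ext.{u} (F.restrict V.ι) ((structureSheaf Y).restrict V.ι) 1} (h : PresRel κ x 0)
    {N : X.Modules} (ψ : sheafExt 1 F (structureSheaf Y) ⟶ (pushforward f).obj N) {v : X}
    (hv : f v ∈ V) : ∃ (W : Y.Opens) (hW : W ≤ V), f v ∈ W ∧
      ψ.app W (extSection W (extRes 1 _ _ hW x)) = 0 := by
  obtain ⟨r, n, P, P', T, m, m', hm, rfl, h0⟩ := h
  obtain ⟨c', rfl⟩ := (P'.ext_eq_zero_iff m').1 h0.symm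
  obtain ⟨W, hW, hvW, c, hc⟩ := P.free₀.exists_lift T.τ₀ T.τ₀_e₀ c' hv
  refine ⟨W, hW, hvW, ?_⟩
  let P₁ := P.restrict (Y.homOfLE_ι hW)
  let T₁ := T.res hW
  let m₁ : P₁.E₁ ⟶ (structureSheaf Y).restrict W.ι := (restrictFunctor (Y.homOfLE hW)).map m ≫
    (restrictComp (Y.homOfLE_ι hW)).hom.app (structureSheaf Y)
  let c₁ : P₁.E₀ ⟶ (structureSheaf Y).restrict W.ι := c
  let v := m₁ - P₁.a ≫ c₁
  have e₁ : extRes 1 _ _ hW (P.ext m) = P₁.ext v := by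
    have h₁ : P₁.ext (v + P₁.a ≫ c₁) = P₁.ext v := by
      rw [P₁.ext_add, (P₁.ext_eq_zero_iff (P₁.a ≫ c₁)).2 ⟨c₁, rfl⟩, add_zero]
    rw [sub_add_cancel] at h₁
    exact (P.extRestrict_ext (Y.homOfLE_ι hW) m).trans h₁
  have e₂ : v ≫ restrictMapAlong (morphismRestrict_ι f W) (sharp f) = 0 := by
    have h₁ : m₁ ≫ restrictMapAlong (morphismRestrict_ι f W) (sharp f) = _ :=
      (restrictMapAlong_square _ (morphismRestrict_homOfLE f hW) _ (Y.homOfLE_ι hW)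
        (X.homOfLE_ι (preimage_mono f hW)) hm.symm).symm
    rw [Preadditive.sub_comp, sub_eq_zero, h₁, Category.assoc]
    refine Eq.trans ?_ (congrArg (P₁.a ≫ ·) hc.symm)
    refine Eq.trans ?_ (Category.assoc _ _ _)
    refine Eq.trans ?_ (congrArg (· ≫ _) T₁.comm₁.symm)
    simp only [Functor.map_comp, Category.assoc]
    rfl
  rw [e₁]
  obtain ⟨x, hx⟩ := P₁.exists_ext_eq_sum v
  rw [hx, extSection_sum, map_sum]
  refine Finset.sum_eq_zero fun t _ ↦ ?_
  rw [extSection_smul, Hom.app_smul]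
  have e₃ := congrArg (fun φ ↦ φ.app ⊤ (P₁.e₁ t)) e₂
  -- The coordinates of `v` vanish on `X`, because `v` followed by `f^♯` is zero.
  have e₄ : f.app W (show Γ(Y, W) from (structureSheaf Y).res (le_ι_image_top W)
      (v.app ⊤ (P₁.e₁ t))) = 0 := by
    have h₁ := (restrictMapAlong_app (morphismRestrict_ι f W) (sharp f) ⊤
      (v.app ⊤ (P₁.e₁ t))).symm.trans e₃
    have h₂ := (sharp f).app_res (le_ι_image_top W) (v.app ⊤ (P₁.e₁ t))
    have h₃ := (structureSheaf X).res_res (image_preimage_le_of_comm (morphismRestrict_ι f W) ⊤)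
      (le_ι_image_top (f ⁻¹ᵁ W)) ((sharp f).app (W.ι ''ᵁ ⊤) (v.app ⊤ (P₁.e₁ t)))
    exact (h₂.trans h₃.symm).trans ((congrArg ((structureSheaf X).res
      (le_ι_image_top (f ⁻¹ᵁ W))) h₁).trans (map_zero _))
  exact (congrArg (fun b : Γ(X, f ⁻¹ᵁ W) ↦
    b • (show Γ(N, f ⁻¹ᵁ W) from ψ.app W (extSection W (x t)))) e₄).trans (zero_smul _ _)

variable (hκ : HasCompatiblePres κ)
include hκ

variable {θ : sheafExt 1 F (structureSheaf Y) ⟶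
    (pushforward f).obj (sheafExt 1 F' (structureSheaf X))}
  (hθ : ∀ (V : Y.Opens) x y, OpenRel κ x y → θ.app V (extSection V x) = extSection (f ⁻¹ᵁ V) y)
include hθ

lemma HasCompatiblePres.epi_baseChange : Epi θ := by
  refine epi_of_locally_surjective_on_range f θ fun V t x hx ↦ ?_
  obtain ⟨U, hU, y, hxU, hy⟩ := exists_extSection t (show x ∈ f ⁻¹ᵁ V from hx)
  obtain ⟨W, hW, hxW, hWU⟩ := exists_preimage_le f hxU hx
  obtain ⟨W', hW', hxW', z, hz⟩ := hκ.exists_target (extRes 1 _ _ hWU y) hxW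
  refine ⟨W', hW'.trans hW, extSection W' z, hxW', ?_⟩
  rw [hθ _ _ _ hz.openRel, extRes_extRes, extSection_extRes, hy, res_res]

/-- Locally a section killed by `θ` is a class whose partner, after shrinking, is the zero class, so
`map_extSection_eq_zero` applies. For `ψ` the unit of the adjunction this is the injectivity half of
base change. -/
lemma HasCompatiblePres.app_eq_zero {N : X.Modules}
    (ψ : sheafExt 1 F (structureSheaf Y) ⟶ (pushforward f).obj N) {V : Y.Opens}
    (t : Γ(sheafExt 1 F (structureSheaf Y), V)) (ht : θ.app V t = 0) : ψ.app V t = 0 := by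
  refine pushforward_section_ext f fun v hv ↦ ?_
  obtain ⟨W, hW, x, hvW, hx⟩ := exists_extSection t hv
  obtain ⟨W₁, hW₁, hvW₁, y, hy⟩ := hκ.exists_source x hvW
  have hy₀ : extSection (f ⁻¹ᵁ W₁) y = 0 := by
    rw [← hθ _ _ _ hy.openRel, extSection_extRes, hx, res_res, Hom.app_res, ht, map_zero]
    rfl
  obtain ⟨U, hU, hvU, hyU⟩ := exists_extRes_eq_zero hy₀ (show v ∈ f ⁻¹ᵁ W₁ from hvW₁)
  obtain ⟨W₂, hW₂, hvW₂, hWU⟩ := exists_preimage_le f hvU hvW₁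
  have hy₂ := hy.res hW₂
  rw [← extRes_extRes hU hWU, hyU, map_zero] at hy₂
  obtain ⟨W₃, hW₃, hvW₃, e⟩ := hy₂.map_extSection_eq_zero ψ hvW₂
  refine ⟨W₃, ((hW₃.trans hW₂).trans hW₁).trans hW, hvW₃, ?_⟩
  rw [extRes_extRes, extRes_extRes, extSection_extRes, hx, res_res] at e
  rw [← Hom.app_res, map_zero]
  exact e

/-- The unit `η` kills the kernel of the epimorphism `θ`, so it factors through `θ`. The factor is a
map between direct images, hence `f_* ρ`, and `ρ` is a retraction of the adjoint `e` of `θ`. As `θ`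
is an epimorphism and `f_*` is faithful, `e` is an epimorphism too. -/
lemma HasCompatiblePres.isIso_baseChange :
    IsIso (((pullbackPushforwardAdjunction f).homEquiv _ _).symm θ) := by
  have := hκ.epi_baseChange hθ
  let adj := pullbackPushforwardAdjunction f
  let e := (adj.homEquiv _ _).symm θ
  have he : adj.homEquiv _ _ e = θ := Equiv.apply_symm_apply _ _
  let η := adj.unit.app (sheafExt 1 F (structureSheaf Y))
  have hη : kernel.ι θ ≫ η = 0 := hom_ext_apply fun V s ↦
    hκ.app_eq_zero hθ η ((kernel.ι θ).app V s)
      (congrArg (fun φ ↦ φ.app V s) (kernel.condition θ))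
  obtain ⟨ρ, hρ⟩ := (pushforward f).map_surjective (Abelian.epiDesc θ η hη)
  have e₁ : e ≫ ρ = 𝟙 _ := by
    apply (adj.homEquiv _ _).injective
    rw [adj.homEquiv_naturality_right, he, hρ, Abelian.comp_epiDesc, adj.homEquiv_unit,
      CategoryTheory.Functor.map_id]
    exact (Category.comp_id _).symm
  have e₂ : Epi e := ⟨fun a b hab ↦ by
    apply (pushforward f).map_injective
    rw [← cancel_epi θ, ← he, ← adj.homEquiv_naturality_right, hab, adj.homEquiv_naturality_right]⟩
  have : IsSplitMono e := ⟨⟨⟨ρ, e₁⟩⟩⟩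
  exact isIso_of_epi_of_isSplitMono e

-- Sections of `𝓔xt¹(F, 𝒪_Y)` are locally classes with a partner coming from compatible
-- presentations, so two maps need only be compared on those.
omit hθ in
lemma HasCompatiblePres.hom_ext {N : X.Modules}
    {θ₁ θ₂ : sheafExt 1 F (structureSheaf Y) ⟶ (pushforward f).obj N}
    (h : ∀ (V : Y.Opens) x y, PresRel κ x y →
      θ₁.app V (extSection V x) = θ₂.app V (extSection V x)) : θ₁ = θ₂ := by
  refine hom_ext_locally fun V t v hv ↦ ?_
  obtain ⟨W, hW, x, hvW, hx⟩ := exists_extSection t hv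
  obtain ⟨W₁, hW₁, hvW₁, y, hy⟩ := hκ.exists_source x hvW
  refine ⟨W₁, hW₁.trans hW, hvW₁, ?_⟩
  rw [← res_res _ hW hW₁, ← hx, ← extSection_extRes]
  exact h _ _ _ hy

end BaseChangeIso

end
end AlgebraicGeometry.Scheme.Modules

/-! ### Uniqueness: realising partners by morphisms of extensions -/

/-- Pushing out a short exact sequence along a map from its first term. -/
lemma CategoryTheory.ShortComplex.ShortExact.exists_pushout {C : Type*} [Category* C] [Abelian C]
    [HasExt.{w} C] {S : ShortComplex C} (hS : S.ShortExact) {M : C} (m : S.X₁ ⟶ M) :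
    ∃ (E : C) (i : M ⟶ E) (q : E ⟶ S.X₃) (hw : i ≫ q = 0) (h : (ShortComplex.mk i q hw).ShortExact)
      (l : S.X₂ ⟶ E), S.f ≫ l = m ≫ i ∧ l ≫ q = S.g ∧
      h.extClass = hS.extClass.comp (Ext.mk₀ m) (add_zero 1) ∧
      (∀ {Z : C} (a : S.X₂ ⟶ Z) (b : M ⟶ Z), S.f ≫ a = m ≫ b → ∃ c : E ⟶ Z, l ≫ c = a ∧ i ≫ c = b) ∧
      ∀ {Z : C} (c c' : E ⟶ Z), l ≫ c = l ≫ c' → i ≫ c = i ≫ c' → c = c' := by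
  have := hS.mono_f
  have := hS.epi_g
  let q : pushout S.f m ⟶ S.X₃ := pushout.desc S.g 0 (by rw [S.zero, comp_zero])
  have hl : pushout.inl S.f m ≫ q = S.g := pushout.inl_desc _ _ _
  have hi : pushout.inr S.f m ≫ q = 0 := pushout.inr_desc _ _ _
  have hq : Epi q := by
    have : Epi (pushout.inl S.f m ≫ q) := hl ▸ inferInstance
    exact epi_of_epi (pushout.inl S.f m) q
  have hex : (ShortComplex.mk _ q hi).Exact := by
    refine ShortComplex.exact_of_g_is_cokernel _ (CokernelCofork.IsColimit.ofπ' q hi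
      fun {Z} k hk ↦ ?_)
    have h₁ : S.f ≫ pushout.inl S.f m ≫ k = 0 := by
      rw [pushout.condition_assoc, hk, comp_zero]
    refine ⟨hS.exact.desc (pushout.inl S.f m ≫ k) h₁, pushout.hom_ext ?_ ?_⟩
    · rw [← Category.assoc, hl, hS.exact.g_desc]
    · rw [← Category.assoc, hi, zero_comp, hk]
  have h : (ShortComplex.mk (pushout.inr S.f m) q hi).ShortExact := { exact := hex }
  refine ⟨_, pushout.inr S.f m, q, hi, h, pushout.inl S.f m, pushout.condition, hl, ?_, ?_, ?_⟩
  · have e := ShortComplex.ShortExact.extClass_naturality hS h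
      { τ₁ := m
        τ₂ := pushout.inl S.f m
        τ₃ := 𝟙 S.X₃
        comm₁₂ := pushout.condition.symm
        comm₂₃ := hl.trans (Category.comp_id _).symm }
    exact (e.trans (Ext.mk₀_id_comp _)).symm
  · exact fun a b hab ↦ ⟨pushout.desc a b hab, pushout.inl_desc _ _ _, pushout.inr_desc _ _ _⟩
  · exact fun c c' h₁ h₂ ↦ pushout.hom_ext h₁ h₂

namespace AlgebraicGeometry.Scheme.Modules
noncomputable section

section

variable {X Y B C : Scheme.{u}} {f : X ⟶ Y} {p : X ⟶ C} {π : Y ⟶ B} {g : C ⟶ B}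
  [IsClosedImmersion f]

/-- The two presentations are pushed out along `m` and `m'`. The universal property of the pushout
produces `φ` from `τ₀` and `f^♯`, which agree on `P.E₁` because `m` and `m'` are compatible. These
are the test extensions which determine a base change map. -/
lemma exists_kaehlerExtension (w : f ≫ π = p ≫ g) {V : Y.Opens}
    {x : Ext.{u} ((kaehler π).restrict V.ι) ((structureSheaf Y).restrict V.ι) 1}
    {y : Ext.{u} ((kaehler p).restrict (f ⁻¹ᵁ V).ι) ((structureSheaf X).restrict (f ⁻¹ᵁ V).ι) 1}
    (h : PresRel (kaehlerMap w) x y) :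
    ∃ (E : KaehlerExtension π V) (E' : KaehlerExtension p (f ⁻¹ᵁ V))
      (φ : E.E ⟶ (pushforward (f ∣_ V)).obj E'.E),
      E.i ≫ φ = restrictMap f (sharp f) V ≫ (pushforward (f ∣_ V)).map E'.i ∧
      φ ≫ (pushforward (f ∣_ V)).map E'.q = E.q ≫ restrictMap f (kaehlerMap w) V ∧
      E.toSection = extSection V x ∧ E'.toSection = extSection (f ⁻¹ᵁ V) y := by
  obtain ⟨r, n, P, P', T, m, m', h, rfl, rfl⟩ := h
  obtain ⟨E, i, q, hw, hE, l, hil, hlq, hcl, hd, hu⟩ := P.shortExact.exists_pushout m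
  obtain ⟨E', i', q', hw', hE', l', hil', hlq', hcl', hd', hu'⟩ := P'.shortExact.exists_pushout m'
  obtain ⟨φ, hφ, hφ'⟩ := hd (T.τ₀ ≫ (pushforward (f ∣_ V)).map l')
    (restrictMapAlong (morphismRestrict_ι f V) (sharp f) ≫ (pushforward (f ∣_ V)).map i') (by
      have e₁ : P.a ≫ T.τ₀ ≫ (pushforward (f ∣_ V)).map l' = T.τ₁ ≫
          (pushforward (f ∣_ V)).map (m' ≫ i') := by
        rw [← Category.assoc, T.comm₁, Category.assoc, ← Functor.map_comp]
        exact congrArg (fun z ↦ T.τ₁ ≫ (pushforward (f ∣_ V)).map z) hil'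
      refine e₁.trans ?_
      rw [Functor.map_comp, ← Category.assoc, ← h, Category.assoc])
  refine ⟨⟨E, i, q, hw, hE⟩, ⟨E', i', q', hw', hE'⟩, φ, hφ', hu _ _ ?_ ?_,
    congrArg (extSection V) hcl, congrArg (extSection (f ⁻¹ᵁ V)) hcl'⟩
  · refine (Category.assoc _ _ _).symm.trans ((congrArg (· ≫ _) hφ).trans ?_)
    refine Eq.trans ?_ ((congrArg (· ≫ _) hlq.symm).trans (Category.assoc _ _ _))
    rw [Category.assoc, ← Functor.map_comp]
    exact (congrArg (fun z ↦ T.τ₀ ≫ (pushforward (f ∣_ V)).map z) hlq').trans T.comm₀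
  · refine (Category.assoc _ _ _).symm.trans ((congrArg (· ≫ _) hφ').trans ?_)
    refine Eq.trans ?_ ((zero_comp.symm.trans (congrArg (· ≫ _) hw.symm)).trans
      (Category.assoc _ _ _))
    rw [Category.assoc, ← Functor.map_comp, hw', Functor.map_zero, comp_zero]

/-- Base change for `T¹`, given compatible local presentations of the sheaves of differentials. -/
theorem existsUnique_isBaseChangeMap (w : f ≫ π = p ≫ g)
    (hκ : HasCompatiblePres (kaehlerMap w)) :
    ∃! e : (pullback f).obj (tOne π) ≅ tOne p, IsBaseChangeMap w e.hom := by
  obtain ⟨θ, hθ⟩ := hκ.exists_baseChange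
  have : IsIso (((pullbackPushforwardAdjunction f).homEquiv (tOne π) (tOne p)).symm θ) :=
    hκ.isIso_baseChange hθ
  refine ⟨asIso (((pullbackPushforwardAdjunction f).homEquiv (tOne π) (tOne p)).symm θ), ?_, fun e he ↦ ?_⟩
  · intro V E E' φ h₁ h₂
    refine (congrArg (fun z ↦ Hom.app z V E.toSection) (Equiv.apply_symm_apply
      ((pullbackPushforwardAdjunction f).homEquiv _ _) θ)).trans ?_
    exact hθ V _ _ (ExtRel.of_extension E.shortExact E'.shortExact φ h₁ h₂)
  · ext1
    apply ((pullbackPushforwardAdjunction f).homEquiv _ _).injective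
    refine Eq.trans ?_ (Equiv.apply_symm_apply _ _).symm
    refine hκ.hom_ext fun V x y h ↦ ?_
    obtain ⟨E, E', φ, h₁, h₂, hE, hE'⟩ := exists_kaehlerExtension w h
    have := he V E E' φ h₁ h₂
    rw [hE, hE'] at this
    exact this.trans (hθ V x y h.openRel).symm

end

end
end AlgebraicGeometry.Scheme.Modules

/-! ### Regular sequences with flat quotient are universally regular -/

section FlatRegular
open TensorProduct RingTheory.Sequence
open scoped Pointwise

variable {R S N : Type*} [CommRing R] [CommRing S] [Algebra R S] [AddCommGroup N] [Module R N]
  [Module S N] [IsScalarTower R S N]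

instance Module.Finite.tensorProduct_of_tower (M : Type*) [AddCommGroup M] [Module R M]
    [Module.Finite R M] [Module.Finite S N] : Module.Finite S (N ⊗[R] M) :=
  Module.Finite.equiv (AlgebraTensorModule.cancelBaseChange R S S N M)

namespace QuotSMulTop

variable (R N)

/-- Multiplication by `f : S` as an `R`-linear map. -/
def smulMap (f : S) : N →ₗ[R] N := (LinearMap.lsmul S N f).restrictScalars R

/-- The quotient map `N → N / f N` as an `R`-linear map. -/
def mkMap (f : S) : N →ₗ[R] QuotSMulTop f N :=
  ((f • (⊤ : Submodule S N)).mkQ).restrictScalars R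

lemma mkMap_surjective (f : S) : Function.Surjective (mkMap R N f) :=
  Submodule.mkQ_surjective (f • (⊤ : Submodule S N))

lemma exact_smulMap_mkMap (f : S) : Function.Exact (smulMap R N f) (mkMap R N f) := by
  intro x
  refine (Submodule.Quotient.mk_eq_zero (f • (⊤ : Submodule S N))).trans ?_
  rw [Submodule.mem_smul_pointwise_iff_exists]
  exact ⟨fun ⟨y, _, h⟩ ↦ ⟨y, h⟩, fun ⟨y, h⟩ ↦ ⟨y, trivial, h⟩⟩

lemma rTensor_smulMap (f : S) (M : Type*) [AddCommGroup M] [Module R M] (z : N ⊗[R] M) :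
    (smulMap R N f).rTensor M z = f • z := by
  induction z with
  | zero => simp
  | add x y hx hy => rw [map_add, hx, hy, smul_add]
  | tmul x y => rfl

end QuotSMulTop

/-- Let `K` be the kernel of `N ⊗ I ⟶ N`. Flatness of `N / f N` puts `K` inside `f (N ⊗ I)`, and
regularity of `f` on `N` then gives `K = f K`. Since `N ⊗ I` is finite over the noetherian local
ring `S` and `f` lies in the maximal ideal, Nakayama gives `K = 0`. -/
lemma Module.Flat.of_flat_quotSMulTop [IsLocalRing S] [IsNoetherianRing S] [Module.Finite S N]
    {f : S} (hfm : f ∈ IsLocalRing.maximalIdeal S) (hf : IsSMulRegular N f)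
    [Module.Flat R (QuotSMulTop f N)] : Module.Flat R N := by
  rw [Module.Flat.iff_lTensor_injective]
  intro I hI
  have : Module.Finite R I := Module.Finite.iff_fg.2 hI
  let ψ : N ⊗[R] I →ₗ[S] N ⊗[R] R := AlgebraTensorModule.lTensor S N I.subtype
  have hψ : ∀ z, ψ z = I.subtype.lTensor N z := fun z ↦ rfl
  have hK : LinearMap.ker ψ = ⊥ := by
    refine Submodule.eq_bot_of_le_smul_of_le_jacobson_bot (IsLocalRing.maximalIdeal S) _
      (IsNoetherian.noetherian _) (fun k hk ↦ ?_) (IsLocalRing.maximalIdeal_le_jacobson _)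
    let q := QuotSMulTop.mkMap R N f
    have h1 : q.rTensor I k = 0 := by
      apply Module.Flat.lTensor_preserves_injective_linearMap (M := QuotSMulTop f N) I.subtype
        I.injective_subtype
      rw [map_zero, ← LinearMap.comp_apply, LinearMap.lTensor_comp_rTensor,
        ← LinearMap.rTensor_comp_lTensor, LinearMap.comp_apply, ← hψ, LinearMap.mem_ker.1 hk, map_zero]
    obtain ⟨k', rfl⟩ := (_root_.rTensor_exact I (QuotSMulTop.exact_smulMap_mkMap R N f)
      (QuotSMulTop.mkMap_surjective R N f) k).1 h1
    rw [QuotSMulTop.rTensor_smulMap] at hk ⊢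
    refine Submodule.smul_mem_smul hfm ?_
    rw [LinearMap.mem_ker, map_smul] at hk
    rw [LinearMap.mem_ker]
    apply (AlgebraTensorModule.rid R S N).injective
    apply hf
    change f • _ = f • _
    rw [← map_smul, hk, map_zero, smul_zero]
  intro x y h
  exact LinearMap.ker_eq_bot.1 hK h

/-- Tensoring `0 → N → N → N / f N → 0` with `M` keeps it exact on the left, because the last term
is flat. -/
lemma IsSMulRegular.tensorProduct_of_flat_quotSMulTop {f : S} (hf : IsSMulRegular N f)
    [Module.Flat R (QuotSMulTop f N)] (M : Type*) [AddCommGroup M] [Module R M] :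
    IsSMulRegular (N ⊗[R] M) f := by
  have h := LinearMap.lTensor_injective_of_exact_of_flat (QuotSMulTop.mkMap R N f)
    (QuotSMulTop.mkMap_surjective R N f) (QuotSMulTop.smulMap R N f) hf
    (QuotSMulTop.exact_smulMap_mkMap R N f) M
  rw [LinearMap.lTensor_inj_iff_rTensor_inj] at h
  intro x y hxy
  apply h
  rw [QuotSMulTop.rTensor_smulMap, QuotSMulTop.rTensor_smulMap]
  exact hxy

/-- Reduction modulo `f` commutes with tensor products. -/
noncomputable def QuotSMulTop.tensorEquiv (f : S) (M : Type*) [AddCommGroup M] [Module R M] :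
    QuotSMulTop f (N ⊗[R] M) ≃ₗ[S] QuotSMulTop f N ⊗[R] M :=
  QuotSMulTop.equivQuotTensor f (N ⊗[R] M) ≪≫ₗ
    (AlgebraTensorModule.assoc R S S (S ⧸ Ideal.span {f}) N M).symm ≪≫ₗ
      AlgebraTensorModule.congr (QuotSMulTop.equivQuotTensor f N).symm (LinearEquiv.refl R M)

/-- A sequence in the maximal ideal which is weakly regular with flat quotient is universally
weakly regular. -/
lemma RingTheory.Sequence.IsWeaklyRegular.flat_and_tensorProduct [IsLocalRing S]
    [IsNoetherianRing S] (rs : List S) (hm : ∀ f ∈ rs, f ∈ IsLocalRing.maximalIdeal S) :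
    ∀ (N : Type max u w) [AddCommGroup N] [Module R N] [Module S N] [IsScalarTower R S N]
      [Module.Finite S N],
      IsWeaklyRegular N rs → Module.Flat R (N ⧸ (Ideal.ofList rs • (⊤ : Submodule S N))) →
      Module.Flat R N ∧ ∀ (M : Type w) [AddCommGroup M] [Module R M],
        IsWeaklyRegular (N ⊗[R] M) rs := by
  induction rs with
  | nil =>
    intro N _ _ _ _ _ _ h
    refine ⟨?_, fun M _ _ ↦ .nil _ _⟩
    have e : (N ⧸ (Ideal.ofList ([] : List S) • (⊤ : Submodule S N))) ≃ₗ[S] N :=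
      Submodule.quotEquivOfEqBot _ (by simp)
    exact Module.Flat.of_linearEquiv (e.symm.restrictScalars R)
  | cons f rs ih =>
    intro N _ _ _ _ _ hN h
    rw [isWeaklyRegular_cons_iff] at hN
    have e := Submodule.quotOfListConsSMulTopEquivQuotSMulTopInner N f rs
    obtain ⟨h₁, h₂⟩ := ih (fun g hg ↦ hm g (List.mem_cons_of_mem _ hg)) (QuotSMulTop f N) hN.2
      (Module.Flat.of_linearEquiv (e.symm.restrictScalars R))
    refine ⟨Module.Flat.of_flat_quotSMulTop (hm f List.mem_cons_self) hN.1, fun M _ _ ↦ ?_⟩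
    rw [isWeaklyRegular_cons_iff]
    exact ⟨hN.1.tensorProduct_of_flat_quotSMulTop M,
      ((QuotSMulTop.tensorEquiv f M).isWeaklyRegular_congr rs).2 (h₂ M)⟩

end FlatRegular

/-! ### Testing injectivity through prime filtrations -/

section PrimeFiltration

open TensorProduct

variable {R : Type u} [CommRing R] [IsNoetherianRing R] {N N' : Type*} [AddCommGroup N]
  [AddCommGroup N'] [Module R N] [Module R N']

/-- A map of flat modules which is injective modulo all primes in the support of `M` is injective
after tensoring with `M`. -/
lemma LinearMap.rTensor_injective_of_forall_prime (φ : N →ₗ[R] N') [Module.Flat R N'] (M : Type u)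
    [AddCommGroup M] [Module R M] [hM : Module.Finite R M]
    (h : ∀ p ∈ Module.support R M, Function.Injective (φ.rTensor (R ⧸ p.asIdeal))) :
    Function.Injective (φ.rTensor M) := by
  induction hM using IsNoetherianRing.induction_on_isQuotientEquivQuotientPrime with
  | subsingleton M =>
    have : Subsingleton (N ⊗[R] M) := inferInstance
    exact Function.injective_of_subsingleton _
  | quotient M p e =>
    have hp : p ∈ Module.support R M := by
      rw [e.support_eq, Module.support_eq_zeroLocus, Ideal.annihilator_quotient]
      exact le_refl p.asIdeal
    have := h p hp
    have hc : φ.rTensor M = (e.symm.lTensor N').toLinearMap ∘ₗ φ.rTensor (R ⧸ p.asIdeal) ∘ₗ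
        (e.lTensor N).toLinearMap := by
      ext x y
      simp
    rw [hc]
    exact (e.symm.lTensor N').injective.comp (this.comp (e.lTensor N).injective)
  | exact M₁ M₂ M₃ i q hi hq hiq h₁ h₃ =>
    have h₁' := h₁ fun p hp ↦ h p (Module.support_subset_of_injective i hi hp)
    have h₃' := h₃ fun p hp ↦ h p (Module.support_subset_of_surjective q hq hp)
    rw [injective_iff_map_eq_zero]
    -- The image of `x` in `N ⊗ M₃` vanishes, so `x` comes from `N ⊗ M₁`, and `N' ⊗ M₁` injects into
    -- `N' ⊗ M₂` because `N'` is flat.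
    intro x hx
    have hx₃ : q.lTensor N x = 0 := by
      apply h₃'
      rw [map_zero, ← LinearMap.comp_apply, LinearMap.rTensor_comp_lTensor,
        ← LinearMap.lTensor_comp_rTensor, LinearMap.comp_apply, hx, map_zero]
    obtain ⟨y, rfl⟩ := (lTensor_exact N hiq hq x).1 hx₃
    have : y = 0 := by
      apply h₁'
      apply Module.Flat.lTensor_preserves_injective_linearMap (M := N') i hi
      rw [map_zero, map_zero, ← LinearMap.comp_apply, LinearMap.lTensor_comp_rTensor,
        ← LinearMap.rTensor_comp_lTensor, LinearMap.comp_apply, hx]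
    rw [this, map_zero]

end PrimeFiltration

/-! ### Regular parameters, a form of the Cohen–Macaulay condition -/

section Macaulay
open TensorProduct RingTheory.Sequence IsLocalRing

/-- A local ring with a regular sequence which generates an ideal primary to the maximal ideal. -/
def IsLocalRing.HasRegularParameters (S : Type*) [CommRing S] [IsLocalRing S] : Prop :=
  ∃ rs : List S, IsWeaklyRegular S rs ∧ Ideal.ofList rs ≤ maximalIdeal S ∧
    ∀ P : Ideal S, P.IsPrime → Ideal.ofList rs ≤ P → P = maximalIdeal S

namespace IsLocalRing.HasRegularParameters

lemma of_isField {S : Type*} [CommRing S] [IsLocalRing S] (h : IsField S) :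
    HasRegularParameters S := by
  refine ⟨[], .nil _ _, by simp, fun P hP _ ↦ ?_⟩
  let _ := h.toField
  rw [Ideal.eq_bot_of_prime P, ((IsLocalRing.isField_iff_maximalIdeal_eq).1 h)]

lemma of_ringEquiv {S S' : Type*} [CommRing S] [IsLocalRing S] [CommRing S'] [IsLocalRing S']
    (e : S ≃+* S') (h : HasRegularParameters S) : HasRegularParameters S' := by
  obtain ⟨rs, h₁, h₂, h₃⟩ := h
  have hm : (maximalIdeal S).map (e : S →+* S') = maximalIdeal S' :=
    IsLocalRing.eq_maximalIdeal (Ideal.map_isMaximal_of_equiv e)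
  refine ⟨rs.map (e : S →+* S'), ?_, ?_, fun P hP hrs ↦ ?_⟩
  · refine (AddEquiv.isWeaklyRegular_congr (e := e.toAddEquiv) ?_).1 h₁
    exact List.forall₂_map_right_iff.mpr <| List.forall₂_same.mpr fun r _ x ↦ map_mul e r x
  · rw [← hm, ← Ideal.map_ofList (e : S →+* S')]
    exact Ideal.map_mono h₂
  · have := h₃ (P.comap (e : S →+* S')) (Ideal.IsPrime.comap _)
      (Ideal.map_le_iff_le_comap.1 (by rwa [Ideal.map_ofList]))
    rw [← hm, ← this, Ideal.map_comap_of_surjective (e : S →+* S') e.surjective]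

variable {A : Type u} {S : Type*} [CommRing A] [CommRing S] [IsLocalRing A] [IsLocalRing S]
  [IsNoetherianRing A] [Algebra A S] [IsLocalHom (algebraMap A S)] [Module.Flat A S]

-- The sequence of `A` stays regular under a flat map, and a prime of `S` containing its image
-- contains the extension of the maximal ideal of `A`.
omit [IsNoetherianRing A] in
lemma of_flat_of_fiber (hA : HasRegularParameters A)
    (hP : ∀ P : Ideal S, P.IsPrime → (maximalIdeal A).map (algebraMap A S) ≤ P →
      P = maximalIdeal S) : HasRegularParameters S := by
  obtain ⟨rs, h₁, h₂, h₃⟩ := hA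
  refine ⟨rs.map (algebraMap A S), h₁.of_flat, ?_, fun P hP' hrs ↦ hP P hP' ?_⟩
  · rw [← Ideal.map_ofList]
    exact (Ideal.map_mono h₂).trans
      (((IsLocalRing.local_hom_TFAE (algebraMap A S)).out 0 2 rfl rfl).1 inferInstance)
  · rw [← Ideal.map_ofList, Ideal.map_le_iff_le_comap] at hrs
    rw [Ideal.map_le_iff_le_comap, h₃ _ (Ideal.IsPrime.comap _) hrs]

/-- Multiplication by `h` on the fibre of a flat algebra. -/
lemma _root_.LinearMap.rTensor_smulMap_injective_iff {A : Type*} [CommRing A] {S : Type*}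
    [CommRing S] [Algebra A S] (h : S) (I : Ideal A) :
    Function.Injective ((QuotSMulTop.smulMap A S h).rTensor (A ⧸ I)) ↔
      IsSMulRegular (S ⧸ I.map (algebraMap A S)) h := by
  rw [(Algebra.TensorProduct.quotIdealMapEquivTensorQuot S I).toLinearEquiv.isSMulRegular_congr h]
  refine ⟨fun H x y hxy ↦ H ?_, fun H x y hxy ↦ H ?_⟩
  · rw [QuotSMulTop.rTensor_smulMap, QuotSMulTop.rTensor_smulMap]
    exact hxy
  · rw [QuotSMulTop.rTensor_smulMap, QuotSMulTop.rTensor_smulMap] at hxy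
    exact hxy

/-- The sequence of `A` is prolonged by `h`. Regularity of `h` modulo the earlier elements comes
from the closed fibre by a prime filtration of `A / (rs)`, whose support is the maximal ideal alone.
-/
lemma of_flat_of_fiber_cons (hA : HasRegularParameters A) (h : S) (hm : h ∈ maximalIdeal S)
    (hreg : IsSMulRegular (S ⧸ (maximalIdeal A).map (algebraMap A S)) h)
    (hP : ∀ P : Ideal S, P.IsPrime → (maximalIdeal A).map (algebraMap A S) ≤ P → h ∈ P →
      P = maximalIdeal S) : HasRegularParameters S := by
  obtain ⟨rs, h₁, h₂, h₃⟩ := hA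
  have hmap : (maximalIdeal A).map (algebraMap A S) ≤ maximalIdeal S :=
    ((IsLocalRing.local_hom_TFAE (algebraMap A S)).out 0 2 rfl rfl).1 inferInstance
  refine ⟨rs.map (algebraMap A S) ++ [h], ?_, ?_, fun P hP' hrs ↦ ?_⟩
  · rw [isWeaklyRegular_append_iff]
    refine ⟨h₁.of_flat, ?_⟩
    rw [isWeaklyRegular_singleton_iff]
    have : IsSMulRegular (S ⧸ (Ideal.ofList rs).map (algebraMap A S)) h := by
      rw [← LinearMap.rTensor_smulMap_injective_iff]
      refine LinearMap.rTensor_injective_of_forall_prime _ _ fun p hp ↦ ?_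
      rw [Module.support_eq_zeroLocus, Ideal.annihilator_quotient] at hp
      rw [h₃ p.asIdeal p.2 hp, LinearMap.rTensor_smulMap_injective_iff]
      exact hreg
    rwa [Ideal.map_ofList, (Submodule.quotEquivOfEq _ _ (by simp) : (S ⧸ Ideal.ofList
      (rs.map (algebraMap A S))) ≃ₗ[S] S ⧸ (Ideal.ofList (rs.map (algebraMap A S)) •
        (⊤ : Submodule S S))).isSMulRegular_congr h] at this
  · rw [Ideal.ofList_append, ← Ideal.map_ofList, Ideal.ofList_singleton]
    refine sup_le ((Ideal.map_mono h₂).trans hmap) ?_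
    rwa [Ideal.span_singleton_le_iff_mem]
  · rw [Ideal.ofList_append, ← Ideal.map_ofList, Ideal.ofList_singleton] at hrs
    refine hP P hP' ?_ ((Ideal.span_singleton_le_iff_mem _).1 (le_sup_right.trans hrs))
    have := Ideal.map_le_iff_le_comap.1 (le_sup_left.trans hrs)
    rw [Ideal.map_le_iff_le_comap, h₃ _ (Ideal.IsPrime.comap _) this]

end IsLocalRing.HasRegularParameters

/-- A ring all of whose localizations at primes have regular parameters. -/
def Ring.HasRegularParameters (T : Type*) [CommRing T] : Prop :=
  ∀ (Q : Ideal T) [Q.IsPrime], IsLocalRing.HasRegularParameters (Localization.AtPrime Q)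

namespace Ring.HasRegularParameters

lemma of_field (K : Type*) [Field K] : HasRegularParameters K := by
  intro Q _
  obtain rfl := Ideal.eq_bot_of_prime Q
  apply IsLocalRing.HasRegularParameters.of_isField
  have : IsFractionRing K (Localization.AtPrime (⊥ : Ideal K)) := by
    have : (⊥ : Ideal K).primeCompl = nonZeroDivisors K := by
      ext x; simp [Ideal.primeCompl]
    rw [IsFractionRing, ← this]
    infer_instance
  exact (IsFractionRing.toField K (K := Localization.AtPrime (⊥ : Ideal K))).toIsField

lemma of_ringEquiv {T T' : Type*} [CommRing T] [CommRing T'] (e : T ≃+* T')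
    (h : HasRegularParameters T) : HasRegularParameters T' := by
  intro Q _
  exact (h (Q.comap (e : T →+* T'))).of_ringEquiv
    (Localization.localRingEquiv _ Q e rfl)

end Ring.HasRegularParameters

end Macaulay

/-! ### Smooth algebras over a field are Cohen–Macaulay -/

section Macaulay
open TensorProduct RingTheory.Sequence IsLocalRing

section

variable {A : Type u} {T : Type*} [CommRing A] [CommRing T] [Algebra A T] (Q : Ideal T) [Q.IsPrime]

lemma Localization.AtPrime.eq_maximalIdeal_of_le_under (P : Ideal (Localization.AtPrime Q))
    [P.IsPrime] (h : Q ≤ P.under T) : P = maximalIdeal (Localization.AtPrime Q) := by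
  refine (le_maximalIdeal Ideal.IsPrime.ne_top').antisymm ?_
  rw [← Localization.AtPrime.map_eq_maximalIdeal, Ideal.map_le_iff_le_comap]
  exact h

lemma Localization.AtPrime.under_le (P : Ideal (Localization.AtPrime Q)) [P.IsPrime] :
    P.under T ≤ Q :=
  (Ideal.comap_mono (le_maximalIdeal Ideal.IsPrime.ne_top')).trans
    (Localization.AtPrime.under_maximalIdeal (I := Q)).le

end

namespace Ring.HasRegularParameters

/-- The alternatives for `Q` say that the fibre has dimension zero at `Q`, or that it is a domain in
which a single nonzero element `F` cuts the dimension at `Q` down to zero. They match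
`of_flat_of_fiber` and `of_flat_of_fiber_cons`. -/
lemma of_flat {A : Type u} {T : Type*} [CommRing A] [CommRing T] [Algebra A T] [IsNoetherianRing A]
    [Module.Flat A T] (hA : HasRegularParameters A)
    (h : ∀ (Q : Ideal T) [Q.IsPrime], (∀ (P : Ideal T) [P.IsPrime], P ≤ Q → P.under A = Q.under A →
        P = Q) ∨ (((Q.under A).map (algebraMap A T)).IsPrime ∧ ∃ F ∈ Q,
          F ∉ (Q.under A).map (algebraMap A T) ∧ ∀ (P : Ideal T) [P.IsPrime], P ≤ Q →
            P.under A = Q.under A → F ∈ P → P = Q)) :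
    HasRegularParameters T := by
  intro Q _
  let q := Q.under A
  algebraize [Localization.localRingHom q Q (algebraMap A T) rfl]
  have hfl : Module.Flat (Localization.AtPrime q) (Localization.AtPrime Q) :=
    RingHom.Flat.localRingHom (f := algebraMap A T)
      (RingHom.flat_algebraMap_iff.2 inferInstance) Q q rfl
  have hloc : IsLocalHom (algebraMap (Localization.AtPrime q) (Localization.AtPrime Q)) :=
    Localization.isLocalHom_localRingHom q Q (algebraMap A T) rfl
  have htower : IsScalarTower A (Localization.AtPrime q) (Localization.AtPrime Q) :=
    .of_algebraMap_eq fun x ↦ (Localization.localRingHom_to_map _ _ _ rfl x).symm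
  have hmap : (maximalIdeal (Localization.AtPrime q)).map
      (algebraMap (Localization.AtPrime q) (Localization.AtPrime Q)) =
      (q.map (algebraMap A T)).map (algebraMap T (Localization.AtPrime Q)) := by
    rw [← Localization.AtPrime.map_eq_maximalIdeal, Ideal.map_map, Ideal.map_map,
      ← IsScalarTower.algebraMap_eq, ← IsScalarTower.algebraMap_eq]
  have hq (P : Ideal (Localization.AtPrime Q)) [P.IsPrime]
      (hP : (maximalIdeal (Localization.AtPrime q)).map
        (algebraMap (Localization.AtPrime q) (Localization.AtPrime Q)) ≤ P) :
      (P.under T).under A = Q.under A := by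
    refine (Ideal.comap_mono (Localization.AtPrime.under_le Q P)).antisymm ?_
    rw [hmap, Ideal.map_le_iff_le_comap, Ideal.map_le_iff_le_comap] at hP
    exact hP
  obtain h | ⟨hp, F, hFQ, hF, h⟩ := h Q
  · refine (hA q).of_flat_of_fiber fun P _ hP ↦ ?_
    exact Localization.AtPrime.eq_maximalIdeal_of_le_under Q P
      (h (P.under T) (Localization.AtPrime.under_le Q P) (hq P hP)).ge
  · have hle : q.map (algebraMap A T) ≤ Q := Ideal.map_comap_le
    have hdisj : Disjoint (Q.primeCompl : Set T) (q.map (algebraMap A T) : Ideal T) :=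
      Set.disjoint_left.2 fun x hx hx' ↦ hx (hle hx')
    refine (hA q).of_flat_of_fiber_cons (algebraMap T _ F) ?_ ?_ fun P _ hP hFP ↦ ?_
    · rw [← Localization.AtPrime.map_eq_maximalIdeal]
      exact Ideal.mem_map_of_mem _ hFQ
    · rw [hmap]
      have := IsLocalization.isPrime_of_isPrime_disjoint Q.primeCompl (Localization.AtPrime Q)
        (q.map (algebraMap A T)) hp hdisj
      rw [isSMulRegular_iff_right_eq_zero_of_smul]
      intro x hx
      obtain ⟨x, rfl⟩ := Ideal.Quotient.mk_surjective x
      rw [← Ideal.Quotient.mk_eq_mk, ← Submodule.Quotient.mk_smul, Ideal.Quotient.mk_eq_mk,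
        Ideal.Quotient.eq_zero_iff_mem] at hx
      rw [Ideal.Quotient.eq_zero_iff_mem]
      refine (this.mem_or_mem hx).resolve_left fun hx' ↦ hF ?_
      have := IsLocalization.under_map_of_isPrime_disjoint Q.primeCompl (Localization.AtPrime Q)
        hp hdisj
      rw [← this]
      exact hx'
    · exact Localization.AtPrime.eq_maximalIdeal_of_le_under Q P
        (h (P.under T) (Localization.AtPrime.under_le Q P) (hq P hP) hFP).ge

/-- In a quasi-finite algebra two primes with the same contraction are never strictly nested. -/
lemma of_quasiFinite {A : Type u} {T : Type*} [CommRing A] [CommRing T] [Algebra A T]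
    [IsNoetherianRing A] [Module.Flat A T] [Algebra.QuasiFinite A T]
    (hA : HasRegularParameters A) : HasRegularParameters T :=
  hA.of_flat fun Q _ ↦ .inl fun P _ h₁ h₂ ↦ Algebra.QuasiFinite.eq_of_le_of_under_eq P Q h₁ h₂

-- The fibre over the common contraction is a polynomial ring in one variable over a field, whose
-- dimension is at most one, so it has no chain `P₀ < P < Q`.
open Polynomial in
lemma _root_.Polynomial.eq_of_le_of_lt_of_under_eq {A : Type*} [CommRing A] {P₀ P Q : Ideal A[X]}
    [P₀.IsPrime] [P.IsPrime] [Q.IsPrime] (h₀ : P₀ < P) (h : P ≤ Q)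
    (h₁ : P₀.under A = Q.under A) (h₂ : P.under A = Q.under A) : P = Q := by
  let p : PrimeSpectrum A := ⟨Q.under A, inferInstance⟩
  let e := PrimeSpectrum.preimageOrderIsoFiber A A[X] p
  have hdim : Ring.KrullDimLE 1 (p.asIdeal.Fiber A[X]) := by
    rw [Ring.krullDimLE_iff,
      ← ringKrullDim_eq_of_ringEquiv (polyEquivTensor A (p.asIdeal.ResidueField)).toRingEquiv,
      ← Ring.krullDimLE_iff]
    infer_instance
  by_contra hne
  let x₀ : PrimeSpectrum.comap (algebraMap A A[X]) ⁻¹' {p} := ⟨⟨P₀, ‹_›⟩, PrimeSpectrum.ext h₁⟩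
  let x₁ : PrimeSpectrum.comap (algebraMap A A[X]) ⁻¹' {p} := ⟨⟨P, ‹_›⟩, PrimeSpectrum.ext h₂⟩
  let x₂ : PrimeSpectrum.comap (algebraMap A A[X]) ⁻¹' {p} := ⟨⟨Q, ‹_›⟩, rfl⟩
  have l₁ : e x₀ < e x₁ := e.strictMono h₀
  have h' : P < Q := lt_of_le_of_ne h hne
  have l₂ : e x₁ < e x₂ := e.strictMono h'
  have := Order.krullDim_le_one_iff.1 (Ring.krullDimLE_iff.1 hdim) (e x₁)
  exact this.elim (fun h ↦ (h.not_lt l₁)) fun h ↦ h.not_lt l₂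

-- With `𝔮 = Q ∩ A`, the ideal `𝔮 A[X]` is the least prime over `𝔮`. Either it equals `Q`, or any `F
-- ∈ Q` outside it is contained in no smaller prime over `𝔮`, because the fibre has dimension at
-- most one.
open Polynomial in
lemma polynomial {A : Type u} [CommRing A] [IsNoetherianRing A] (hA : HasRegularParameters A) :
    HasRegularParameters A[X] := by
  refine hA.of_flat fun Q _ ↦ ?_
  have hprime : ((Q.under A).map (algebraMap A A[X])).IsPrime :=
    Ideal.isPrime_map_C_of_isPrime
  have hu : ((Q.under A).map (algebraMap A A[X])).under A = Q.under A :=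
    (Ideal.comap_mono Ideal.map_comap_le).antisymm Ideal.le_comap_map
  by_cases hQ : Q ≤ (Q.under A).map (algebraMap A A[X])
  · refine .inl fun P _ h₁ h₂ ↦ h₁.antisymm (hQ.trans ?_)
    rw [← h₂]
    exact Ideal.map_comap_le
  · obtain ⟨F, hFQ, hF⟩ := SetLike.not_le_iff_exists.1 hQ
    refine .inr ⟨hprime, F, hFQ, hF, fun P _ h₁ h₂ hFP ↦ ?_⟩
    refine Polynomial.eq_of_le_of_lt_of_under_eq
      (P₀ := (Q.under A).map (algebraMap A A[X])) ?_ h₁ hu h₂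
    refine lt_of_le_of_ne ?_ fun h ↦ hF (h ▸ hFP)
    rw [← h₂]
    exact Ideal.map_comap_le

lemma mvPolynomial {K : Type u} [Field K] (n : ℕ) :
    HasRegularParameters (MvPolynomial (Fin n) K) := by
  induction n with
  | zero => exact (of_field K).of_ringEquiv (MvPolynomial.isEmptyRingEquiv K (Fin 0)).symm
  | succ n ih => exact ih.polynomial.of_ringEquiv (MvPolynomial.finSuccEquiv K n).symm.toRingEquiv

/-- Standard smooth algebras over a field have regular parameters. -/
lemma of_isStandardSmooth {K T : Type u} [Field K] [CommRing T] [Algebra K T]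
    [Algebra.IsStandardSmooth K T] : HasRegularParameters T := by
  -- A standard smooth algebra is étale over a polynomial ring, hence flat and quasi-finite over it.
  obtain ⟨n, g, -, hg⟩ := RingHom.IsStandardSmooth.exists_etale_mvPolynomial
    (f := algebraMap K T) (by rwa [RingHom.isStandardSmooth_algebraMap])
  algebraize [g]
  exact (mvPolynomial n).of_quasiFinite (A := MvPolynomial (Fin n) K)

end Ring.HasRegularParameters

end Macaulay

/-! ### Unmixedness, and relations between the elements of a regular sequence -/

section Unmixed
open TensorProduct RingTheory.Sequence IsLocalRing

section

variable {S : Type u} [CommRing S]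

/-- Dividing by one regular element lowers by one the range in which `Ext^i(S/I, -)` vanishes, by
the long exact sequence. As the range is longer than the sequence, `Hom(S/I, M/(rs)M) = 0` remains
at the end. -/
lemma ModuleCat.eq_zero_of_subsingleton_ext (I : Ideal S) (rs : List S) :
    ∀ (M : ModuleCat.{u} S) (n : ℕ), IsWeaklyRegular M rs → rs.length < n →
      (∀ i < n, Subsingleton (Ext (ModuleCat.of S (S ⧸ I)) M i)) →
      ∀ x : M ⧸ (Ideal.ofList rs • (⊤ : Submodule S M)), (∀ a ∈ I, a • x = 0) → x = 0 := by
  induction rs with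
  | nil =>
    intro M n _ hn h x hx
    have : Subsingleton (ModuleCat.of S (S ⧸ I) ⟶ M) :=
      Ext.addEquiv₀.subsingleton_congr.mp (h 0 (by simpa using hn))
    have : Subsingleton ((S ⧸ I) →ₗ[S] M) :=
      (ModuleCat.homAddEquiv (M := ModuleCat.of S (S ⧸ I)) (N := M)).symm.subsingleton
    let e : (M ⧸ (Ideal.ofList ([] : List S) • (⊤ : Submodule S M))) ≃ₗ[S] M :=
      Submodule.quotEquivOfEqBot _ (by simp)
    let φ : (S ⧸ I) →ₗ[S] M := Submodule.liftQ I (LinearMap.toSpanSingleton S M (e x)) fun a ha ↦ by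
      rw [LinearMap.mem_ker, LinearMap.toSpanSingleton_apply, ← map_smul, hx a ha, map_zero]
    have h1 : φ (Submodule.Quotient.mk 1) = e x := one_smul S (e x)
    rw [Subsingleton.elim φ 0] at h1
    exact e.injective (h1.symm.trans (map_zero e).symm)
  | cons f rs ih =>
    intro M n hM hn h x hx
    rw [isWeaklyRegular_cons_iff] at hM
    let e := Submodule.quotOfListConsSMulTopEquivQuotSMulTopInner M f rs
    have hn' : rs.length < n - 1 := by
      rw [List.length_cons] at hn
      omega
    have := ih (ModuleCat.of S (QuotSMulTop f M)) (n - 1) hM.2 hn' (fun i hi ↦ by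
      have zero1 := AddCommGrpCat.isZero_of_iff_subsingleton.mpr (h i (by omega))
      have zero2 := AddCommGrpCat.isZero_of_iff_subsingleton.mpr (h (i + 1) (by omega))
      exact AddCommGrpCat.subsingleton_of_isZero <| ShortComplex.Exact.isZero_of_both_zeros
        ((Ext.covariant_sequence_exact₃' (ModuleCat.of S (S ⧸ I))
          hM.1.smulShortComplex_shortExact) i (i + 1) rfl)
        (zero1.eq_zero_of_src _) (zero2.eq_zero_of_tgt _)) (e x) fun a ha ↦ by
      rw [← map_smul, hx a ha, map_zero]
    exact e.injective (this.trans (map_zero e).symm)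

/-- Unmixedness: the quotient by a regular sequence has positive depth unless it has dimension
zero. -/
lemma IsLocalRing.HasRegularParameters.eq_maximalIdeal [IsLocalRing S] [IsNoetherianRing S]
    (hS : HasRegularParameters S) {rs : List S} (hrs : IsWeaklyRegular S rs)
    (hm : Ideal.ofList rs ≤ maximalIdeal S) {x : S} (hx : x ∉ Ideal.ofList rs)
    (hxm : ∀ a ∈ maximalIdeal S, a * x ∈ Ideal.ofList rs) (P : Ideal S) [P.IsPrime]
    (hP : Ideal.ofList rs ≤ P) : P = maximalIdeal S := by
  obtain ⟨gs, h₁, h₂, h₃⟩ := hS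
  have hgs : IsRegular S gs := (IsLocalRing.isRegular_iff_isWeaklyRegular_of_subset_maximalIdeal
    fun r hr ↦ h₂ (Ideal.subset_span hr)).2 h₁
  have hrs' : IsRegular S rs := (IsLocalRing.isRegular_iff_isWeaklyRegular_of_subset_maximalIdeal
    fun r hr ↦ hm (Ideal.subset_span hr)).2 hrs
  -- Otherwise the depth supplied by `gs` exceeds the length of `rs`, and the socle element `x` of
  -- `S / (rs)` would be zero.
  have hlen : gs.length ≤ rs.length := by
    by_contra! hlt
    have hext := ModuleCat.subsingleton_ext_of_exists_isRegular (maximalIdeal S)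
      (ModuleCat.of S (S ⧸ maximalIdeal S))
      (by rw [Module.support_eq_zeroLocus, Ideal.annihilator_quotient]) (ModuleCat.of S S)
      (by rw [smul_eq_mul, Ideal.mul_top]; exact Ideal.IsPrime.ne_top'.lt_top) gs
      (fun r hr ↦ h₂ (Ideal.subset_span hr)) hgs
    have := ModuleCat.eq_zero_of_subsingleton_ext (maximalIdeal S) rs (ModuleCat.of S S) gs.length
      hrs hlt hext (Submodule.Quotient.mk x) fun a ha ↦ by
        rw [← Submodule.Quotient.mk_smul, Submodule.Quotient.mk_eq_zero, smul_eq_mul, smul_eq_mul,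
          Ideal.mul_top]
        exact hxm a ha
    rw [Submodule.Quotient.mk_eq_zero, smul_eq_mul, Ideal.mul_top] at this
    exact hx this
  have hgd : ringKrullDim (S ⧸ Ideal.ofList gs) ≤ 0 := by
    refine Ring.krullDimLE_iff.1
      (Ideal.krullDimLE_zero_quotient_iff_forall_minimalPrimes_isMaximal.2 fun J hJ ↦ ?_)
    rw [h₃ J hJ.1.1 hJ.1.2]
    infer_instance
  have e₁ := ringKrullDim_add_length_eq_ringKrullDim_of_isRegular gs hgs
  have e₂ := ringKrullDim_add_length_eq_ringKrullDim_of_isRegular rs hrs'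
  -- Both quotients satisfy `dim S = dim S/(gs) + |gs| = dim S/(rs) + |rs|`, where `|gs| ≤ |rs|` and
  -- `dim S/(gs) ≤ 0`.
  have hrd : ringKrullDim (S ⧸ Ideal.ofList rs) ≤ 0 := by
    have : ringKrullDim (S ⧸ Ideal.ofList rs) + rs.length ≤ 0 + rs.length := by
      rw [e₂, ← e₁]
      exact add_le_add hgd (by exact_mod_cast hlen)
    exact (WithBot.add_le_add_iff_right' (WithBot.natCast_ne_bot _) fun h ↦
      ENat.natCast_ne_top _ (WithBot.coe_injective h)).1 this
  have := Ring.krullDimLE_iff.2 hrd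
  have hmin : P.map (Ideal.Quotient.mk (Ideal.ofList rs)) |>.IsPrime :=
    Ideal.map_isPrime_of_surjective Ideal.Quotient.mk_surjective (by rwa [Ideal.mk_ker])
  have hmax := hmin.isMaximal'
  have : P.IsMaximal := by
    have h := Ideal.comap_isMaximal_of_surjective (Ideal.Quotient.mk (Ideal.ofList rs))
      Ideal.Quotient.mk_surjective (K := P.map (Ideal.Quotient.mk (Ideal.ofList rs)))
    rwa [Ideal.comap_map_of_surjective' _ Ideal.Quotient.mk_surjective, Ideal.mk_ker,
      sup_eq_left.2 hP] at h
  exact IsLocalRing.eq_maximalIdeal this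

end

section

variable {S : Type*} [CommRing S]

/-- The relations of a weakly regular sequence have coefficients in the ideal it generates. -/
lemma RingTheory.Sequence.IsWeaklyRegular.mem_of_sum_eq_zero {r : ℕ} {f : Fin r → S}
    (hf : IsWeaklyRegular S (List.ofFn f)) {a : Fin r → S} (h : ∑ i, a i * f i = 0) (i : Fin r) :
    a i ∈ Ideal.span (Set.range f) := by
  induction r with
  | zero => exact i.elim0
  | succ r ih =>
    have hl : List.ofFn f = List.ofFn (fun j : Fin r ↦ f j.castSucc) ++ [f (Fin.last r)] :=
      List.ofFn_succ_last
    rw [hl, isWeaklyRegular_append_iff, isWeaklyRegular_singleton_iff] at hf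
    have hI : Ideal.ofList (List.ofFn fun j : Fin r ↦ f j.castSucc) =
        Ideal.span (Set.range fun j : Fin r ↦ f j.castSucc) := by
      rw [Ideal.ofList]
      congr 1
      ext
      simp [List.mem_ofFn]
    rw [hI] at hf
    have hle : Ideal.span (Set.range fun j : Fin r ↦ f j.castSucc) ≤ Ideal.span (Set.range f) :=
      Ideal.span_mono (Set.range_comp_subset_range Fin.castSucc f)
    rw [Fin.sum_univ_castSucc] at h
    -- The relation puts the last term into the ideal of the earlier elements, modulo which the last
    -- element is regular.
    have hlast : a (Fin.last r) ∈ Ideal.span (Set.range fun j : Fin r ↦ f j.castSucc) := by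
      have := hf.2.right_eq_zero_of_smul (x := Submodule.Quotient.mk (a (Fin.last r))) (by
        rw [← Submodule.Quotient.mk_smul, Submodule.Quotient.mk_eq_zero, smul_eq_mul, smul_eq_mul,
          Ideal.mul_top, mul_comm, ← neg_mem_iff, ← eq_neg_iff_add_eq_zero.2 h]
        exact Ideal.sum_mem _ fun j _ ↦ Ideal.mul_mem_left _ _ (Ideal.subset_span ⟨j, rfl⟩))
      rwa [Submodule.Quotient.mk_eq_zero, smul_eq_mul, Ideal.mul_top] at this
    obtain ⟨b, hb⟩ := (Ideal.mem_span_range_iff_exists_fun).1 hlast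
    -- Expressing the last coefficient through the earlier elements turns the relation into a
    -- shorter one.
    have h' := ih hf.1 (a := fun j ↦ a j.castSucc + b j * f (Fin.last r)) (by
      simp only [add_mul, Finset.sum_add_distrib]
      rw [← h, ← hb, Finset.sum_mul]
      congr 1
      exact Finset.sum_congr rfl fun j _ ↦ by ring)
    induction i using Fin.lastCases with
    | last => exact hle hlast
    | cast j =>
      have := Ideal.sub_mem _ (hle (h' j)) (Ideal.mul_mem_left (Ideal.span (Set.range f)) (b j)
        (Ideal.subset_span ⟨Fin.last r, rfl⟩))
      rwa [add_sub_cancel_right] at this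

/-- An element of `I²` is a combination of the `f i` with coefficients in `I`; its difference from
the given expression is a relation, whose coefficients lie in `I` as well. So the `f i` are
independent in the conormal module `I / I²`. -/
lemma RingTheory.Sequence.IsWeaklyRegular.mem_of_sum_mem_sq {r : ℕ} {f : Fin r → S}
    (hf : IsWeaklyRegular S (List.ofFn f)) {a : Fin r → S}
    (h : ∑ i, a i * f i ∈ Ideal.span (Set.range f) ^ 2) (i : Fin r) :
    a i ∈ Ideal.span (Set.range f) := by
  have h' : ∑ i, a i * f i ∈ Ideal.span (Set.range f) • Ideal.span (Set.range f) := by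
    rwa [smul_eq_mul, ← sq]
  obtain ⟨b, hbI, hb⟩ := (Submodule.mem_ideal_smul_span_iff_exists_sum _ _ _).1 h'
  rw [Finsupp.sum_fintype _ _ (by simp)] at hb
  have := hf.mem_of_sum_eq_zero (a := fun j ↦ a j - b j) (by
    simp only [sub_mul, Finset.sum_sub_distrib]
    rw [sub_eq_zero]
    exact hb.symm) i
  have := Ideal.add_mem _ this (hbI i)
  rwa [sub_add_cancel] at this

end
end Unmixed

/-! ### The Jacobian map over a field -/

section ConormalField
open TensorProduct RingTheory.Sequence IsLocalRing KaehlerDifferential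

lemma Ideal.ofList_ofFn {S : Type*} [CommRing S] {r : ℕ} (f : Fin r → S) :
    Ideal.ofList (List.ofFn f) = Ideal.span (Set.range f) := by
  rw [Ideal.ofList]
  congr 1
  ext
  simp [List.mem_ofFn]

/-- If `S / I` is formally smooth over `K`, where `I` is generated by a regular sequence `f`, then
the differentials `d f i` are linearly independent in `Ω_S / I Ω_S`. -/
lemma RingTheory.Sequence.IsWeaklyRegular.mem_of_sum_smul_D_mem {K S A : Type*} [CommRing K]
    [CommRing S] [CommRing A] [Algebra K S] [Algebra K A] [Algebra S A] [IsScalarTower K S A]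
    [Algebra.FormallySmooth K S] [Algebra.FormallySmooth K A]
    (hsurj : Function.Surjective (algebraMap S A)) {r : ℕ} {f : Fin r → S}
    (hf : IsWeaklyRegular S (List.ofFn f))
    (hker : RingHom.ker (algebraMap S A) = Ideal.span (Set.range f)) {c : Fin r → S}
    (hc : ∑ i, c i • D K S (f i) ∈ Ideal.span (Set.range f) • (⊤ : Submodule S Ω[S⁄K]))
    (i : Fin r) : c i ∈ Ideal.span (Set.range f) := by
  -- Formal smoothness of `A` gives a retraction `l` of `I / I² ⟶ A ⊗ Ω`. The element `∑ c i * f i`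
  -- has zero differential in `A ⊗ Ω`, so it lies in `I²`, where regularity of the sequence applies.
  obtain ⟨l, hl⟩ := (Algebra.FormallySmooth.iff_split_injection (R := K) hsurj).1 inferInstance
  refine hf.mem_of_sum_mem_sq (a := c) ?_ i
  rw [← hker] at hc ⊢
  have hfm : ∀ i, f i ∈ RingHom.ker (algebraMap S A) := fun i ↦
    hker ▸ Ideal.subset_span ⟨i, rfl⟩
  let z : RingHom.ker (algebraMap S A) :=
    ⟨∑ i, c i * f i, Ideal.sum_mem _ fun i _ ↦ Ideal.mul_mem_left _ _ (hfm i)⟩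
  have h0 : ∀ x ∈ RingHom.ker (algebraMap S A) • (⊤ : Submodule S Ω[S⁄K]),
      (1 : A) ⊗ₜ[S] x = 0 := by
    intro x hx
    refine Submodule.smul_induction_on hx (fun a ha y _ ↦ ?_) fun x y hx hy ↦ ?_
    · rw [TensorProduct.tmul_smul, TensorProduct.smul_tmul', Algebra.smul_def,
        RingHom.mem_ker.1 ha, zero_mul, TensorProduct.zero_tmul]
    · rw [TensorProduct.tmul_add, hx, hy, add_zero]
  have h1 : kerCotangentToTensor K S A (Ideal.toCotangent _ z) = 0 := by
    rw [kerCotangentToTensor_toCotangent]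
    apply h0
    have : D K S (z : S) = ∑ i, c i • D K S (f i) + ∑ i, f i • D K S (c i) := by
      rw [← Finset.sum_add_distrib]
      simp [z, Derivation.leibniz]
    rw [this]
    exact Submodule.add_mem _ hc (Submodule.sum_mem _ fun i _ ↦
      Submodule.smul_mem_smul (hfm i) trivial)
  have h2 : Ideal.toCotangent _ z = 0 := by
    have := LinearMap.congr_fun hl (Ideal.toCotangent _ z)
    rw [LinearMap.comp_apply, h1, map_zero] at this
    exact this.symm
  exact (Ideal.toCotangent_eq_zero _ z).1 h2

section

variable {T A : Type*} [CommRing T] [CommRing A] [Algebra T A]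
  (hsurj : Function.Surjective (algebraMap T A)) (q : Ideal A) [q.IsPrime]

include hsurj

lemma Localization.localRingHom_surjective_of_surjective :
    Function.Surjective (Localization.localRingHom (q.under T) q (algebraMap T A) rfl) :=
  RingHom.surjectiveOnStalks_of_surjective hsurj q inferInstance

lemma Localization.ker_localRingHom_of_surjective :
    RingHom.ker (Localization.localRingHom (q.under T) q (algebraMap T A) rfl) =
      (RingHom.ker (algebraMap T A)).map (algebraMap T (Localization.AtPrime (q.under T))) := by
  refine le_antisymm (fun x hx ↦ ?_) (Ideal.map_le_iff_le_comap.2 fun a ha ↦ ?_)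
  · obtain ⟨a, t, rfl⟩ := IsLocalization.exists_mk'_eq (q.under T).primeCompl x
    rw [RingHom.mem_ker, Localization.localRingHom_mk', IsLocalization.mk'_eq_zero_iff] at hx
    obtain ⟨⟨u, hu⟩, h⟩ := hx
    obtain ⟨u, rfl⟩ := hsurj u
    rw [IsLocalization.mk'_mem_map_algebraMap_iff]
    refine ⟨u, hu, ?_⟩
    rw [RingHom.mem_ker, map_mul]
    exact h
  · rw [Ideal.mem_comap, RingHom.mem_ker, Localization.localRingHom_to_map, RingHom.mem_ker.1 ha,
      map_zero]

end

/-- The Jacobian map of a generically smooth complete intersection over a field is injective. -/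
theorem Algebra.IsStandardSmooth.mem_of_sum_smul_D_mem {K T A : Type u} [Field K] [CommRing T]
    [CommRing A] [Algebra K T] [Algebra K A] [Algebra T A] [IsScalarTower K T A]
    [Algebra.IsStandardSmooth K T] (hsurj : Function.Surjective (algebraMap T A)) {r : ℕ}
    {f : Fin r → T} (hker : RingHom.ker (algebraMap T A) = Ideal.span (Set.range f))
    (hreg : ∀ (Q : Ideal T) [Q.IsPrime], Ideal.span (Set.range f) ≤ Q →
      IsWeaklyRegular (Localization.AtPrime Q)
        (List.ofFn fun i ↦ algebraMap T (Localization.AtPrime Q) (f i)))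
    (hsm : ∀ q ∈ minimalPrimes A, ∀ _ : q.IsPrime,
      Algebra.FormallySmooth K (Localization.AtPrime q))
    {c : Fin r → T}
    (hc : ∑ i, c i • D K T (f i) ∈ Ideal.span (Set.range f) • (⊤ : Submodule T Ω[T⁄K]))
    (i : Fin r) : c i ∈ Ideal.span (Set.range f) := by
  by_contra hi
  have hT : IsNoetherianRing T := Algebra.FiniteType.isNoetherianRing K T
  have hA : IsNoetherianRing A := isNoetherianRing_of_surjective T A _ hsurj
  have hci : algebraMap T A (c i) ≠ 0 := fun h ↦ hi (hker ▸ h)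
  -- If `c i` is nonzero in `A`, its annihilator lies in an associated prime `q`, the annihilator of
  -- some `y`. It turns out that `q` is minimal and that `c i` vanishes in `A_q`, which is a
  -- contradiction.
  obtain ⟨q, hq, hle⟩ := exists_le_isAssociatedPrime_of_isNoetherianRing A (algebraMap T A (c i)) hci
  obtain ⟨hqp, y, hy⟩ := isAssociatedPrime_iff.1 hq
  obtain ⟨y, rfl⟩ := hsurj y
  let Q := q.under T
  let S := Localization.AtPrime Q
  let J := Ideal.span (Set.range f)
  have hmemJ : ∀ x, algebraMap T A x = 0 ↔ x ∈ J := fun x ↦ by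
    rw [← RingHom.mem_ker, hker]
  have hJQ : J ≤ Q := fun x hx ↦ by
    change algebraMap T A x ∈ q
    rw [(hmemJ x).2 hx]
    exact zero_mem q
  have hmemq : ∀ x, algebraMap T A (x * y) = 0 ↔ x ∈ Q := fun x ↦ by
    change _ ↔ algebraMap T A x ∈ q
    rw [hy, Submodule.mem_colon_singleton, map_mul, Submodule.mem_bot, smul_eq_mul]
  have hJS : Ideal.ofList (List.ofFn fun i ↦ algebraMap T S (f i)) = J.map (algebraMap T S) := by
    rw [Ideal.ofList_ofFn, Ideal.map_span, ← Set.range_comp]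
    rfl
  have hmQ : J.map (algebraMap T S) ≤ maximalIdeal S := by
    rw [← Localization.AtPrime.map_eq_maximalIdeal]
    exact Ideal.map_mono hJQ
  have hnot : ∀ x, algebraMap T S x ∈ J.map (algebraMap T S) → ∃ u ∉ Q, u * x ∈ J := fun x hx ↦ by
    obtain ⟨u, hu, h⟩ := (IsLocalization.algebraMap_mem_map_algebraMap_iff Q.primeCompl S J x).1 hx
    exact ⟨u, hu, h⟩
  -- The element `y` is nonzero in `S / J S` and killed by the maximal ideal. Since `S` has regular
  -- parameters, unmixedness leaves the maximal ideal as the only prime over `J S`.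
  have hprime (P : Ideal S) [P.IsPrime] (hP : J.map (algebraMap T S) ≤ P) : P = maximalIdeal S := by
    refine (Ring.HasRegularParameters.of_isStandardSmooth (K := K) Q).eq_maximalIdeal (hreg Q hJQ)
      (hJS.trans_le hmQ) (x := algebraMap T S y) ?_ ?_ P (hJS.trans_le hP)
    · rw [hJS]
      intro h
      obtain ⟨u, hu, h⟩ := hnot y h
      exact hu ((hmemq u).1 ((hmemJ _).2 h))
    · intro a ha
      rw [hJS]
      obtain ⟨b, t, rfl⟩ := IsLocalization.exists_mk'_eq Q.primeCompl a
      have hb : b ∈ Q := (IsLocalization.AtPrime.mk'_mem_maximal_iff S Q b t).1 ha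
      rw [mul_comm, IsLocalization.mul_mk'_eq_mk'_of_mul, IsLocalization.mk'_mem_map_algebraMap_iff]
      refine ⟨1, one_mem _, ?_⟩
      rw [one_mul, mul_comm y b, ← hmemJ, hmemq]
      exact hb
  have hmin : q ∈ minimalPrimes A := by
    refine ⟨⟨hqp, bot_le⟩, fun P hP hPq ↦ ?_⟩
    have := hP.1
    have hle' : P.under T ≤ Q := Ideal.comap_mono hPq
    have hdisj : Disjoint (Q.primeCompl : Set T) (P.under T : Ideal T) :=
      Set.disjoint_left.2 fun x hx hx' ↦ hx (hle' hx')
    have hpr := IsLocalization.isPrime_of_isPrime_disjoint Q.primeCompl S (P.under T)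
      inferInstance hdisj
    have h1 := hprime ((P.under T).map (algebraMap T S)) (Ideal.map_mono fun x hx ↦ by
      change algebraMap T A x ∈ P
      rw [(hmemJ x).2 hx]
      exact zero_mem P)
    have h2 := IsLocalization.under_map_of_isPrime_disjoint Q.primeCompl S
      (inferInstance : (P.under T).IsPrime) hdisj
    rw [h1, Localization.AtPrime.under_maximalIdeal] at h2
    exact (Ideal.comap_injective_of_surjective (algebraMap T A) hsurj h2).le
  have := hsm q hmin hqp
  algebraize [Localization.localRingHom Q q (algebraMap T A) rfl]
  have htower : IsScalarTower K S (Localization.AtPrime q) := .of_algebraMap_eq fun x ↦ by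
    rw [IsScalarTower.algebraMap_apply K T S, IsScalarTower.algebraMap_apply K A]
    refine Eq.trans ?_ (Localization.localRingHom_to_map _ _ _ rfl _).symm
    exact congrArg (algebraMap A _) (IsScalarTower.algebraMap_apply K T A x)
  have hTS : Algebra.FormallySmooth T S := Algebra.FormallySmooth.of_isLocalization Q.primeCompl
  have hKS : Algebra.FormallySmooth K S := Algebra.FormallySmooth.comp K T S
  have hspan : Ideal.span (Set.range fun i ↦ algebraMap T S (f i)) = J.map (algebraMap T S) := by
    rw [← hJS, Ideal.ofList_ofFn]
  -- Formal smoothness at the minimal prime `q` gives `c i ∈ J S`, so an element outside `Q`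
  -- multiplies `c i` into `J`, although the annihilator of `c i` in `A` lies in `q`.
  have h := (hreg Q hJQ).mem_of_sum_smul_D_mem (K := K) (A := Localization.AtPrime q)
    (Localization.localRingHom_surjective_of_surjective hsurj q)
    ((Localization.ker_localRingHom_of_surjective hsurj q).trans (by rw [hker]; exact hspan.symm))
    (c := fun i ↦ algebraMap T S (c i)) ?_ i
  · rw [hspan] at h
    obtain ⟨u, hu, h⟩ := hnot _ h
    refine hu (hle ?_)
    rw [Submodule.mem_colon_singleton, Submodule.mem_bot, smul_eq_mul, ← map_mul]
    exact (hmemJ _).2 h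
  · have hmap : ∀ x ∈ J • (⊤ : Submodule T Ω[T⁄K]), KaehlerDifferential.map K K T S x ∈
        J.map (algebraMap T S) • (⊤ : Submodule S Ω[S⁄K]) := by
      intro x hx
      refine Submodule.smul_induction_on hx (fun a ha y _ ↦ ?_) fun x y hx hy ↦ ?_
      · rw [map_smul, ← algebraMap_smul S]
        exact Submodule.smul_mem_smul (Ideal.mem_map_of_mem _ ha) trivial
      · rw [map_add]
        exact add_mem hx hy
    rw [hspan]
    convert hmap _ hc using 1
    rw [map_sum]
    refine Finset.sum_congr rfl fun j _ ↦ ?_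
    rw [map_smul, KaehlerDifferential.map_D]
    exact algebraMap_smul S (c j) (D K S (algebraMap T S (f j)))

end ConormalField

/-! ### Regularity of the equations on the fibres -/

section FiberRegular
open TensorProduct RingTheory.Sequence IsLocalRing

lemma List.map_ofFn_fun {α β : Type*} {r : ℕ} (g : α → β) (f : Fin r → α) :
    (List.ofFn f).map g = List.ofFn fun i ↦ g (f i) := by
  rw [List.map_ofFn]
  rfl

/-- A weakly regular sequence with quotient flat over the base stays regular on the fibres, locally
on the zero locus of the sequence. -/
lemma RingTheory.Sequence.IsWeaklyRegular.localization_tensorProduct {R P K : Type u} [CommRing R]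
    [CommRing P] [CommRing K] [Algebra R P] [Algebra R K] [IsNoetherianRing P] {r : ℕ}
    {f : Fin r → P} (hf : IsWeaklyRegular P (List.ofFn f))
    [Module.Flat R (P ⧸ Ideal.span (Set.range f))] (Q : Ideal (K ⊗[R] P)) [Q.IsPrime]
    (hQ : ∀ i, 1 ⊗ₜ f i ∈ Q) :
    IsWeaklyRegular (Localization.AtPrime Q)
      (List.ofFn fun i ↦ algebraMap (K ⊗[R] P) (Localization.AtPrime Q) (1 ⊗ₜ f i)) := by
  let J := Ideal.span (Set.range f)
  let ι : P →+* K ⊗[R] P := Algebra.TensorProduct.includeRight.toRingHom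
  -- Over the localization of `P` at `q` the sequence lies in the maximal ideal, as
  -- `flat_and_tensorProduct` requires.
  let q : Ideal P := Q.comap ι
  let S := Localization.AtPrime q
  have hJ : Ideal.ofList (List.ofFn fun i ↦ algebraMap P S (f i)) = J.map (algebraMap P S) := by
    rw [Ideal.ofList_ofFn, Ideal.map_span, ← Set.range_comp]
    rfl
  have hS : IsWeaklyRegular S (List.ofFn fun i ↦ algebraMap P S (f i)) := by
    have := hf.of_flat (S := S)
    rwa [List.map_ofFn_fun] at this
  have hSm : ∀ x ∈ List.ofFn (fun i ↦ algebraMap P S (f i)), x ∈ maximalIdeal S := by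
    intro x hx
    obtain ⟨i, rfl⟩ := (List.mem_ofFn' _ _).1 hx
    rw [← Localization.AtPrime.map_eq_maximalIdeal]
    exact Ideal.mem_map_of_mem _ (hQ i)
  have hflat : Module.Flat R (S ⧸ (Ideal.ofList (List.ofFn fun i ↦ algebraMap P S (f i)) •
      (⊤ : Submodule S S))) := by
    have h1 : Module.Flat R ((P ⧸ J) ⊗[P] S) := Module.Flat.trans R (P ⧸ J) _
    have e : (S ⧸ J.map (algebraMap P S)) ≃ₗ[P] (P ⧸ J) ⊗[P] S :=
      (Algebra.TensorProduct.quotIdealMapEquivTensorQuot S J).toLinearEquiv.restrictScalars P ≪≫ₗ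
        TensorProduct.comm P S (P ⧸ J)
    have e' : (S ⧸ (Ideal.ofList (List.ofFn fun i ↦ algebraMap P S (f i)) •
      (⊤ : Submodule S S))) ≃ₗ[S] (S ⧸ J.map (algebraMap P S)) :=
      Submodule.quotEquivOfEq _ _ (by rw [hJ, smul_eq_mul, Ideal.mul_top])
    have : Module.Flat R (S ⧸ J.map (algebraMap P S)) :=
      Module.Flat.of_linearEquiv (e.restrictScalars R)
    exact Module.Flat.of_linearEquiv (e'.restrictScalars R)
  have h₁ := (IsWeaklyRegular.flat_and_tensorProduct (R := R) _ hSm S hS hflat).2 K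
  let := Algebra.TensorProduct.rightAlgebra (R := R) (A := K) (B := S)
  have h₂ : IsWeaklyRegular (K ⊗[R] S)
      (List.ofFn fun i ↦ (1 : K) ⊗ₜ[R] algebraMap P S (f i)) := by
    have := (Algebra.TensorProduct.commRight R S K).toLinearEquiv.isWeaklyRegular_congr
      (List.ofFn fun i ↦ algebraMap P S (f i)) |>.1 h₁
    have := (isWeaklyRegular_map_algebraMap_iff (K ⊗[R] S) (K ⊗[R] S) _).2 this
    rw [List.map_ofFn_fun] at this
    exact this
  -- The maps `g₁` and `g` are `K ⊗ P ⟶ K ⊗ P_q ⟶ (K ⊗ P)_Q`. The second is a localization, hence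
  -- flat, and carries regularity over.
  let g₁ : K ⊗[R] P →ₐ[R] K ⊗[R] S :=
    Algebra.TensorProduct.map (AlgHom.id R K) (IsScalarTower.toAlgHom R P S)
  let g₂ : S →ₐ[R] Localization.AtPrime Q :=
    { Localization.localRingHom q Q ι rfl with
      commutes' := fun x ↦ by
        refine (congrArg (Localization.localRingHom q Q ι rfl)
          (IsScalarTower.algebraMap_apply R P S x)).trans ?_
        refine (Localization.localRingHom_to_map q Q ι rfl _).trans ?_
        exact (congrArg (algebraMap (K ⊗[R] P) (Localization.AtPrime Q))
          ((Algebra.TensorProduct.includeRight (R := R) (A := K) (B := P)).commutes x)).trans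
          (IsScalarTower.algebraMap_apply R (K ⊗[R] P) (Localization.AtPrime Q) x).symm }
  let g : K ⊗[R] S →ₐ[R] Localization.AtPrime Q :=
    Algebra.TensorProduct.lift ((Algebra.ofId (K ⊗[R] P) (Localization.AtPrime Q)).restrictScalars
      R |>.comp Algebra.TensorProduct.includeLeft) g₂ fun _ _ ↦ .all _ _
  have hg : g.comp g₁ = (Algebra.ofId (K ⊗[R] P) (Localization.AtPrime Q)).restrictScalars R := by
    ext x
    · simp [g, g₁]
    · change g (1 ⊗ₜ algebraMap P S x) = algebraMap (K ⊗[R] P) (Localization.AtPrime Q) (1 ⊗ₜ x)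
      rw [Algebra.TensorProduct.lift_tmul, map_one, one_mul]
      exact Localization.localRingHom_to_map q Q ι rfl x
  let a₁ : Algebra (K ⊗[R] P) (K ⊗[R] S) := g₁.toRingHom.toAlgebra
  let a₂ : Algebra (K ⊗[R] S) (Localization.AtPrime Q) := g.toRingHom.toAlgebra
  have : IsScalarTower (K ⊗[R] P) (K ⊗[R] S) (Localization.AtPrime Q) :=
    .of_algebraMap_eq fun x ↦ (AlgHom.congr_fun hg x).symm
  have : IsScalarTower K (K ⊗[R] P) (K ⊗[R] S) := .of_algebraMap_eq fun x ↦ by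
    change _ = g₁ (x ⊗ₜ 1)
    rw [Algebra.TensorProduct.map_tmul, map_one]
    rfl
  have hloc : IsLocalization (q.primeCompl.map (Algebra.TensorProduct.includeRight (R := R)
      (A := K))) (K ⊗[R] S) :=
    IsLocalization.tensorProduct_tensorProduct_right R K q.primeCompl S (by
      ext x
      change g₁ (1 ⊗ₜ x) = _
      simp [g₁])
  have hle : q.primeCompl.map (Algebra.TensorProduct.includeRight (R := R) (A := K)) ≤
      Q.primeCompl := by
    rintro _ ⟨x, hx, rfl⟩
    exact hx
  have := IsLocalization.isLocalization_of_submonoid_le (K ⊗[R] S) (Localization.AtPrime Q) _ _ hle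
  have hfl : Module.Flat (K ⊗[R] S) (Localization.AtPrime Q) := IsLocalization.flat _
    (Q.primeCompl.map (algebraMap (K ⊗[R] P) (K ⊗[R] S)))
  have h₃ := h₂.of_flat (S := Localization.AtPrime Q)
  rw [List.map_ofFn_fun] at h₃
  have e : (fun i ↦ algebraMap (K ⊗[R] P) (Localization.AtPrime Q) (1 ⊗ₜ f i)) =
      fun i ↦ algebraMap (K ⊗[R] S) (Localization.AtPrime Q) (1 ⊗ₜ algebraMap P S (f i)) :=
    funext fun i ↦ (AlgHom.congr_fun hg (1 ⊗ₜ f i)).symm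
  rw [e]
  exact h₃

end FiberRegular

/-! ### Independence of the rows of the Jacobian matrix -/

section Jacobian
open TensorProduct RingTheory.Sequence KaehlerDifferential

/-- The rows of the matrix `a` are linearly independent. -/
def Matrix.HasIndependentRows {A : Type*} [CommRing A] {r n : ℕ} (a : Fin r → Fin n → A) : Prop :=
  ∀ c : Fin r → A, (∀ j, ∑ i, c i * a i j = 0) → ∀ i, c i = 0

section

variable {R A : Type*} [CommRing R] [CommRing A] [Algebra R A] {r n : ℕ} (a : Fin r → Fin n → A)

variable (R) in
/-- The row vector `c` is sent to `c * a`. -/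
def Matrix.rowMap : (Fin r → A) →ₗ[R] (Fin n → A) :=
  LinearMap.pi fun j ↦ ∑ i, (LinearMap.mulRight R (a i j)) ∘ₗ LinearMap.proj i

lemma Matrix.rowMap_apply (c : Fin r → A) (j : Fin n) : rowMap R a c j = ∑ i, c i * a i j := by
  simp [rowMap]

lemma Matrix.piRight_lTensor_rowMap (E : Type*) [CommRing E] [Algebra R E]
    (z : E ⊗[R] (Fin r → A)) (j : Fin n) :
    TensorProduct.piRight R R E (fun _ ↦ A) ((rowMap R a).lTensor E z) j =
      ∑ i, TensorProduct.piRight R R E (fun _ ↦ A) z i * (1 ⊗ₜ a i j) := by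
  induction z with
  | zero => simp
  | add x y hx hy => simp only [map_add, Pi.add_apply, hx, hy, add_mul, Finset.sum_add_distrib]
  | tmul x y =>
    simp [rowMap_apply, TensorProduct.tmul_sum]

lemma Matrix.lTensor_rowMap_injective_iff (E : Type*) [CommRing E] [Algebra R E] :
    Function.Injective ((rowMap R a).lTensor E) ↔
      HasIndependentRows fun i j ↦ (1 : E) ⊗ₜ[R] a i j := by
  rw [injective_iff_map_eq_zero]
  refine ⟨fun h c hc ↦ ?_, fun h z hz ↦ ?_⟩
  · obtain ⟨z, rfl⟩ := (TensorProduct.piRight R R E (fun _ : Fin r ↦ A)).surjective c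
    have : z = 0 := h z <| (TensorProduct.piRight R R E (fun _ ↦ A)).injective <| by
      ext j
      rw [piRight_lTensor_rowMap, hc j, map_zero]
      rfl
    simp [this]
  · apply (TensorProduct.piRight R R E (fun _ ↦ A)).injective
    rw [map_zero]
    refine funext fun i ↦ h _ (fun j ↦ ?_) i
    rw [← piRight_lTensor_rowMap, hz, map_zero]
    rfl

end

/-- A matrix over a flat algebra with independent rows on all fibres has independent rows after
every finite base change. -/
lemma Matrix.HasIndependentRows.of_fiber {R : Type u} {A : Type*} [CommRing R] [IsNoetherianRing R]
    [CommRing A] [Algebra R A] [Module.Flat R A] {r n : ℕ} {a : Fin r → Fin n → A}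
    (h : ∀ (p : Ideal R) [p.IsPrime], HasIndependentRows fun i j ↦
      (1 : p.ResidueField) ⊗ₜ[R] a i j) (E : Type u) [CommRing E] [Algebra R E]
    [Module.Finite R E] : HasIndependentRows fun i j ↦ (1 : E) ⊗ₜ[R] a i j := by
  have hflat (m : ℕ) : Module.Flat R (Fin m → A) := Module.Flat.trans R A _
  rw [← lTensor_rowMap_injective_iff, LinearMap.lTensor_inj_iff_rTensor_inj]
  -- A prime filtration of the finite module `E` leaves the quotients `R / 𝔭`. These embed in the
  -- residue fields, and flatness of `A^r` preserves the embedding.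
  refine LinearMap.rTensor_injective_of_forall_prime _ _ fun p _ ↦ ?_
  have hp := h p.asIdeal
  rw [← lTensor_rowMap_injective_iff, LinearMap.lTensor_inj_iff_rTensor_inj] at hp
  let i : (R ⧸ p.asIdeal) →ₗ[R] p.asIdeal.ResidueField :=
    (IsScalarTower.toAlgHom R (R ⧸ p.asIdeal) p.asIdeal.ResidueField).toLinearMap
  have hi : Function.Injective i := Ideal.injective_algebraMap_quotient_residueField p.asIdeal
  have hN := Module.Flat.lTensor_preserves_injective_linearMap (M := Fin r → A) i hi
  have := hp.comp hN
  rw [← LinearMap.coe_comp, LinearMap.rTensor_comp_lTensor, ← LinearMap.lTensor_comp_rTensor,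
    LinearMap.coe_comp] at this
  exact this.of_comp

/-- The Jacobian matrix of a generically smooth complete intersection over a field has independent
rows. -/
lemma Algebra.IsStandardSmooth.hasIndependentRows_of_field {K T A : Type u} [Field K] [CommRing T]
    [CommRing A] [Algebra K T] [Algebra K A] [Algebra.IsStandardSmooth K T] (φ : T →ₐ[K] A)
    (hφ : Function.Surjective φ) {r : ℕ} {f : Fin r → T}
    (hker : RingHom.ker φ = Ideal.span (Set.range f))
    (hreg : ∀ (Q : Ideal T) [Q.IsPrime], Ideal.span (Set.range f) ≤ Q →
      IsWeaklyRegular (Localization.AtPrime Q)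
        (List.ofFn fun i ↦ algebraMap T (Localization.AtPrime Q) (f i)))
    (hsm : ∀ q ∈ minimalPrimes A, ∀ _ : q.IsPrime,
      Algebra.FormallySmooth K (Localization.AtPrime q))
    {n : ℕ} {t : Fin n → T} {a : Fin r → Fin n → T}
    (ha : ∀ i, D K T (f i) = ∑ j, a i j • D K T (t j)) :
    Matrix.HasIndependentRows fun i j ↦ φ (a i j) := by
  let : Algebra T A := φ.toRingHom.toAlgebra
  have htower : IsScalarTower K T A := .of_algebraMap_eq fun x ↦ (φ.commutes x).symm
  intro c hc i
  choose c' hc' using fun i ↦ hφ (c i)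
  rw [← hc' i]
  refine (RingHom.mem_ker (f := φ)).1 ?_
  rw [hker]
  refine Algebra.IsStandardSmooth.mem_of_sum_smul_D_mem (K := K) (A := A) hφ hker hreg hsm
    (c := c') ?_ i
  have : ∑ i, c' i • D K T (f i) = ∑ j, (∑ i, c' i * a i j) • D K T (t j) := by
    simp_rw [ha, Finset.smul_sum, Finset.sum_smul, mul_smul]
    exact Finset.sum_comm
  rw [this]
  refine Submodule.sum_mem _ fun j _ ↦ Submodule.smul_mem_smul ?_ trivial
  rw [← hker, RingHom.mem_ker, map_sum, ← hc j]
  refine Finset.sum_congr rfl fun i _ ↦ ?_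
  rw [map_mul, hc' i]

lemma KaehlerDifferential.D_one_tmul {R P K : Type*} [CommRing R] [CommRing P] [CommRing K]
    [Algebra R P] [Algebra R K] {n : ℕ} {x : P} {t a : Fin n → P}
    (h : D R P x = ∑ j, a j • D R P (t j)) :
    D K (K ⊗[R] P) (1 ⊗ₜ x) = ∑ j, ((1 : K) ⊗ₜ[R] a j) • D K (K ⊗[R] P) (1 ⊗ₜ t j) := by
  let : Algebra P (K ⊗[R] P) := Algebra.TensorProduct.rightAlgebra
  have := congrArg (KaehlerDifferential.map R K P (K ⊗[R] P)) h
  rw [map_sum, KaehlerDifferential.map_D] at this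
  refine this.trans (Finset.sum_congr rfl fun j _ ↦ ?_)
  rw [map_smul, KaehlerDifferential.map_D]
  exact (algebraMap_smul (K ⊗[R] P) (a j) _).symm

section

variable {R P A K : Type*} [CommRing R] [CommRing P] [CommRing A] [CommRing K] [Algebra R P]
  [Algebra R A] [Algebra R K] {g : P →ₐ[R] A} (hg : Function.Surjective g)

include hg

lemma Algebra.TensorProduct.map_id_surjective :
    Function.Surjective (Algebra.TensorProduct.map (AlgHom.id K K) g) := by
  intro x
  induction x with
  | zero => exact ⟨0, map_zero _⟩
  | add x y hx hy =>
    obtain ⟨x, rfl⟩ := hx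
    obtain ⟨y, rfl⟩ := hy
    exact ⟨x + y, map_add _ _ _⟩
  | tmul k y =>
    obtain ⟨y, rfl⟩ := hg y
    exact ⟨k ⊗ₜ y, rfl⟩

lemma Algebra.TensorProduct.ker_map_id_eq_span {r : ℕ} {f : Fin r → P}
    (hker : RingHom.ker g = Ideal.span (Set.range f)) :
    RingHom.ker (Algebra.TensorProduct.map (AlgHom.id K K) g) =
      Ideal.span (Set.range fun i ↦ (1 : K) ⊗ₜ[R] f i) := by
  refine (Algebra.TensorProduct.lTensor_ker (A := K) g hg).trans ?_
  rw [hker, Ideal.map_span, ← Set.range_comp]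
  rfl

end

/-- The Jacobian matrix of a flat complete intersection with generically smooth fibres has
independent rows. -/
theorem Algebra.IsStandardSmooth.hasIndependentRows {R P A : Type u} [CommRing R]
    [IsNoetherianRing R] [CommRing P] [CommRing A] [Algebra R P] [Algebra R A]
    [Algebra.IsStandardSmooth R P] [Module.Flat R A] (g : P →ₐ[R] A)
    (hg : Function.Surjective g) {r : ℕ} {f : Fin r → P}
    (hker : RingHom.ker g = Ideal.span (Set.range f))
    (hf : IsWeaklyRegular P (List.ofFn f))
    (hsm : ∀ (p : Ideal R) [p.IsPrime], ∀ q ∈ minimalPrimes (p.Fiber A), ∀ _ : q.IsPrime,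
      Algebra.FormallySmooth p.ResidueField (Localization.AtPrime q))
    {n : ℕ} {t : Fin n → P} {a : Fin r → Fin n → P}
    (ha : ∀ i, D R P (f i) = ∑ j, a i j • D R P (t j))
    (E : Type u) [CommRing E] [Algebra R E] [Module.Finite R E] :
    Matrix.HasIndependentRows fun i j ↦ (1 : E) ⊗ₜ[R] g (a i j) := by
  have hP : IsNoetherianRing P := Algebra.FiniteType.isNoetherianRing R P
  have hq : Module.Flat R (P ⧸ Ideal.span (Set.range f)) := by
    rw [← hker]
    exact Module.Flat.of_linearEquiv (Ideal.quotientKerAlgEquivOfSurjective hg).toLinearEquiv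
  refine Matrix.HasIndependentRows.of_fiber (fun p _ ↦ ?_) E
  have h1 := Algebra.TensorProduct.map_id_surjective (K := p.ResidueField) hg
  have h2 := Algebra.TensorProduct.ker_map_id_eq_span (K := p.ResidueField) hg hker
  have h3 (Q : Ideal (p.ResidueField ⊗[R] P)) [Q.IsPrime]
      (hQ : Ideal.span (Set.range fun i ↦ (1 : p.ResidueField) ⊗ₜ[R] f i) ≤ Q) :=
    hf.localization_tensorProduct Q fun i ↦ hQ (Ideal.subset_span ⟨i, rfl⟩)
  exact Algebra.IsStandardSmooth.hasIndependentRows_of_field _ h1 h2 h3 (hsm p)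
    fun i ↦ KaehlerDifferential.D_one_tmul (ha i)

end Jacobian

namespace AlgebraicGeometry.Scheme.Modules
noncomputable section

/-! ### Coordinates on free modules, and presentations given by matrices -/

section Free

variable {U : Scheme.{u}}

/-- The compatible family of sections defined by a global section. -/
def sectionsOfTop (M : U.Modules) (m : Γ(M, ⊤)) : SheafOfModules.sections M :=
  PresheafOfModules.sectionsMk (fun W ↦ (show Γ(M, W.unop) from M.res le_top m))
    (fun _ _ h ↦ M.res_res le_top (leOfHom h.unop) m)

lemma sections_ext {M : U.Modules} {s t : SheafOfModules.sections M}
    (h : (show Γ(M, ⊤) from s.eval (op ⊤)) = t.eval (op ⊤)) : s = t := by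
  refine PresheafOfModules.sections_ext s t fun W ↦ ?_
  have hs := PresheafOfModules.sections_property s (homOfLE (le_top (a := W.unop))).op
  have ht := PresheafOfModules.sections_property t (homOfLE (le_top (a := W.unop))).op
  exact hs.symm.trans ((congrArg _ h).trans ht)

/-- The tautological basis of a free module. -/
def freeBasis (U : Scheme.{u}) (I : Type u) (i : I) :
    Γ(show U.Modules from SheafOfModules.free I, ⊤) :=
  (SheafOfModules.freeSection (R := U.ringCatSheaf) i).eval (op ⊤)

lemma isFreeOn_freeBasis (I : Type u) :
    IsFreeOn (show U.Modules from SheafOfModules.free I) (freeBasis U I) := by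
  intro M m
  refine ⟨(SheafOfModules.freeHomEquiv M).symm fun i ↦ sectionsOfTop M (m i), fun i ↦ ?_,
    fun φ hφ ↦ ?_⟩
  · have h := congrFun ((SheafOfModules.freeHomEquiv M).apply_symm_apply
      fun i ↦ sectionsOfTop M (m i)) i
    exact (congrArg (fun s : SheafOfModules.sections M ↦ s.eval (op ⊤)) h).trans (M.res_self _ _)
  · refine ((SheafOfModules.freeHomEquiv M).eq_symm_apply).2 (funext fun i ↦ sections_ext ?_)
    exact (hφ i).trans (M.res_self _ _).symm

lemma isFreeOn_structureSheaf :
    IsFreeOn (structureSheaf U) (fun _ : Unit ↦ (show Γ(structureSheaf U, ⊤) from (1 : Γ(U, ⊤)))) := by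
  intro M m
  refine ⟨(SheafOfModules.unitHomEquiv M).symm (sectionsOfTop M (m ())), fun i ↦ ?_,
    fun φ hφ ↦ ?_⟩
  · have h := (SheafOfModules.unitHomEquiv M).apply_symm_apply (sectionsOfTop M (m ()))
    exact (congrArg (fun s : SheafOfModules.sections M ↦ s.eval (op ⊤)) h).trans (M.res_self _ _)
  · refine ((SheafOfModules.unitHomEquiv M).eq_symm_apply).2 (sections_ext ?_)
    exact (hφ ()).trans (M.res_self _ _).symm

lemma app_sum_smul {M N : U.Modules} (φ : M ⟶ N) {ι : Type*} [Fintype ι] {W : U.Opens}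
    (c : ι → Γ(U, W)) (s : ι → Γ(M, W)) : φ.app W (∑ t, c t • s t) = ∑ t, c t • φ.app W (s t) := by
  rw [map_sum]
  exact Finset.sum_congr rfl fun t _ ↦ φ.app_smul _ _

lemma res_sum_smul {M : U.Modules} {ι : Type*} [Fintype ι] {W W' : U.Opens} (h : W' ≤ W)
    (c : ι → Γ(U, W)) (s : ι → Γ(M, W)) :
    M.res h (∑ t, c t • s t) = ∑ t, resO h (c t) • M.res h (s t) := by
  rw [map_sum]
  exact Finset.sum_congr rfl fun t _ ↦ M.res_smul _ _ _

namespace IsFreeOn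

variable {E : U.Modules} {ι : Type*} [Fintype ι] {e : ι → Γ(E, ⊤)} (h : IsFreeOn E e)
include h

/-- The identity `𝟙 E = ∑ ε t ≫ β t`, where `β t` sends `1` to `e t`, holds because it holds on the
basis. Evaluated on sections over any open it gives the expansion in coordinates. -/
lemma exists_dual [DecidableEq ι] : ∃ ε : ι → (E ⟶ structureSheaf U),
    (∀ s t, (show Γ(U, ⊤) from (ε t).app ⊤ (e s)) = if s = t then 1 else 0) ∧
    ∀ (W : U.Opens) (z : Γ(E, W)),
      z = ∑ t, (show Γ(U, W) from (ε t).app W z) • E.res le_top (e t) := by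
  choose ε hε using fun t : ι ↦ h.exists_hom (M := structureSheaf U)
    (fun s ↦ (show Γ(structureSheaf U, ⊤) from ((if s = t then 1 else 0 : Γ(U, ⊤)))))
  choose β hβ using fun t : ι ↦ isFreeOn_structureSheaf.exists_hom (M := E) (fun _ ↦ e t)
  refine ⟨ε, fun s t ↦ hε t s, fun W z ↦ ?_⟩
  have hβ' (t : ι) (W : U.Opens) (c : Γ(U, W)) :
      (β t).app W (show Γ(structureSheaf U, W) from c) = c • E.res le_top (e t) := by
    have h₁ := (β t).app_smul c (show Γ(structureSheaf U, W) from (1 : Γ(U, W)))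
    have h₂ := (β t).app_res (le_top : W ≤ ⊤) (show Γ(structureSheaf U, ⊤) from (1 : Γ(U, ⊤)))
    have h₃ : (structureSheaf U).res (le_top : W ≤ ⊤) (show Γ(structureSheaf U, ⊤) from
      (1 : Γ(U, ⊤))) = (1 : Γ(U, W)) := map_one (resO (le_top : W ≤ ⊤))
    refine Eq.trans ?_ (h₁.trans (congrArg (c • ·) ((congrArg _ h₃.symm).trans
      (h₂.trans (congrArg _ (hβ t ()))))))
    exact congrArg ((β t).app W) (mul_one c).symm
  have key : 𝟙 E = ∑ t, ε t ≫ β t := by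
    refine h.hom_ext fun s ↦ ?_
    rw [app_sum, Finset.sum_eq_single s]
    · refine Eq.trans ?_ (congrArg ((β s).app ⊤) ((hε s s).trans (if_pos rfl))).symm
      exact (hβ s ()).symm
    · intro t _ hts
      exact (congrArg ((β t).app ⊤) ((hε t s).trans (if_neg hts.symm))).trans (map_zero _)
    · exact fun h ↦ (h (Finset.mem_univ s)).elim
  have h₁ := congrArg (fun φ ↦ φ.app W z) key
  refine h₁.trans ((app_sum _ _ _ _).trans (Finset.sum_congr rfl fun t _ ↦ ?_))
  exact hβ' t W _

lemma exists_eq_sum {W : U.Opens} (z : Γ(E, W)) :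
    ∃ c : ι → Γ(U, W), z = ∑ t, c t • E.res le_top (e t) := by
  classical
  obtain ⟨ε, -, hε⟩ := h.exists_dual
  exact ⟨_, hε W z⟩

lemma eq_zero_of_sum_eq_zero {W : U.Opens} (c : ι → Γ(U, W))
    (hc : ∑ t, c t • E.res (le_top : W ≤ ⊤) (e t) = 0) : c = 0 := by
  classical
  obtain ⟨ε, hε, -⟩ := h.exists_dual
  funext s
  have h₁ := (app_sum_smul (ε s) c fun t ↦ E.res le_top (e t)).symm.trans
    ((congrArg ((ε s).app W) hc).trans (map_zero _))
  refine Eq.trans ?_ h₁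
  have h₂ (t : ι) : (show Γ(U, W) from (ε s).app W (E.res le_top (e t))) =
      if t = s then 1 else 0 := by
    refine ((ε s).app_res le_top (e t)).trans ((congrArg (resO le_top) (hε t s)).trans ?_)
    split_ifs
    · exact map_one _
    · exact map_zero _
  refine Eq.trans ?_ (Finset.sum_congr rfl fun t _ ↦
    congrArg (fun z : Γ(U, W) ↦ c t * z) (h₂ t)).symm
  simp

end IsFreeOn

variable (U) in
/-- The free module of rank `n`. -/
def freeFin (n : ℕ) : U.Modules := SheafOfModules.free (ULift.{u} (Fin n))

variable (U) in
/-- The basis of the free module of rank `n`. -/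
def freeFinBasis (n : ℕ) (t : Fin n) : Γ(freeFin U n, ⊤) := freeBasis U (ULift.{u} (Fin n)) ⟨t⟩

lemma isFreeOn_freeFinBasis (n : ℕ) : IsFreeOn (freeFin U n) (freeFinBasis U n) := by
  intro M m
  obtain ⟨φ, hφ, hu⟩ := isFreeOn_freeBasis (U := U) (ULift.{u} (Fin n)) M fun t ↦ m t.down
  exact ⟨φ, fun t ↦ hφ ⟨t⟩, fun ψ hψ ↦ hu ψ fun t ↦ hψ t.down⟩

/-- A complex of free modules given by a matrix and a family of sections which is exact locally. -/
theorem IsFreeOn.exists_presentation {N : U.Modules} {r n : ℕ} {s : Fin n → Γ(N, ⊤)}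
    {E₁ E₀ : U.Modules} {e₁ : Fin r → Γ(E₁, ⊤)} {e₀ : Fin n → Γ(E₀, ⊤)} (he₁ : IsFreeOn E₁ e₁)
    (he₀ : IsFreeOn E₀ e₀) {A : Fin r → Fin n → Γ(U, ⊤)} (h0 : ∀ i, ∑ t, A i t • s t = 0)
    (hs : ∀ (W : U.Opens) (z : Γ(N, W)), ∀ x ∈ W, ∃ (W' : U.Opens) (h : W' ≤ W), x ∈ W' ∧
      ∃ c : Fin n → Γ(U, W'), N.res h z = ∑ t, c t • N.res le_top (s t))
    (hk : ∀ (W : U.Opens) (c : Fin n → Γ(U, W)), ∑ t, c t • N.res (le_top : W ≤ ⊤) (s t) = 0 →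
      ∀ x ∈ W, ∃ (W' : U.Opens) (h : W' ≤ W), x ∈ W' ∧
        ∃ d : Fin r → Γ(U, W'), ∀ t, resO h (c t) = ∑ i, d i * resO le_top (A i t)) :
    ∃ (a : E₁ ⟶ E₀) (b : E₀ ⟶ N) (w : a ≫ b = 0),
      (∀ i, a.app ⊤ (e₁ i) = ∑ t, A i t • e₀ t) ∧ (∀ t, b.app ⊤ (e₀ t) = s t) ∧
      (ShortComplex.mk a b w).Exact ∧ Epi b := by
  obtain ⟨a, ha⟩ := he₁.exists_hom (M := E₀) fun i ↦ ∑ t, A i t • e₀ t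
  obtain ⟨b, hb⟩ := he₀.exists_hom (M := N) s
  have hb' (W : U.Opens) (c : Fin n → Γ(U, W)) : b.app W (∑ t, c t • E₀.res le_top (e₀ t)) =
      ∑ t, c t • N.res le_top (s t) := by
    rw [app_sum_smul]
    exact Finset.sum_congr rfl fun t _ ↦ congrArg (c t • ·)
      ((b.app_res _ _).trans (congrArg _ (hb t)))
  have w : a ≫ b = 0 := he₁.hom_ext fun i ↦ by
    refine (congrArg (b.app ⊤) (ha i)).trans ((app_sum_smul _ _ _).trans ?_)
    exact (Finset.sum_congr rfl fun t _ ↦ congrArg (A i t • ·) (hb t)).trans (h0 i)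
  have hepi : Epi b := epi_of_locally_surjective _ fun W z x hx ↦ by
    obtain ⟨W', h, hx', c, hc⟩ := hs W z x hx
    exact ⟨W', h, _, hx', (hb' W' c).trans hc.symm⟩
  refine ⟨a, b, w, ha, hb, ?_, hepi⟩
  -- Exactness means that `E₁` maps onto the kernel of `b`, which may be tested locally: a section
  -- of the kernel has coordinates `c` with `∑ c t • s t = 0`, to which `hk` applies.
  rw [ShortComplex.exact_iff_epi_kernel_lift]
  refine epi_of_locally_surjective _ fun W z x hx ↦ ?_
  have hι : Mono (kernel.ι b) := inferInstance
  obtain ⟨c, hc⟩ := he₀.exists_eq_sum ((kernel.ι b).app W z)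
  have hc0 : b.app W ((kernel.ι b).app W z) = 0 :=
    congrArg (fun φ ↦ φ.app W z) (kernel.condition b)
  obtain ⟨W', h, hx', d, hd⟩ := hk W c ((hb' W c).symm.trans
    ((congrArg (b.app W) hc.symm).trans hc0)) x hx
  refine ⟨W', h, ∑ i, d i • E₁.res le_top (e₁ i), hx', app_injective_of_mono (kernel.ι b) W' ?_⟩
  have h₁ := congrArg (fun φ ↦ φ.app W' (∑ i, d i • E₁.res le_top (e₁ i))) (kernel.lift_ι b a w)
  refine h₁.trans (Eq.trans ?_ ((kernel.ι b).app_res h z).symm)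
  rw [hc, res_sum_smul, app_sum_smul]
  have h₂ (i : Fin r) : a.app W' (E₁.res le_top (e₁ i)) =
      ∑ t, resO le_top (A i t) • E₀.res le_top (e₀ t) :=
    (a.app_res _ _).trans ((congrArg _ (ha i)).trans (res_sum_smul _ _ _))
  refine (Finset.sum_congr rfl fun i _ ↦ (congrArg (d i • ·) (h₂ i)).trans Finset.smul_sum).trans ?_
  rw [Finset.sum_comm]
  refine Finset.sum_congr rfl fun t _ ↦ ?_
  rw [hd, Finset.sum_smul, res_res]
  exact Finset.sum_congr rfl fun i _ ↦ smul_smul _ _ _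

/-- A map of free modules given by a matrix with independent rows is a monomorphism. -/
lemma IsFreeOn.mono {r n : ℕ} {E₁ E₀ : U.Modules} {e₁ : Fin r → Γ(E₁, ⊤)} {e₀ : Fin n → Γ(E₀, ⊤)}
    (he₁ : IsFreeOn E₁ e₁) (he₀ : IsFreeOn E₀ e₀) {A : Fin r → Fin n → Γ(U, ⊤)} {a : E₁ ⟶ E₀}
    (ha : ∀ i, a.app ⊤ (e₁ i) = ∑ t, A i t • e₀ t)
    (hA : ∀ (W : U.Opens) (d : Fin r → Γ(U, W)),
      (∀ t, ∑ i, d i * resO (le_top : W ≤ ⊤) (A i t) = 0) → d = 0) : Mono a := by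
  refine mono_of_injective _ fun W ↦ (injective_iff_map_eq_zero (a.app W).hom).2 fun z hz ↦ ?_
  obtain ⟨d, rfl⟩ := he₁.exists_eq_sum z
  have h₂ (i : Fin r) : a.app W (E₁.res le_top (e₁ i)) =
      ∑ t, resO le_top (A i t) • E₀.res le_top (e₀ t) :=
    (a.app_res _ _).trans ((congrArg _ (ha i)).trans (res_sum_smul _ _ _))
  have h₃ : ∑ t, (∑ i, d i * resO (le_top : W ≤ ⊤) (A i t)) • E₀.res (le_top : W ≤ ⊤) (e₀ t) = 0 := by
    refine Eq.trans ?_ hz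
    refine Eq.trans ?_ ((app_sum_smul a d fun i ↦ E₁.res le_top (e₁ i)).trans (Finset.sum_congr rfl
      fun i _ ↦ (congrArg (d i • ·) (h₂ i)).trans Finset.smul_sum)).symm
    rw [Finset.sum_comm]
    refine Finset.sum_congr rfl fun t _ ↦ ?_
    rw [Finset.sum_smul]
    exact Finset.sum_congr rfl fun i _ ↦ (smul_smul _ _ _).symm
  have h₄ := hA W d fun t ↦ congrFun (he₀.eq_zero_of_sum_eq_zero _ h₃) t
  refine Finset.sum_eq_zero fun i _ ↦ ?_
  rw [h₄]
  exact zero_smul _ _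

end Free
end
end AlgebraicGeometry.Scheme.Modules

/-! ### Coherence of `𝓔xt¹` -/

namespace AlgebraicGeometry.Scheme.Modules
noncomputable section
variable {X U : Scheme.{u}}

lemma exists_isFinite_presentation {N : U.Modules} {r n : ℕ} {a : freeFin U r ⟶ freeFin U n}
    {b : freeFin U n ⟶ N} {w : a ≫ b = 0} (h : (ShortComplex.mk a b w).Exact) [Epi b] :
    ∃ P : SheafOfModules.Presentation N, P.IsFinite := by
  let P := SheafOfModules.presentationOfIsCokernelFree a b w (h.gIsCokernel)
  refine ⟨P, ⟨⟨?_⟩, ⟨?_⟩⟩⟩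
  · exact inferInstanceAs (Finite (ULift.{u} (Fin n)))
  · exact inferInstanceAs (Finite (ULift.{u} (Fin r)))

/-- Finite presentation is tested on slices of the site of opens, whereas presentations are
constructed on open subschemes; the equivalence `overEquiv` transports one to the other. -/
lemma exists_isFinite_presentation_over {T : X.Modules} {V : X.Opens} 
    (P : SheafOfModules.Presentation (T.restrict V.ι)) (hP : P.IsFinite) :
    ∃ P : SheafOfModules.Presentation (SheafOfModules.over T V), P.IsFinite := by
  let e := overEquiv V
  let η : SheafOfModules.unit (X.ringCatSheaf.over V) ≅ e.inverse.obj (structureSheaf V) :=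
    e.unitIso.app _ ≪≫ e.inverse.mapIso (Iso.refl _)
  let i : e.inverse.obj (T.restrict V.ι) ≅ SheafOfModules.over T V :=
    e.inverse.mapIso ((overFunctorEquiv V).app T).symm ≪≫ (e.unitIso.app _).symm
  let G : SheafOfModules (V : Scheme.{u}).ringCatSheaf ⥤ SheafOfModules (X.ringCatSheaf.over V) :=
    e.inverse
  have : PreservesColimitsOfSize.{u, u} G := e.symm.toAdjunction.leftAdjoint_preservesColimits
  have : (P.map G η).IsFinite := ⟨⟨hP.1.1⟩, ⟨hP.2.1⟩⟩
  exact ⟨(P.map G η).ofIsIso i.hom, inferInstance⟩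

theorem isCoherent_of_locally {T : X.Modules} 
    (h : ∀ x : X, ∃ V : X.Opens, x ∈ V ∧
      ∃ P : SheafOfModules.Presentation (T.restrict V.ι), P.IsFinite) :
    IsCoherent T := by
  choose V hx P hP using h
  choose Q hQ using fun x ↦ exists_isFinite_presentation_over (P x) (hP x)
  have hV : (Opens.grothendieckTopology X).CoversTop V := (_root_.Opens.coversTop_iff X V).2
    (IsOpenCover.mk (top_le_iff.1 fun x _ ↦ Opens.mem_iSup.2 ⟨x, hx x⟩))
  exact SheafOfModules.IsFinitePresentation.mk.{u, u, u} (R := X.ringCatSheaf) (M := T)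
    ⟨SheafOfModules.QuasicoherentData.mk.{u, u, u, u} (R := X.ringCatSheaf) (M := T) X V hV Q,
      SheafOfModules.QuasicoherentData.IsFinitePresentation.mk.{u, u, u, u} (R := X.ringCatSheaf)
        (M := T) hQ⟩

lemma IsCoherent.of_iso {M N : X.Modules} (e : M ≅ N) (h : IsCoherent N) : IsCoherent M :=
  (SheafOfModules.isFinitePresentation X.ringCatSheaf).prop_of_iso e.symm h

section Coord

variable {V W : X.Opens} {ι : Type*} {E : (V : Scheme.{u}).Modules} 

/-- The values of a linear form on a family of sections. -/
def coord (e : ι → Γ(E, ⊤)) (m : E ⟶ (structureSheaf X).restrict V.ι) (t : ι) : Γ(X, V) :=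
  resO (le_ι_image_top V) (m.app ⊤ (e t))

variable {e : ι → Γ(E, ⊤)}

lemma resO_coord (m : E ⟶ (structureSheaf X).restrict V.ι) (t : ι) :
    resO (ι_image_top_le V) (coord e m t) = m.app ⊤ (e t) :=
  (resO_resO _ _ _).trans (resO_self _ _)

lemma IsFreeOn.ext_coord (he : IsFreeOn E e) {m m' : E ⟶ (structureSheaf X).restrict V.ι}
    (h : ∀ t, coord e m t = coord e m' t) : m = m' :=
  he.hom_ext fun t ↦ (resO_coord m t).symm.trans ((congrArg _ (h t)).trans (resO_coord m' t))

lemma IsFreeOn.exists_coord_eq (he : IsFreeOn E e) (v : ι → Γ(X, V)) :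
    ∃ m : E ⟶ (structureSheaf X).restrict V.ι, ∀ t, coord e m t = v t := by
  obtain ⟨m, hm⟩ := he.exists_hom (M := (structureSheaf X).restrict V.ι)
    fun t ↦ resO (ι_image_top_le V) (v t)
  exact ⟨m, fun t ↦ (congrArg _ (hm t)).trans ((resO_resO _ _ _).trans (resO_self _ _))⟩

lemma coord_sum_smul {κ : Type*} (S : Finset κ) (c : κ → Γ(X, V))
    (m : κ → (E ⟶ (structureSheaf X).restrict V.ι)) (t : ι) :
    coord e (∑ i ∈ S, V.topIso.inv (c i) • m i) t = ∑ i ∈ S, c i * coord e (m i) t := by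
  refine (congrArg (resO (le_ι_image_top V)) (app_sum S _ ⊤ (e t))).trans ?_
  refine (map_sum (resO (le_ι_image_top V)) _ S).trans (Finset.sum_congr rfl fun i _ ↦ ?_)
  refine (congrArg (resO (le_ι_image_top V)) (smul_structureSheaf_restrict V (c i)
    ((m i).app ⊤ (e t)))).trans ?_
  refine (map_mul (resO (le_ι_image_top V)) _ _).trans (congrArg (· * coord e (m i) t) ?_)
  exact (resO_resO _ _ _).trans (resO_self _ _)

lemma coord_restrict (h : W ≤ V) (m : E ⟶ (structureSheaf X).restrict V.ι) (t : ι) :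
    coord (fun t ↦ (show Γ(E.restrict (X.homOfLE h), ⊤) from E.res le_top (e t)))
      ((restrictFunctor (X.homOfLE h)).map m ≫
        (restrictComp (X.homOfLE_ι h)).hom.app (structureSheaf X)) t = resO h (coord e m t) := by
  refine (congrArg (resO (le_ι_image_top W)) (restrict_map_comp_app_top (X.homOfLE_ι h) m
    ((ι_image_top_le W).trans (h.trans (le_ι_image_top V))) (e t))).trans ?_
  exact (resO_resO _ _ _).trans (resO_resO _ _ _).symm

end Coord

section SheafExt

variable {F : X.Modules} {V W : X.Opens} {r n : ℕ} (P : FreePres F V.ι r n)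

namespace FreePres

/-- The linear form on `E₁` with given values on the basis. -/
def form₁ (v : Fin r → Γ(X, V)) : P.E₁ ⟶ (structureSheaf X).restrict V.ι :=
  (P.free₁.exists_coord_eq v).choose

lemma coord_form₁ (v : Fin r → Γ(X, V)) (t : Fin r) : coord P.e₁ (P.form₁ v) t = v t :=
  (P.free₁.exists_coord_eq v).choose_spec t

/-- The linear form on `E₀` with given values on the basis. -/
def form₀ (v : Fin n → Γ(X, V)) : P.E₀ ⟶ (structureSheaf X).restrict V.ι :=
  (P.free₀.exists_coord_eq v).choose

lemma coord_form₀ (v : Fin n → Γ(X, V)) (t : Fin n) : coord P.e₀ (P.form₀ v) t = v t :=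
  (P.free₀.exists_coord_eq v).choose_spec t

/-- The matrix of the transpose of `E₁ ⟶ E₀`. -/
def transposeMatrix (j : Fin n) (t : Fin r) : Γ(X, V) :=
  coord P.e₁ (P.a ≫ P.form₀ (Pi.single j 1)) t

/-- The section of `𝓔xt¹(F, 𝒪)` attached to a linear form on `E₁`. -/
def formSection (v : Fin r → Γ(X, V)) : Γ(sheafExt 1 F (structureSheaf X), V) :=
  extSection V (P.ext (P.form₁ v))

lemma formSection_sum {κ : Type*} (S : Finset κ) (c : κ → Γ(X, V)) (v : κ → Fin r → Γ(X, V)) :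
    P.formSection (fun t ↦ ∑ i ∈ S, c i * v i t) = ∑ i ∈ S, c i • P.formSection (v i) := by
  have h : P.form₁ (fun t ↦ ∑ i ∈ S, c i * v i t) =
      ∑ i ∈ S, V.topIso.inv (c i) • P.form₁ (v i) := P.free₁.ext_coord fun t ↦ by
    rw [coord_form₁, coord_sum_smul]
    simp only [coord_form₁]
  rw [formSection, h, ext_sum, extSection_sum]
  refine Finset.sum_congr rfl fun i _ ↦ ?_
  refine (congrArg (extSection V) (P.ext_smul _ _)).trans ?_
  exact extSection_smul (c i) (P.ext (P.form₁ (v i)))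

lemma formSection_eq_sum (v : Fin r → Γ(X, V)) :
    P.formSection v = ∑ t, v t • P.formSection (Pi.single t 1) := by
  rw [← formSection_sum]
  congr 1
  funext t
  simp [Pi.single_apply]

/-- The restriction of a presentation to a smaller open. -/
abbrev res (h : W ≤ V) : FreePres F W.ι r n := P.restrict (X.homOfLE_ι h)

lemma extRes_form₁ (h : W ≤ V) (v : Fin r → Γ(X, V)) :
    extRes 1 F (structureSheaf X) h (P.ext (P.form₁ v)) =
      (P.res h).ext ((P.res h).form₁ fun t ↦ resO h (v t)) := by
  refine (P.extRestrict_ext (X.homOfLE_ι h) (P.form₁ v)).trans (congrArg _ ?_)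
  refine (P.res h).free₁.ext_coord fun t ↦ ?_
  rw [coord_form₁]
  exact (coord_restrict h (P.form₁ v) t).trans (congrArg _ (P.coord_form₁ v t))

lemma res_formSection (h : W ≤ V) (v : Fin r → Γ(X, V)) :
    (sheafExt 1 F (structureSheaf X)).res h (P.formSection v) =
      (P.res h).formSection fun t ↦ resO h (v t) := by
  rw [formSection, ← extSection_extRes, extRes_form₁]
  rfl

lemma res_formSection_single (h : W ≤ V) (t : Fin r) :
    (sheafExt 1 F (structureSheaf X)).res h (P.formSection (Pi.single t 1)) =
      (P.res h).formSection (Pi.single t 1) := by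
  rw [res_formSection]
  congr 1
  funext s
  simp only [Pi.single_apply]
  split_ifs
  · exact map_one _
  · exact map_zero _

lemma transposeMatrix_res (h : W ≤ V) (j : Fin n) (t : Fin r) :
    (P.res h).transposeMatrix j t = resO h (P.transposeMatrix j t) := by
  refine Eq.trans ?_ (coord_restrict h (P.a ≫ P.form₀ (Pi.single j 1)) t)
  have e : (P.res h).form₀ (Pi.single j 1) =
      (restrictFunctor (X.homOfLE h)).map (P.form₀ (Pi.single j 1)) ≫
        (restrictComp (X.homOfLE_ι h)).hom.app (structureSheaf X) := by
    refine (P.res h).free₀.ext_coord fun s ↦ ?_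
    rw [coord_form₀]
    refine Eq.trans ?_ (coord_restrict h (P.form₀ (Pi.single j 1)) s).symm
    rw [coord_form₀]
    simp only [Pi.single_apply]
    split_ifs
    · exact (map_one _).symm
    · exact (map_zero _).symm
  rw [transposeMatrix, e, Functor.map_comp, Category.assoc]
  rfl

lemma coord_a_form₀ (w : Fin n → Γ(X, V)) (t : Fin r) :
    coord P.e₁ (P.a ≫ P.form₀ w) t = ∑ j, w j * P.transposeMatrix j t := by
  have h : P.form₀ w = ∑ j, V.topIso.inv (w j) • P.form₀ (Pi.single j 1) :=
    P.free₀.ext_coord fun t ↦ by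
      rw [coord_form₀, coord_sum_smul]
      simp only [coord_form₀]
      simp [Pi.single_apply]
  have h' : P.a ≫ P.form₀ w =
      ∑ j, V.topIso.inv (w j) • (P.a ≫ P.form₀ (Pi.single j 1)) := by
    rw [h, Preadditive.comp_sum]
    exact Finset.sum_congr rfl fun j _ ↦ Linear.comp_smul _ _ _ _ _ _
  rw [h', coord_sum_smul]
  rfl

lemma formSection_transposeMatrix (j : Fin n) : P.formSection (P.transposeMatrix j) = 0 := by
  have h : P.form₁ (P.transposeMatrix j) = P.a ≫ P.form₀ (Pi.single j 1) :=
    P.free₁.ext_coord fun t ↦ P.coord_form₁ _ t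
  rw [formSection, h, (P.ext_eq_zero_iff _).2 ⟨_, rfl⟩, extSection_zero]

/-- Near `x` the section is given by a class pushed out of the presentation along a form on `E₁`;
the coordinates of that form are the coefficients. -/
lemma exists_res_eq_sum_formSection (h : W ≤ V) (z : Γ(sheafExt 1 F (structureSheaf X), W)) {x : X}
    (hx : x ∈ W) : ∃ (W' : X.Opens) (h' : W' ≤ W), x ∈ W' ∧ ∃ c : Fin r → Γ(X, W'),
      (sheafExt 1 F (structureSheaf X)).res h' z = ∑ t, c t •
        (sheafExt 1 F (structureSheaf X)).res (h'.trans h) (P.formSection (Pi.single t 1)) := by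
  obtain ⟨D, hD, y, hxD, hy⟩ := exists_extSection z hx
  obtain ⟨W₁, hxW₁, H⟩ := (P.res (hD.trans h)).exists_extRestrict_eq_ext y ⟨x, hxD⟩
  have hD' : D.ι ''ᵁ W₁ ≤ D := by
    rintro _ ⟨z, -, rfl⟩
    exact z.2
  obtain ⟨m, hm⟩ := H (X.homOfLE hD') (D.ι ''ᵁ W₁).ι (X.homOfLE_ι hD')
    (homOfLE_image_top_le hD' le_rfl)
  let P' := (P.res (hD.trans h)).res hD'
  refine ⟨D.ι ''ᵁ W₁, hD'.trans hD, ⟨⟨x, hxD⟩, hxW₁, rfl⟩, coord P'.e₁ m, ?_⟩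
  have e₁ : m = P'.form₁ (coord P'.e₁ m) := P'.free₁.ext_coord fun t ↦ (P'.coord_form₁ _ t).symm
  rw [← res_res _ hD hD', ← hy, ← extSection_extRes]
  refine (congrArg (extSection (D.ι ''ᵁ W₁)) (hm.trans (congrArg P'.ext e₁))).trans ?_
  refine (P'.formSection_eq_sum _).trans (Finset.sum_congr rfl fun t _ ↦ ?_)
  rw [← res_res _ (hD.trans h) hD', res_formSection_single, res_formSection_single]

/-- The combination is the section attached to the form with coordinates `c`. If it vanishes, the
class vanishes near `x`, so the form extends to `E₀`, and the coordinates of the extension are the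
coefficients `d`. -/
lemma exists_res_eq_sum_transposeMatrix (h : W ≤ V) (c : Fin r → Γ(X, W))
    (hc : ∑ t, c t •
      (sheafExt 1 F (structureSheaf X)).res h (P.formSection (Pi.single t 1)) = 0) {x : X}
    (hx : x ∈ W) : ∃ (W' : X.Opens) (h' : W' ≤ W), x ∈ W' ∧ ∃ d : Fin n → Γ(X, W'),
      ∀ t, resO h' (c t) = ∑ j, d j * resO (h'.trans h) (P.transposeMatrix j t) := by
  simp only [res_formSection_single] at hc
  rw [← formSection_eq_sum] at hc
  obtain ⟨W', h', hx', e⟩ := exists_extRes_eq_zero hc hx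
  rw [extRes_form₁] at e
  obtain ⟨m, hm⟩ := (ext_eq_zero_iff _ _).1 e
  let P' := (P.res h).res h'
  have e₁ : m = P'.form₀ (coord P'.e₀ m) := P'.free₀.ext_coord fun t ↦ (P'.coord_form₀ _ t).symm
  refine ⟨W', h', hx', coord P'.e₀ m, fun t ↦ ?_⟩
  have e₂ := (P'.coord_form₁ (fun t ↦ resO h' (c t)) t).symm.trans
    ((congrArg (fun φ ↦ coord P'.e₁ φ t) (hm.symm.trans (congrArg (P'.a ≫ ·) e₁))).trans
      (P'.coord_a_form₀ _ t))
  refine e₂.trans (Finset.sum_congr rfl fun j _ ↦ ?_)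
  rw [transposeMatrix_res, transposeMatrix_res, resO_resO]

end FreePres

lemma restrict_smul (T : X.Modules) {W : (V : Scheme.{u}).Opens} (c : Γ((V : Scheme.{u}), W))
    (z : Γ(T.restrict V.ι, W)) : c • z =
      (show Γ(T, V.ι ''ᵁ W) from (show Γ(X, V.ι ''ᵁ W) from c) • (show Γ(T, V.ι ''ᵁ W) from z)) := by
  have h : (V.ι.appIso W).inv c = (show Γ(X, V.ι ''ᵁ W) from c) := by
    rw [Scheme.Opens.ι_appIso]
    rfl
  exact congrArg (fun b : Γ(X, V.ι ''ᵁ W) ↦ b • (show Γ(T, V.ι ''ᵁ W) from z)) h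

end SheafExt
end
end AlgebraicGeometry.Scheme.Modules

namespace AlgebraicGeometry.Scheme.Modules
noncomputable section
variable {X U : Scheme.{u}} {V W : X.Opens} 

lemma restrict_sum_smul (T : X.Modules) {n : ℕ} {W : (V : Scheme.{u}).Opens}
    (h : V.ι ''ᵁ W ≤ V) (c : Fin n → Γ((V : Scheme.{u}), W)) (s : Fin n → Γ(T, V)) :
    (∑ t, c t • (T.restrict V.ι).res (le_top : W ≤ ⊤)
      (show Γ(T.restrict V.ι, ⊤) from T.res (ι_image_top_le V) (s t))) =
    (show Γ(T.restrict V.ι, W) from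
      (∑ t, (show Γ(X, V.ι ''ᵁ W) from c t) • T.res h (s t))) := by
  have e (t : Fin n) : c t • (T.restrict V.ι).res (le_top : W ≤ ⊤)
      (show Γ(T.restrict V.ι, ⊤) from T.res (ι_image_top_le V) (s t)) =
      (show Γ(T, V.ι ''ᵁ W) from (show Γ(X, V.ι ''ᵁ W) from c t) • T.res h (s t)) := by
    refine (restrict_smul T (c t) _).trans ?_
    exact congrArg (fun z : Γ(T, V.ι ''ᵁ W) ↦ (show Γ(X, V.ι ''ᵁ W) from c t) • z)
      (T.res_res (ι_image_top_le V) (Scheme.Hom.image_mono V.ι (le_top : W ≤ ⊤)) (s t))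
  exact Finset.sum_congr rfl fun t _ ↦ e t

lemma ι_image_ι_preimage_le {W' : X.Opens} : V.ι ''ᵁ (V.ι ⁻¹ᵁ W') ≤ W' := by
  rintro _ ⟨z, hz, rfl⟩
  exact hz

lemma ι_preimage_le {W' : X.Opens} {W : (V : Scheme.{u}).Opens} (h : W' ≤ V.ι ''ᵁ W) :
    V.ι ⁻¹ᵁ W' ≤ W := fun z hz ↦ by
  obtain ⟨y, hy, e⟩ := h hz
  obtain rfl : y = z := Subtype.ext e
  exact hy

/-- A presentation of `T|_V` by free modules which is given by a matrix and a family of sections. -/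
theorem exists_restrict_presentation {T : X.Modules} {r n : ℕ} {s : Fin n → Γ(T, V)}
    {A : Fin r → Fin n → Γ(X, V)} (h0 : ∀ i, ∑ t, A i t • s t = 0)
    (hs : ∀ (W : X.Opens) (h : W ≤ V) (z : Γ(T, W)), ∀ x ∈ W, ∃ (W' : X.Opens) (h' : W' ≤ W),
      x ∈ W' ∧ ∃ c : Fin n → Γ(X, W'), T.res h' z = ∑ t, c t • T.res (h'.trans h) (s t))
    (hk : ∀ (W : X.Opens) (h : W ≤ V) (c : Fin n → Γ(X, W)), ∑ t, c t • T.res h (s t) = 0 →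
      ∀ x ∈ W, ∃ (W' : X.Opens) (h' : W' ≤ W), x ∈ W' ∧
        ∃ d : Fin r → Γ(X, W'), ∀ t, resO h' (c t) = ∑ i, d i * resO (h'.trans h) (A i t)) :
    ∃ (a : freeFin (V : Scheme.{u}) r ⟶ freeFin V n) (b : freeFin V n ⟶ T.restrict V.ι)
      (w : a ≫ b = 0),
      (∀ i, a.app ⊤ (freeFinBasis V r i) = ∑ t,
        (show Γ((V : Scheme.{u}), ⊤) from resO (ι_image_top_le V) (A i t)) • freeFinBasis V n t) ∧
      (∀ t, b.app ⊤ (freeFinBasis V n t) = T.res (ι_image_top_le V) (s t)) ∧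
      (ShortComplex.mk a b w).Exact ∧ Epi b := by
  have hV (W : (V : Scheme.{u}).Opens) : V.ι ''ᵁ W ≤ V := by
    rintro _ ⟨z, -, rfl⟩
    exact z.2
  refine (isFreeOn_freeFinBasis r).exists_presentation (N := T.restrict V.ι)
    (isFreeOn_freeFinBasis n) (fun i ↦ ?_) (fun W z x hx ↦ ?_) (fun W c hc x hx ↦ ?_)
  · have e := (T.res_sum_smul (ι_image_top_le V) (A i) s).symm.trans
      ((congrArg _ (h0 i)).trans (map_zero _))
    refine Eq.trans ?_ e
    exact Finset.sum_congr rfl fun t _ ↦ restrict_smul T _ _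
  · obtain ⟨W', h', hx', c, hc⟩ := hs _ (hV W) z x.1 ⟨x, hx, rfl⟩
    refine ⟨V.ι ⁻¹ᵁ W', ι_preimage_le h', hx',
      fun t ↦ resO (ι_image_ι_preimage_le (V := V)) (c t), ?_⟩
    refine Eq.trans ?_ (restrict_sum_smul T (hV _) _ s).symm
    have e := (T.res_res h' (ι_image_ι_preimage_le (V := V)) z).symm.trans
      ((congrArg _ hc).trans (T.res_sum_smul _ _ _))
    refine e.trans (Finset.sum_congr rfl fun t _ ↦ ?_)
    rw [res_res]
  · obtain ⟨W', h', hx', d, hd⟩ := hk _ (hV W) (fun t ↦ (show Γ(X, V.ι ''ᵁ W) from c t))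
      ((restrict_sum_smul T (hV W) c s).symm.trans hc) x.1 ⟨x, hx, rfl⟩
    refine ⟨V.ι ⁻¹ᵁ W', ι_preimage_le h', hx',
      fun t ↦ resO (ι_image_ι_preimage_le (V := V)) (d t), fun t ↦ ?_⟩
    have e := (resO_resO h' (ι_image_ι_preimage_le (V := V)) _).symm.trans
      ((congrArg (resO (ι_image_ι_preimage_le (V := V))) (hd t)).trans (map_sum _ _ _))
    refine e.trans (Finset.sum_congr rfl fun i _ ↦ (map_mul _ _ _).trans ?_)
    refine congrArg (resO (ι_image_ι_preimage_le (V := V)) (d i) * ·) ?_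
    refine (resO_resO _ _ _).trans ?_
    exact (resO_resO (ι_image_top_le V) (Scheme.Hom.image_mono V.ι le_top) (A i t)).symm

/-- Dualising a free presentation of length one gives the local presentation `𝒪^n → 𝒪^r → 𝓔xt¹(F, 𝒪)
→ 0` by the transposed matrix. -/
theorem isCoherent_sheafExt {F : X.Modules}
    (h : ∀ x : X, ∃ V : X.Opens, x ∈ V ∧ ∃ r n : ℕ, Nonempty (FreePres F V.ι r n)) :
    IsCoherent (sheafExt 1 F (structureSheaf X)) := by
  refine isCoherent_of_locally fun x ↦ ?_
  obtain ⟨V, hx, r, n, ⟨P⟩⟩ := h x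
  refine ⟨V, hx, ?_⟩
  obtain ⟨a, b, w, -, -, hex, hb⟩ := exists_restrict_presentation
    (T := sheafExt 1 F (structureSheaf X)) (V := V) (A := P.transposeMatrix)
    (s := fun t ↦ P.formSection (Pi.single t 1))
    (fun j ↦ (P.formSection_eq_sum _).symm.trans (P.formSection_transposeMatrix j))
    (fun W h z x hx ↦ P.exists_res_eq_sum_formSection h z hx)
    (fun W h c hc x hx ↦ P.exists_res_eq_sum_transposeMatrix h c hc hx)
  exact exists_isFinite_presentation hex

end
end AlgebraicGeometry.Scheme.Modules

/-! ### Presentations of modules of differentials -/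

namespace KaehlerDifferential
open scoped TensorProduct

/-- `Ω[A⁄R]` is generated by the differentials of the family `t`, and the relations are generated
by the rows of the matrix `a`. -/
structure IsPresentedBy (R : Type*) {A : Type*} [CommRing R] [CommRing A] [Algebra R A]
    {r n : ℕ} (t : Fin n → A) (a : Fin r → Fin n → A) : Prop where
  relation (i : Fin r) : ∑ j, a i j • D R A (t j) = 0
  exists_eq_sum (z : Ω[A⁄R]) : ∃ c : Fin n → A, z = ∑ j, c j • D R A (t j)
  exists_of_sum_eq_zero (c : Fin n → A) (hc : ∑ j, c j • D R A (t j) = 0) :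
    ∃ d : Fin r → A, ∀ j, c j = ∑ i, d i * a i j

/-- In the conormal sequence `I/I² → A ⊗ Ω_P → Ω_A → 0` the middle term is free on the `d t j`, and
the generators `f i` of `I` map to the rows of `a`. -/
theorem isPresentedBy_of_basis {R P A : Type*} [CommRing R] [CommRing P] [CommRing A] [Algebra R P]
    [Algebra R A] (g : P →ₐ[R] A) (hg : Function.Surjective g) {r n : ℕ} {f : Fin r → P}
    (hker : RingHom.ker g = Ideal.span (Set.range f)) {t : Fin n → P}
    (b : Module.Basis (Fin n) P Ω[P⁄R]) (hb : ∀ j, b j = D R P (t j)) {a : Fin r → Fin n → P}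
    (ha : ∀ i, D R P (f i) = ∑ j, a i j • D R P (t j)) :
    IsPresentedBy R (fun j ↦ g (t j)) (fun i j ↦ g (a i j)) := by
  let := g.toRingHom.toAlgebra
  have : IsScalarTower R P A := .of_algebraMap_eq' g.comp_algebraMap.symm
  have hg' : Function.Surjective (algebraMap P A) := hg
  let b' : Module.Basis (Fin n) A (A ⊗[P] Ω[P⁄R]) := b.baseChange A
  have hb' (j) : b' j = 1 ⊗ₜ D R P (t j) := by rw [Module.Basis.baseChange_apply, hb]
  have hmap (c : Fin n → A) : mapBaseChange R P A (∑ j, c j • b' j) =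
      ∑ j, c j • D R A (g (t j)) := by
    rw [map_sum]
    refine Finset.sum_congr rfl fun j _ ↦ ?_
    rw [map_smul, hb', mapBaseChange_tmul, one_smul, map_D]
    rfl
  have hf (i : Fin r) : (1 : A) ⊗ₜ[P] D R P (f i) = ∑ j, g (a i j) • b' j := by
    rw [ha, TensorProduct.tmul_sum]
    refine Finset.sum_congr rfl fun j _ ↦ ?_
    rw [hb', TensorProduct.tmul_smul, ← algebraMap_smul A (a i j)]
    rfl
  have hf0 (i : Fin r) : g (f i) = 0 := by
    have : f i ∈ RingHom.ker g := hker ▸ Ideal.subset_span ⟨i, rfl⟩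
    exact this
  refine ⟨fun i ↦ ?_, fun z ↦ ?_, fun c hc ↦ ?_⟩
  · rw [← hmap, ← hf, mapBaseChange_tmul, one_smul, map_D]
    exact (congrArg _ (hf0 i)).trans (map_zero _)
  · obtain ⟨y, rfl⟩ : ∃ y, mapBaseChange R P A y = z := mapBaseChange_surjective R P A hg' z
    refine ⟨fun j ↦ b'.repr y j, ?_⟩
    rw [← hmap, b'.sum_repr]
  · rw [← hmap] at hc
    obtain ⟨x, hx⟩ := (exact_kerCotangentToTensor_mapBaseChange R P A hg' _).1 hc
    obtain ⟨⟨x, hx0⟩, rfl⟩ := Ideal.toCotangent_surjective _ x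
    have hx1 : x ∈ Ideal.span (Set.range f) := hker ▸ hx0
    obtain ⟨p, rfl⟩ := (Submodule.mem_span_range_iff_exists_fun P).1 hx1
    refine ⟨fun i ↦ g (p i), fun j ↦ ?_⟩
    rw [kerCotangentToTensor_toCotangent] at hx
    -- In the Leibniz rule the term `f i • d (p i)` dies, since `f i` is zero in `A`.
    have e (i : Fin r) : (1 : A) ⊗ₜ[P] D R P (p i • f i) = ∑ j, (g (p i) * g (a i j)) • b' j := by
      rw [smul_eq_mul, Derivation.leibniz, TensorProduct.tmul_add, TensorProduct.tmul_smul, hf,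
        TensorProduct.tmul_smul, TensorProduct.smul_tmul', Algebra.smul_def]
      have : algebraMap P A (f i) = 0 := hf0 i
      rw [this, zero_mul, TensorProduct.zero_tmul, add_zero, Finset.smul_sum]
      refine Finset.sum_congr rfl fun j _ ↦ ?_
      rw [mul_smul, ← algebraMap_smul A (p i)]
      rfl
    have e' : ∑ j, (∑ i, g (p i) * g (a i j)) • b' j = ∑ j, c j • b' j := by
      rw [← hx]
      simp only [map_sum, TensorProduct.tmul_sum, e, Finset.sum_smul]
      exact Finset.sum_comm
    have := congrArg (fun z ↦ b'.repr z j) e'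
    simp only [Module.Basis.repr_sum_self] at this
    exact this.symm

/-- Differentials commute with base change, `A' ⊗ Ω[A⁄R] ≃ Ω[A'⁄R']`, and the tensor product is
right exact. -/
theorem IsPresentedBy.of_isPushout {R R' A A' : Type*} [CommRing R] [CommRing R'] [CommRing A]
    [CommRing A'] [Algebra R A] [Algebra R R'] [Algebra R A'] [Algebra A A'] [Algebra R' A']
    [IsScalarTower R A A'] [IsScalarTower R R' A'] [Algebra.IsPushout R R' A A'] {r n : ℕ}
    {t : Fin n → A} {a : Fin r → Fin n → A} (h : IsPresentedBy R t a) :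
    IsPresentedBy R' (fun j ↦ algebraMap A A' (t j)) (fun i j ↦ algebraMap A A' (a i j)) := by
  let e := tensorKaehlerEquiv R R' A A'
  have he (c : A') (y : A) : e (c ⊗ₜ D R A y) = c • D R' A' (algebraMap A A' y) :=
    tensorKaehlerEquiv_tmul_D R R' A A' c y
  let α : (Fin r → A) →ₗ[A] (Fin n → A) := Fintype.linearCombination A a
  let β : (Fin n → A) →ₗ[A] Ω[A⁄R] := Fintype.linearCombination A (fun j ↦ D R A (t j))
  have hαβ : Function.Exact α β := by
    intro c
    constructor
    · intro hc
      obtain ⟨d, hd⟩ := h.exists_of_sum_eq_zero c hc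
      refine ⟨d, funext fun j ↦ ?_⟩
      rw [hd, Fintype.linearCombination_apply, Finset.sum_apply]
      rfl
    · rintro ⟨d, rfl⟩
      rw [show α d = ∑ i, d i • a i from Fintype.linearCombination_apply _ _ _, map_sum]
      refine Finset.sum_eq_zero fun i _ ↦ ?_
      rw [map_smul]
      exact (congrArg (d i • ·) (h.relation i)).trans (smul_zero _)
  have hβ : Function.Surjective β := fun z ↦ by
    obtain ⟨c, hc⟩ := h.exists_eq_sum z
    exact ⟨c, hc.symm⟩
  refine ⟨fun i ↦ ?_, fun z ↦ ?_, fun c hc ↦ ?_⟩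
  · have := congrArg (fun z ↦ e (1 ⊗ₜ z)) (h.relation i)
    simp only [TensorProduct.tmul_sum, TensorProduct.tmul_smul, map_sum, TensorProduct.tmul_zero,
      map_zero] at this
    rw [← this]
    refine Finset.sum_congr rfl fun j _ ↦ ?_
    rw [TensorProduct.smul_tmul', he, Algebra.smul_def, mul_one]
  · obtain ⟨z, rfl⟩ := e.surjective z
    induction z with
    | zero => exact ⟨0, by simp⟩
    | add x y hx hy =>
      obtain ⟨c, hc⟩ := hx
      obtain ⟨c', hc'⟩ := hy
      refine ⟨c + c', ?_⟩
      rw [map_add, hc, hc', ← Finset.sum_add_distrib]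
      exact Finset.sum_congr rfl fun j _ ↦ (add_smul _ _ _).symm
    | tmul x y =>
      obtain ⟨c, rfl⟩ := h.exists_eq_sum y
      refine ⟨fun j ↦ x * algebraMap A A' (c j), ?_⟩
      rw [TensorProduct.tmul_sum, map_sum]
      refine Finset.sum_congr rfl fun j _ ↦ ?_
      rw [TensorProduct.tmul_smul, TensorProduct.smul_tmul', he, Algebra.smul_def, mul_comm]
  · have hex := lTensor_exact A' hαβ hβ
    let w : A' ⊗[A] (Fin n → A) := ∑ j, c j ⊗ₜ Pi.single j 1
    have hw : β.lTensor A' w = 0 := by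
      apply e.injective
      rw [map_zero, ← hc, map_sum, map_sum]
      refine Finset.sum_congr rfl fun j _ ↦ ?_
      rw [LinearMap.lTensor_tmul, Fintype.linearCombination_apply_single, one_smul, he]
    obtain ⟨v, hv⟩ := (hex w).1 hw
    have key (z : A' ⊗[A] (Fin r → A)) (j : Fin n) :
        TensorProduct.piScalarRight A A A' (Fin n) (α.lTensor A' z) j =
          ∑ i, TensorProduct.piScalarRight A A A' (Fin r) z i * algebraMap A A' (a i j) := by
      induction z with
      | zero => simp
      | add x y hx hy => simp only [map_add, Pi.add_apply, hx, hy, add_mul, Finset.sum_add_distrib]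
      | tmul x y =>
        rw [LinearMap.lTensor_tmul, TensorProduct.piScalarRight_apply,
          TensorProduct.piScalarRightHom_tmul, TensorProduct.piScalarRight_apply,
          TensorProduct.piScalarRightHom_tmul,
          show α y = ∑ i, y i • a i from Fintype.linearCombination_apply _ _ _]
        beta_reduce
        rw [Finset.sum_apply, Finset.sum_smul]
        refine Finset.sum_congr rfl fun i _ ↦ ?_
        rw [Pi.smul_apply, smul_eq_mul, mul_smul, Algebra.smul_def (a i j), mul_comm,
          smul_mul_assoc]
    refine ⟨fun i ↦ TensorProduct.piScalarRight A A A' (Fin r) v i, fun j ↦ ?_⟩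
    rw [← key, hv]
    simp [w, TensorProduct.piScalarRight_apply, TensorProduct.piScalarRightHom_tmul, Pi.single_apply]

/-- Over a localization, the relations between the differentials of `t` are generated by the same
matrix. -/
theorem IsPresentedBy.exists_of_isLocalization {R A S : Type*} [CommRing R] [CommRing A]
    [CommRing S] [Algebra R A] [Algebra R S] [Algebra A S] [IsScalarTower R A S] (M : Submonoid A)
    [IsLocalization M S] {r n : ℕ} {t : Fin n → A} {a : Fin r → Fin n → A}
    (h : IsPresentedBy R t a) (c : Fin n → S) (hc : ∑ j, c j • D R S (algebraMap A S (t j)) = 0) :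
    ∃ d : Fin r → S, ∀ j, c j = ∑ i, d i * algebraMap A S (a i j) := by
  obtain ⟨s, hs⟩ := IsLocalization.exist_integer_multiples_of_finite M c
  choose c' hc' using hs
  have h₁ : map R R A S (∑ j, c' j • D R A (t j)) = 0 := by
    have := congrArg (fun z ↦ algebraMap A S s • z) hc
    simp only [smul_zero, Finset.smul_sum] at this
    rw [map_sum, ← this]
    refine Finset.sum_congr rfl fun j _ ↦ ?_
    rw [map_smul, map_D, ← algebraMap_smul S (c' j), hc', ← mul_smul, Algebra.smul_def]
  obtain ⟨s', hs'⟩ := (IsLocalizedModule.eq_zero_iff M (map R R A S)).1 h₁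
  have h₂ : ∑ j, ((s' : A) * c' j) • D R A (t j) = 0 := by
    rw [← hs', Submonoid.smul_def, Finset.smul_sum]
    exact Finset.sum_congr rfl fun j _ ↦ mul_smul _ _ _
  obtain ⟨d, hd⟩ := h.exists_of_sum_eq_zero _ h₂
  refine ⟨fun i ↦ IsLocalization.mk' S (d i) (s' * s), fun j ↦ ?_⟩
  have hu := IsLocalization.map_units S (s' * s)
  refine hu.mul_left_cancel ?_
  rw [Finset.mul_sum]
  have e : ∀ i, algebraMap A S ↑(s' * s) * (IsLocalization.mk' S (d i) (s' * s) *
      algebraMap A S (a i j)) = algebraMap A S (d i * a i j) := fun i ↦ by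
    rw [← mul_assoc, IsLocalization.mk'_spec', map_mul]
  simp only [e]
  rw [← map_sum, ← hd, Submonoid.coe_mul, map_mul, map_mul, hc', Algebra.smul_def, mul_assoc]

end KaehlerDifferential

/-- Independent rows remain independent over a localization. -/
lemma Matrix.HasIndependentRows.of_isLocalization {A S : Type*} [CommRing A] [CommRing S]
    [Algebra A S] (M : Submonoid A) [IsLocalization M S] {r n : ℕ} {a : Fin r → Fin n → A}
    (h : HasIndependentRows a) : HasIndependentRows fun i j ↦ algebraMap A S (a i j) := by
  intro c hc
  obtain ⟨s, hs⟩ := IsLocalization.exist_integer_multiples_of_finite M c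
  choose c' hc' using hs
  have h₁ (j) : algebraMap A S (∑ i, c' i * a i j) = 0 := by
    have := congrArg (fun z ↦ algebraMap A S s * z) (hc j)
    simp only [mul_zero, Finset.mul_sum] at this
    rw [map_sum, ← this]
    refine Finset.sum_congr rfl fun i _ ↦ ?_
    rw [map_mul, hc', Algebra.smul_def, mul_assoc]
  have h₂ (j) : ∃ m : M, m * ∑ i, c' i * a i j = 0 := (IsLocalization.map_eq_zero_iff M S _).1 (h₁ j)
  choose m hm using h₂
  have h₃ := h (fun i ↦ (∏ j, (m j : A)) * c' i) fun j ↦ by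
    simp only [mul_assoc]
    rw [← Finset.mul_sum, ← Finset.mul_prod_erase _ _ (Finset.mem_univ j), mul_comm (m j : A),
      mul_assoc, hm, mul_zero]
  intro i
  have h₄ : algebraMap A S ((∏ j, (m j : A)) * (c' i)) = 0 := by rw [h₃, map_zero]
  have hu : IsUnit (algebraMap A S (∏ j, (m j : A))) := by
    have := IsLocalization.map_units S (∏ j, m j)
    rwa [Submonoid.coe_finsetProd] at this
  have hu' := IsLocalization.map_units S s
  rw [map_mul, hc', Algebra.smul_def, hu.mul_right_eq_zero, hu'.mul_right_eq_zero] at h₄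
  exact h₄

lemma Matrix.HasIndependentRows.of_injective {A S : Type*} [CommRing A] [CommRing S]
    (φ : A →+* S) (hφ : Function.Injective φ) {r n : ℕ} {a : Fin r → Fin n → A}
    (h : HasIndependentRows fun i j ↦ φ (a i j)) : HasIndependentRows a := by
  intro c hc i
  apply hφ
  rw [map_zero]
  refine h (fun i ↦ φ (c i)) (fun j ↦ ?_) i
  have := congrArg φ (hc j)
  simpa using this

/-- A standard smooth algebra has a basis of differentials of functions. -/
theorem Algebra.IsStandardSmooth.exists_basis_kaehlerDifferential (R P : Type u) [CommRing R]
    [CommRing P] [Algebra R P] [Algebra.IsStandardSmooth R P] :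
    ∃ (n : ℕ) (t : Fin n → P) (b : Module.Basis (Fin n) P Ω[P⁄R]),
      ∀ j, b j = KaehlerDifferential.D R P (t j) := by
  obtain ⟨n, g, hgC, hg⟩ := RingHom.IsStandardSmooth.exists_etale_mvPolynomial
    (f := algebraMap R P) (RingHom.isStandardSmooth_algebraMap.2 inferInstance)
  algebraize [g]
  have : IsScalarTower R (MvPolynomial (Fin n) R) P := .of_algebraMap_eq' hgC.symm
  refine ⟨n, fun j ↦ g (.X j), ((KaehlerDifferential.mvPolynomialBasis R (Fin n)).baseChange P).map
    (KaehlerDifferential.tensorKaehlerEquivOfFormallyEtale R _ P), fun j ↦ ?_⟩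
  rw [Module.Basis.map_apply, Module.Basis.baseChange_apply,
    KaehlerDifferential.mvPolynomialBasis_apply,
    KaehlerDifferential.tensorKaehlerEquivOfFormallyEtale_apply,
    KaehlerDifferential.mapBaseChange_tmul, one_smul, KaehlerDifferential.map_D]
  rfl

/-! ### The sheaf of differentials over affine opens -/

namespace AlgebraicGeometry.Scheme.Modules
noncomputable section
variable {Y B : Scheme.{u}} (π : Y ⟶ B)

/-- The functions on `U` which are pulled back from an open of the base. -/
def baseSubring (U : Y.Opens) : Subring Γ(Y, U) where
  carrier := {x | ∃ (W : B.Opens) (h : U ≤ π ⁻¹ᵁ W) (b : Γ(B, W)), x = π.appLE W U h b}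
  mul_mem' := by
    rintro _ _ ⟨W, h, b, rfl⟩ ⟨W', h', b', rfl⟩
    refine ⟨W ⊓ W', le_inf h h', resO inf_le_left b * resO inf_le_right b', ?_⟩
    rw [map_mul]
    exact congrArg₂ (· * ·) (congrArg (fun φ ↦ φ.hom b) (π.map_appLE (le_inf h h')
      (homOfLE (inf_le_left : W ⊓ W' ≤ W)).op)).symm (congrArg (fun φ ↦ φ.hom b') (π.map_appLE
      (le_inf h h') (homOfLE (inf_le_right : W ⊓ W' ≤ W')).op)).symm
  add_mem' := by
    rintro _ _ ⟨W, h, b, rfl⟩ ⟨W', h', b', rfl⟩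
    refine ⟨W ⊓ W', le_inf h h', resO inf_le_left b + resO inf_le_right b', ?_⟩
    rw [map_add]
    exact congrArg₂ (· + ·) (congrArg (fun φ ↦ φ.hom b) (π.map_appLE (le_inf h h')
      (homOfLE (inf_le_left : W ⊓ W' ≤ W)).op)).symm (congrArg (fun φ ↦ φ.hom b') (π.map_appLE
      (le_inf h h') (homOfLE (inf_le_right : W ⊓ W' ≤ W')).op)).symm
  one_mem' := ⟨⊤, le_top, 1, (map_one _).symm⟩
  zero_mem' := ⟨⊤, le_top, 0, (map_zero _).symm⟩
  neg_mem' := by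
    rintro _ ⟨W, h, b, rfl⟩
    exact ⟨W, h, -b, (map_neg _ _).symm⟩

lemma map_mem_baseSubring {U U' : Y.Opens} (h : U' ≤ U) {x : Γ(Y, U)} (hx : x ∈ baseSubring π U) :
    resO h x ∈ baseSubring π U' := by
  obtain ⟨W, h', b, rfl⟩ := hx
  exact ⟨W, h.trans h', b, congrArg (fun φ ↦ φ.hom b) (π.appLE_map h' (homOfLE h).op)⟩

/-- The presheaf of functions which are pulled back from an open of the base. -/
def basePresheaf : TopCat.Presheaf CommRingCat.{u} Y where
  obj U := CommRingCat.of (baseSubring π U.unop)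
  map {U U'} h := CommRingCat.ofHom (((resO (leOfHom h.unop)).comp (baseSubring π U.unop).subtype).codRestrict
    (baseSubring π U'.unop) fun x ↦ map_mem_baseSubring π (leOfHom h.unop) x.2)
  map_id _ := CommRingCat.hom_ext (RingHom.ext fun x ↦ Subtype.ext (resO_self le_rfl x.1))
  map_comp h h' := CommRingCat.hom_ext (RingHom.ext fun x ↦
    Subtype.ext (resO_resO (leOfHom h.unop) (leOfHom h'.unop) x.1).symm)

/-- The functions pulled back from opens of the base form a subpresheaf of `𝒪_Y` through whose
direct image `𝒪_B ⟶ π_* 𝒪_Y` factors. By adjunction the map from the inverse image lands in it. -/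
lemma exists_eq_of_inverseImageHom (U : Y.Opens) (s : (inverseImage π).obj (op U)) :
    ∃ (W : B.Opens) (h : U ≤ π ⁻¹ᵁ W) (b : Γ(B, W)),
      (inverseImageHom π).app (op U) s = π.appLE W U h b := by
  let ι : basePresheaf π ⟶ Y.presheaf :=
    { app U := CommRingCat.ofHom (baseSubring π U.unop).subtype
      naturality U U' h := rfl }
  let k : B.presheaf ⟶ (TopCat.Presheaf.pushforward CommRingCat.{u} π.base).obj (basePresheaf π) :=
    { app W := CommRingCat.ofHom ((π.app W.unop).hom.codRestrict (baseSubring π (π ⁻¹ᵁ W.unop))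
        fun b ↦ ⟨W.unop, le_rfl, b, by rw [Scheme.Hom.appLE_eq_app]⟩)
      naturality W W' h := by
        ext x
        exact Subtype.ext (congrArg (fun φ ↦ φ.hom x) (π.naturality h)) }
  have hk : k ≫ (TopCat.Presheaf.pushforward CommRingCat.{u} π.base).map ι = π.c := rfl
  let adj := TopCat.Presheaf.pullbackPushforwardAdjunction CommRingCat.{u} π.base
  have e : inverseImageHom π = (adj.homEquiv _ _).symm k ≫ ι := by
    rw [← adj.homEquiv_naturality_right_symm, hk]
    rfl
  rw [e]
  exact (((adj.homEquiv _ _).symm k).app (op U) s).2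

lemma dSection_appLE {U : Y.Opens} {W : B.Opens} (h : U ≤ π ⁻¹ᵁ W) (b : Γ(B, W)) :
    dSection π U (π.appLE W U h b) = 0 := by
  let adj := TopCat.Presheaf.pullbackPushforwardAdjunction CommRingCat.{u} π.base
  have e : π.c = adj.unit.app B.presheaf ≫
      (TopCat.Presheaf.pushforward CommRingCat.{u} π.base).map (inverseImageHom π) :=
    ((adj.homEquiv _ _).apply_symm_apply π.c).symm.trans (adj.homEquiv_unit _ _ _)
  have e₁ : π.app W b = (inverseImageHom π).app (op (π ⁻¹ᵁ W))
      ((adj.unit.app B.presheaf).app (op W) b) :=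
    congrArg (fun φ ↦ (φ.app (op W)).hom b) e
  have e₂ : dSection π (π ⁻¹ᵁ W) (π.app W b) = 0 :=
    (congrArg _ e₁).trans (dSection_inverseImageHom π _ _)
  exact (dSection_map π (homOfLE h) (π.app W b)).trans ((congrArg _ e₂).trans (map_zero _))

/-- The algebra structure of the local ring at `x` over the functions on an open of the base. -/
abbrev stalkAlgebra {W : B.Opens} {x : Y} (hx : π x ∈ W) : Algebra Γ(B, W) (Y.presheaf.stalk x) :=
  ((π.stalkMap x).hom.comp (B.presheaf.germ W (π x) hx).hom).toAlgebra

/-- The germ comes from the local ring of `B` at `π x`, which is a localization of `Γ(B, W)` since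
`W` is affine. A localization is formally unramified, so the differential vanishes even though `b`
need not be defined on `W`. -/
lemma D_germ_appLE {W : B.Opens} (hW : IsAffineOpen W) {x : Y} (hx : π x ∈ W) {U : Y.Opens}
    (hxU : x ∈ U) {W' : B.Opens} (h : U ≤ π ⁻¹ᵁ W') (b : Γ(B, W')) :
    letI := stalkAlgebra π hx
    KaehlerDifferential.D Γ(B, W) (Y.presheaf.stalk x)
      (Y.presheaf.germ U x hxU (π.appLE W' U h b)) = 0 := by
  let := stalkAlgebra π hx
  let : Algebra Γ(B, W) (B.presheaf.stalk (π x)) := B.presheaf.algebra_section_stalk ⟨π x, hx⟩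
  let : Algebra (B.presheaf.stalk (π x)) (Y.presheaf.stalk x) := (π.stalkMap x).hom.toAlgebra
  have : IsScalarTower Γ(B, W) (B.presheaf.stalk (π x)) (Y.presheaf.stalk x) :=
    .of_algebraMap_eq' rfl
  have := hW.isLocalization_stalk ⟨π x, hx⟩
  have : Algebra.FormallyUnramified Γ(B, W) (B.presheaf.stalk (π x)) :=
    .of_isLocalization (hW.primeIdealOf ⟨π x, hx⟩).asIdeal.primeCompl
  have e : Y.presheaf.germ U x hxU (π.appLE W' U h b) =
      algebraMap (B.presheaf.stalk (π x)) (Y.presheaf.stalk x) (B.presheaf.germ W' (π x) (h hxU) b) := by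
    have e₁ := congrArg (fun φ ↦ φ.hom b) (π.germ_stalkMap W' x (h hxU))
    have e₂ := TopCat.Presheaf.germ_res_apply Y.presheaf (homOfLE h) x hxU (π.app W' b)
    exact e₂.trans e₁.symm
  rw [e]
  have := congrArg (KaehlerDifferential.map Γ(B, W) Γ(B, W) (B.presheaf.stalk (π x))
    (Y.presheaf.stalk x)) (Subsingleton.elim (KaehlerDifferential.D Γ(B, W) _
      (B.presheaf.germ W' (π x) (h hxU) b)) 0)
  rw [KaehlerDifferential.map_D, map_zero] at this
  exact this

/-- A relation between differentials of functions on an open holds in the differentials of the local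
rings. -/
lemma sum_germ_smul_D_eq_zero {W : B.Opens} (hW : IsAffineOpen W) {x : Y} (hx : π x ∈ W)
    {U : Y.Opens} (hxU : x ∈ U) {ι : Type*} [Fintype ι] (c b : ι → Γ(Y, U))
    (h : ∑ k, c k • dSection π U (b k) = 0) :
    letI := stalkAlgebra π hx
    ∑ k, Y.presheaf.germ U x hxU (c k) • KaehlerDifferential.D Γ(B, W) (Y.presheaf.stalk x)
      (Y.presheaf.germ U x hxU (b k)) = 0 := by
  let := stalkAlgebra π hx
  let s : CommRingCat.KaehlerDifferential ((inverseImageHom π).app (op U)) :=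
    ∑ k, c k • CommRingCat.KaehlerDifferential.d (b k)
  -- The relation holds in the associated sheaf, hence in the presheaf itself on a smaller
  -- neighbourhood of `x`.
  have hs : toSheafOf (kaehlerPresheaf π) U s = toSheafOf (kaehlerPresheaf π) U 0 := by
    refine Eq.trans ?_ (h.trans (map_zero (toSheafOf (kaehlerPresheaf π) U)).symm)
    refine (map_sum (toSheafOf (kaehlerPresheaf π) U) _ _).trans (Finset.sum_congr rfl fun k _ ↦ ?_)
    exact (toSheafOf (kaehlerPresheaf π) U).map_smul (c k) _
  obtain ⟨U', hU', hx', e⟩ := exists_map_eq_of_toSheafOf_eq (kaehlerPresheaf π) hs hxU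
  let M : ModuleCat.{u} Γ(Y, U') := (ModuleCat.restrictScalars (Y.presheaf.germ U' x hx').hom).obj
    (ModuleCat.of _ Ω[Y.presheaf.stalk x⁄Γ(B, W)])
  -- The differential of the germ at `x` is a derivation relative to the inverse image, and the map
  -- it induces on differentials carries the relation to the local ring.
  let δ : M.Derivation ((inverseImageHom π).app (op U')) := ModuleCat.Derivation.mk
    (fun b ↦ KaehlerDifferential.D Γ(B, W) (Y.presheaf.stalk x) (Y.presheaf.germ U' x hx' b))
    (fun b b' ↦ by rw [map_add, map_add]; rfl)
    (fun b b' ↦ by rw [map_mul, Derivation.leibniz]; rfl)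
    (fun s ↦ by
      obtain ⟨W', h, b, e⟩ := exists_eq_of_inverseImageHom π U' s
      exact (congrArg (fun z ↦ KaehlerDifferential.D Γ(B, W) (Y.presheaf.stalk x)
        (Y.presheaf.germ U' x hx' z)) e).trans (D_germ_appLE π hW hx hx' h b))
  have e₁ : ((kaehlerPresheaf π).map (homOfLE hU').op).hom s =
      ∑ k, resO hU' (c k) • CommRingCat.KaehlerDifferential.d (resO hU' (b k)) := by
    refine (map_sum ((kaehlerPresheaf π).map (homOfLE hU').op).hom _ _).trans
      (Finset.sum_congr rfl fun k _ ↦ ?_)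
    refine ((kaehlerPresheaf π).map_smul (homOfLE hU').op (c k) _).trans ?_
    exact congrArg (fun z : CommRingCat.KaehlerDifferential ((inverseImageHom π).app (op U')) ↦
        resO hU' (c k) • z)
      (PresheafOfModules.DifferentialsConstruction.relativeDifferentials'_map_d
        (inverseImageHom π) (homOfLE hU').op (b k))
  have e₂ := congrArg (fun z ↦ δ.desc.hom z) (e₁.symm.trans (e.trans (map_zero _)))
  refine Eq.trans ?_ (e₂.trans (map_zero δ.desc.hom))
  refine Eq.trans ?_ (map_sum δ.desc.hom _ _).symm
  refine Finset.sum_congr rfl fun k _ ↦ ?_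
  refine Eq.trans ?_ (δ.desc.hom.map_smul (resO hU' (c k)) _).symm
  refine Eq.trans ?_ (congrArg (resO hU' (c k) • ·) (δ.desc_d (resO hU' (b k)))).symm
  have g (a : Γ(Y, U)) : Y.presheaf.germ U' x hx' (resO hU' a) = Y.presheaf.germ U x hxU a :=
    TopCat.Presheaf.germ_res_apply Y.presheaf (homOfLE hU') x hx' a
  exact (congrArg₂ (fun a b ↦ a • KaehlerDifferential.D Γ(B, W) (Y.presheaf.stalk x) b)
    (g (c k)) (g (b k))).symm

/-- The algebra structure on the functions on `V` over the functions on an open of the base. -/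
abbrev sectionAlgebra {W : B.Opens} {V : Y.Opens} (h : V ≤ π ⁻¹ᵁ W) : Algebra Γ(B, W) Γ(Y, V) :=
  (π.appLE W V h).hom.toAlgebra

/-- `dSection` kills functions from the base, so it is a derivation over `Γ(B, W)` and factors
through the algebraic differentials, where the relation is given. -/
lemma dSection_eq_sum {W : B.Opens} {V : Y.Opens} (h : V ≤ π ⁻¹ᵁ W) {ι : Type*} [Fintype ι]
    (p : Γ(Y, V)) (c t : ι → Γ(Y, V))
    (hp : letI := sectionAlgebra π h
      KaehlerDifferential.D Γ(B, W) Γ(Y, V) p = ∑ j, c j • KaehlerDifferential.D Γ(B, W) Γ(Y, V) (t j)) :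
    dSection π V p = ∑ j, c j • dSection π V (t j) := by
  let := sectionAlgebra π h
  let : Module Γ(B, W) Γ(kaehler π, V) := Module.compHom _ (π.appLE W V h).hom
  have : IsScalarTower Γ(B, W) Γ(Y, V) Γ(kaehler π, V) :=
    ⟨fun r a m ↦ mul_smul ((π.appLE W V h).hom r) a m⟩
  let δ : Derivation Γ(B, W) Γ(Y, V) Γ(kaehler π, V) := Derivation.mk'
    { toFun := dSection π V
      map_add' := map_add _
      map_smul' r a := by
        rw [Algebra.smul_def]
        refine (dSection_mul π V _ _).trans ?_
        refine (congrArg (_ + ·) ((congrArg (a • ·) (dSection_appLE π h r)).trans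
          (smul_zero a))).trans ?_
        exact add_zero _ }
    (fun a b ↦ dSection_mul π V a b)
  have e := congrArg δ.liftKaehlerDifferential hp
  rw [map_sum, Derivation.liftKaehlerDifferential_comp_D] at e
  refine e.trans (Finset.sum_congr rfl fun j _ ↦ ?_)
  rw [δ.liftKaehlerDifferential.map_smul, Derivation.liftKaehlerDifferential_comp_D]
  rfl

end
end AlgebraicGeometry.Scheme.Modules

namespace AlgebraicGeometry.Scheme.Modules
noncomputable section
variable {Y B : Scheme.{u}} (π : Y ⟶ B)

/-- Over an affine open, differentials of functions are locally combinations of differentials of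
functions on the whole affine open. -/
lemma exists_dSection_mem_span {V : Y.Opens} (hV : IsAffineOpen V) {n : ℕ} {t : Fin n → Γ(Y, V)}
    (hd : ∀ p : Γ(Y, V), ∃ c : Fin n → Γ(Y, V), dSection π V p = ∑ j, c j • dSection π V (t j))
    {U : Y.Opens} (hU : U ≤ V) {x : Y} (hx : x ∈ U) (b : Γ(Y, U)) :
    ∃ (U' : Y.Opens) (h' : U' ≤ U), x ∈ U' ∧ (kaehler π).res h' (dSection π U b) ∈
      Submodule.span Γ(Y, U')
        (Set.range fun j ↦ (kaehler π).res (h'.trans hU) (dSection π V (t j))) := by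
  let : Algebra Γ(Y, V) (Y.presheaf.stalk x) := Y.presheaf.algebra_section_stalk ⟨x, hU hx⟩
  have := hV.isLocalization_stalk ⟨x, hU hx⟩
  -- Near `x` the function `b` is a fraction `p / s` with `p` and `s` defined on all of `V`; its
  -- differential is then given by the quotient rule.
  obtain ⟨⟨p, s⟩, hps⟩ := IsLocalization.surj (hV.primeIdealOf ⟨x, hU hx⟩).asIdeal.primeCompl
    (Y.presheaf.germ U x hx b)
  have hsu : IsUnit (Y.presheaf.germ V x (hU hx) s) := IsLocalization.map_units _ s
  have e : Y.presheaf.germ U x hx (b * resO hU s) = Y.presheaf.germ V x (hU hx) p := by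
    rw [map_mul]
    refine Eq.trans ?_ hps
    exact congrArg (Y.presheaf.germ U x hx b * ·)
      (TopCat.Presheaf.germ_res_apply Y.presheaf (homOfLE hU) x hx s.1)
  obtain ⟨U₂, hx₂, i₁, i₂, e₂⟩ := Y.presheaf.germ_eq x hx (hU hx) _ _ e
  have h' : U₂ ⊓ Y.basicOpen s.1 ≤ U := inf_le_left.trans (leOfHom i₁)
  refine ⟨U₂ ⊓ Y.basicOpen s.1, h', ⟨hx₂, (Y.mem_basicOpen _ _ (hU hx)).2 hsu⟩, ?_⟩
  have hp (q : Γ(Y, V)) : dSection π (U₂ ⊓ Y.basicOpen s.1) (resO (h'.trans hU) q) ∈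
      Submodule.span Γ(Y, U₂ ⊓ Y.basicOpen s.1)
        (Set.range fun j ↦ (kaehler π).res (h'.trans hU) (dSection π V (t j))) := by
    obtain ⟨c, hc⟩ := hd q
    refine (Submodule.mem_span_range_iff_exists_fun _).2 ⟨fun j ↦ resO (h'.trans hU) (c j), ?_⟩
    refine Eq.trans ?_ (dSection_map π (homOfLE (h'.trans hU)) q).symm
    refine Eq.trans ?_ (congrArg ((kaehler π).res (h'.trans hU)) hc).symm
    exact (res_sum_smul _ _ _).symm
  have e₃ : resO h' b * resO (h'.trans hU) s.1 = resO (h'.trans hU) p := by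
    have := congrArg (resO (inf_le_left : U₂ ⊓ Y.basicOpen s.1 ≤ U₂)) e₂
    have e₄ : resO (inf_le_left : U₂ ⊓ Y.basicOpen s.1 ≤ U₂) (resO (leOfHom i₁) (b * resO hU s.1)) =
      resO (inf_le_left : U₂ ⊓ Y.basicOpen s.1 ≤ U₂) (resO (leOfHom i₂) p) := this
    rw [resO_resO, resO_resO, map_mul, resO_resO] at e₄
    exact e₄
  have hu : IsUnit (resO (h'.trans hU) s.1) := by
    have := (Y.toRingedSpace.isUnit_res_basicOpen s.1).map
      (resO (inf_le_right : U₂ ⊓ Y.basicOpen s.1 ≤ Y.basicOpen s.1))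
    exact (congrArg IsUnit (resO_resO (Y.basicOpen_le s.1) inf_le_right s.1)).mp this
  have e₅ := dSection_mul π _ (resO h' b) (resO (h'.trans hU) s.1)
  rw [e₃] at e₅
  obtain ⟨v, hv⟩ := hu
  have e₆ : dSection π (U₂ ⊓ Y.basicOpen s.1) (resO h' b) = (↑v⁻¹ : Γ(Y, U₂ ⊓ Y.basicOpen s.1)) •
      (dSection π (U₂ ⊓ Y.basicOpen s.1) (resO (h'.trans hU) p) -
        resO h' b • dSection π (U₂ ⊓ Y.basicOpen s.1) (resO (h'.trans hU) s.1)) := by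
    rw [e₅, add_sub_cancel_left, ← hv, ← mul_smul, Units.inv_mul, one_smul]
  have e₇ : (kaehler π).res h' (dSection π U b) = dSection π (U₂ ⊓ Y.basicOpen s.1) (resO h' b) :=
    (dSection_map π (homOfLE h') b).symm
  rw [e₇, e₆]
  exact Submodule.smul_mem _ _ (Submodule.sub_mem _ (hp p) (Submodule.smul_mem _ _ (hp s)))

lemma res_mem_span {M : Y.Modules} {n : ℕ} {V U₁ U' U'' : Y.Opens} {s : Fin n → Γ(M, V)}
    (h₁ : U₁ ≤ V) (h' : U' ≤ U₁) (h'' : U'' ≤ U') {y : Γ(M, U₁)}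
    (hy : M.res h' y ∈ Submodule.span Γ(Y, U')
      (Set.range fun j ↦ M.res (h'.trans h₁) (s j))) :
    M.res h'' (M.res h' y) ∈ Submodule.span Γ(Y, U'')
      (Set.range fun j ↦ M.res ((h''.trans h').trans h₁) (s j)) := by
  obtain ⟨c, hc⟩ := (Submodule.mem_span_range_iff_exists_fun _).1 hy
  refine (Submodule.mem_span_range_iff_exists_fun _).2 ⟨fun j ↦ resO h'' (c j), ?_⟩
  rw [← hc]
  refine Eq.trans ?_ (res_sum_smul _ _ _).symm
  exact Finset.sum_congr rfl fun j _ ↦ congrArg (resO h'' (c j) • ·)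
    (M.res_res (h'.trans h₁) h'' (s j)).symm

/-- Over an affine open, the sheaf of differentials is locally generated by the differentials of
functions which generate the module of differentials. -/
lemma exists_res_eq_sum_dSection {W : B.Opens} {V : Y.Opens} (h : V ≤ π ⁻¹ᵁ W) (hV : IsAffineOpen V)
    {n : ℕ} {t : Fin n → Γ(Y, V)}
    (ht : letI := sectionAlgebra π h
      ∀ z : Ω[Γ(Y, V)⁄Γ(B, W)], ∃ c : Fin n → Γ(Y, V),
        z = ∑ j, c j • KaehlerDifferential.D Γ(B, W) Γ(Y, V) (t j))
    {U : Y.Opens} (hU : U ≤ V) (z : Γ(kaehler π, U)) {x : Y} (hx : x ∈ U) :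
    ∃ (U' : Y.Opens) (h' : U' ≤ U), x ∈ U' ∧ ∃ c : Fin n → Γ(Y, U'),
      (kaehler π).res h' z = ∑ j, c j • (kaehler π).res (h'.trans hU) (dSection π V (t j)) := by
  let := sectionAlgebra π h
  have hd (p : Γ(Y, V)) : ∃ c : Fin n → Γ(Y, V), dSection π V p = ∑ j, c j • dSection π V (t j) := by
    obtain ⟨c, hc⟩ := ht (KaehlerDifferential.D Γ(B, W) Γ(Y, V) p)
    exact ⟨c, dSection_eq_sum π h p c t hc⟩
  obtain ⟨U₁, hU₁, s, hx₁, hs⟩ := exists_toSheafOf (kaehlerPresheaf π) z hx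
  let := ((inverseImageHom π).app (op U₁)).hom.toAlgebra
  have key (y : Ω[Γ(Y, U₁)⁄(inverseImage π).obj (op U₁)]) :
      ∃ (U' : Y.Opens) (h' : U' ≤ U₁), x ∈ U' ∧
        (kaehler π).res h' (toSheafOf (kaehlerPresheaf π) U₁ y) ∈ Submodule.span Γ(Y, U')
          (Set.range fun j ↦ (kaehler π).res (h'.trans (hU₁.trans hU)) (dSection π V (t j))) := by
    -- Sections of the presheaf are finite sums of terms `c • d b`, which reduces the claim to a
    -- single differential.
    have hy : y ∈ Submodule.span Γ(Y, U₁)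
        (Set.range (KaehlerDifferential.D ((inverseImage π).obj (op U₁)) Γ(Y, U₁))) := by
      rw [KaehlerDifferential.span_range_derivation]
      exact Submodule.mem_top
    induction hy using Submodule.span_induction with
    | mem y hy =>
      obtain ⟨b, rfl⟩ := hy
      exact exists_dSection_mem_span π hV hd (hU₁.trans hU) hx₁ b
    | zero =>
      refine ⟨U₁, le_rfl, hx₁, ?_⟩
      have e : (kaehler π).res (le_refl U₁) (toSheafOf (kaehlerPresheaf π) U₁ 0) = 0 :=
        (congrArg _ (map_zero (toSheafOf (kaehlerPresheaf π) U₁))).trans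
          (map_zero ((kaehler π).res (le_refl U₁)))
      exact e ▸ Submodule.zero_mem _
    | add y y' _ _ hy hy' =>
      obtain ⟨U', h', hx', hy⟩ := hy
      obtain ⟨U'', h'', hx'', hy'⟩ := hy'
      refine ⟨U' ⊓ U'', inf_le_left.trans h', ⟨hx', hx''⟩, ?_⟩
      have e : (kaehler π).res (inf_le_left.trans h' : U' ⊓ U'' ≤ U₁)
            (toSheafOf (kaehlerPresheaf π) U₁ (y + y')) =
          (kaehler π).res inf_le_left ((kaehler π).res h' (toSheafOf (kaehlerPresheaf π) U₁ y)) +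
          (kaehler π).res inf_le_right
            ((kaehler π).res h'' (toSheafOf (kaehlerPresheaf π) U₁ y')) := by
        refine (congrArg _ (map_add (toSheafOf (kaehlerPresheaf π) U₁) y y')).trans ?_
        refine (map_add ((kaehler π).res (inf_le_left.trans h' : U' ⊓ U'' ≤ U₁)) _ _).trans ?_
        exact congrArg₂ (· + ·) ((kaehler π).res_res h' inf_le_left _).symm
          ((kaehler π).res_res h'' inf_le_right _).symm
      rw [e]
      exact Submodule.add_mem _ (res_mem_span (hU₁.trans hU) h' inf_le_left hy)
        (res_mem_span (hU₁.trans hU) h'' inf_le_right hy')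
    | smul c y _ hy =>
      obtain ⟨U', h', hx', hy⟩ := hy
      refine ⟨U', h', hx', ?_⟩
      have e : (kaehler π).res h' (toSheafOf (kaehlerPresheaf π) U₁ (c • y)) =
          resO h' c • (kaehler π).res h' (toSheafOf (kaehlerPresheaf π) U₁ y) :=
        (congrArg _ ((toSheafOf (kaehlerPresheaf π) U₁).map_smul c y)).trans
          ((kaehler π).res_smul h' c _)
      rw [e]
      exact Submodule.smul_mem _ _ hy
  obtain ⟨U', h', hx', hz⟩ := key s
  refine ⟨U', h'.trans hU₁, hx', ?_⟩
  obtain ⟨c, hc⟩ := (Submodule.mem_span_range_iff_exists_fun _).1 hz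
  exact ⟨c, (((congrArg ((kaehler π).res h') hs).trans ((kaehler π).res_res hU₁ h' z)).symm.trans
    hc.symm)⟩

end
end AlgebraicGeometry.Scheme.Modules

namespace AlgebraicGeometry.Scheme.Modules
noncomputable section
variable {Y B : Scheme.{u}} (π : Y ⟶ B)

lemma exists_le_of_forall_exists_le {ι : Type*} [Finite ι] {U : Y.Opens} {x : Y} (hx : x ∈ U)
    {Q : ι → Y.Opens → Prop} (hQ : ∀ i V V', V' ≤ V → Q i V → Q i V')
    (h : ∀ i, ∃ V ≤ U, x ∈ V ∧ Q i V) : ∃ V ≤ U, x ∈ V ∧ ∀ i, Q i V := by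
  choose V hV hxV hQV using h
  refine ⟨U ⊓ ⟨⋂ i, (V i : Set Y), isOpen_iInter_of_finite fun i ↦ (V i).2⟩, inf_le_left,
    ⟨hx, Set.mem_iInter.2 fun i ↦ hxV i⟩, fun i ↦ hQ i (V i) _ ?_ (hQV i)⟩
  exact fun y hy ↦ Set.mem_iInter.1 hy.2 i

lemma exists_le_forall_resO_eq {ι : Type*} [Finite ι] {U : Y.Opens} {x : Y} (hx : x ∈ U)
    {a b : ι → Γ(Y, U)} (h : ∀ i, Y.presheaf.germ U x hx (a i) = Y.presheaf.germ U x hx (b i)) :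
    ∃ (V : Y.Opens) (hV : V ≤ U), x ∈ V ∧ ∀ i, resO hV (a i) = resO hV (b i) := by
  obtain ⟨V, hV, hxV, h⟩ := exists_le_of_forall_exists_le (ι := ι) hx
    (Q := fun i V ↦ ∃ hV : V ≤ U, resO hV (a i) = resO hV (b i))
    (fun i V V' hV' ⟨hV, h⟩ ↦ ⟨hV'.trans hV, by
      rw [← resO_resO hV hV', h, resO_resO]⟩)
    (fun i ↦ by
      obtain ⟨V, hxV, i₁, i₂, e⟩ := Y.presheaf.germ_eq x hx hx _ _ (h i)
      exact ⟨V, leOfHom i₁, hxV, leOfHom i₁, e⟩)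
  exact ⟨V, hV, hxV, fun i ↦ (h i).2⟩

lemma exists_le_forall_germ_eq {ι : Type*} [Finite ι] {U : Y.Opens} {x : Y} (hx : x ∈ U)
    (d : ι → Y.presheaf.stalk x) :
    ∃ (V : Y.Opens) (_ : V ≤ U) (hx : x ∈ V) (δ : ι → Γ(Y, V)),
      ∀ i, Y.presheaf.germ V x hx (δ i) = d i := by
  obtain ⟨V, hV, hxV, h⟩ := exists_le_of_forall_exists_le (ι := ι) hx
    (Q := fun i V ↦ x ∈ V → ∃ (hx : x ∈ V) (δ : Γ(Y, V)), Y.presheaf.germ V x hx δ = d i)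
    (fun i V V' hV' h hx' ↦ by
      obtain ⟨hx, δ, e⟩ := h (hV' hx')
      exact ⟨hx', resO hV' δ, (TopCat.Presheaf.germ_res_apply Y.presheaf (homOfLE hV') x hx' δ).trans e⟩)
    (fun i ↦ by
      obtain ⟨V, hV, hxV, δ, e⟩ := Y.presheaf.exists_le_germ_eq (d i) hx
      exact ⟨V, hV, hxV, fun _ ↦ ⟨hxV, δ, e⟩⟩)
  choose _ δ e using fun i ↦ h i hxV
  exact ⟨V, hV, hxV, δ, e⟩

/-- In the stalk, a localization of `Γ(Y, V)`, the relation is one between algebraic differentials,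
so its coefficients are a combination of the rows of `a`. The finitely many germs and equations
involved extend to a neighbourhood. -/
lemma exists_resO_eq_sum {W : B.Opens} (hW : IsAffineOpen W) {V : Y.Opens} (hV : IsAffineOpen V)
    (h : V ≤ π ⁻¹ᵁ W) {r n : ℕ} {t : Fin n → Γ(Y, V)} {a : Fin r → Fin n → Γ(Y, V)}
    (hp : letI := sectionAlgebra π h; KaehlerDifferential.IsPresentedBy Γ(B, W) t a)
    {U : Y.Opens} (hU : U ≤ V) (c : Fin n → Γ(Y, U))
    (hc : ∑ j, c j • (kaehler π).res hU (dSection π V (t j)) = 0) {x : Y} (hx : x ∈ U) :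
    ∃ (U' : Y.Opens) (h' : U' ≤ U), x ∈ U' ∧ ∃ d : Fin r → Γ(Y, U'),
      ∀ j, resO h' (c j) = ∑ i, d i * resO (h'.trans hU) (a i j) := by
  let := sectionAlgebra π h
  let : Algebra Γ(Y, V) (Y.presheaf.stalk x) := Y.presheaf.algebra_section_stalk ⟨x, hU hx⟩
  let := stalkAlgebra π (h (hU hx))
  have : IsScalarTower Γ(B, W) Γ(Y, V) (Y.presheaf.stalk x) := .of_algebraMap_eq fun b ↦ by
    have e₁ := congrArg (fun φ ↦ φ.hom b) (π.germ_stalkMap W x (h (hU hx)))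
    have e₂ := TopCat.Presheaf.germ_res_apply Y.presheaf (homOfLE h) x (hU hx) (π.app W b)
    exact e₁.trans e₂.symm
  have := hV.isLocalization_stalk ⟨x, hU hx⟩
  have g (a : Γ(Y, V)) : Y.presheaf.germ U x hx (resO hU a) = algebraMap Γ(Y, V) _ a :=
    TopCat.Presheaf.germ_res_apply Y.presheaf (homOfLE hU) x hx a
  obtain ⟨d, hd⟩ := hp.exists_of_isLocalization
    (hV.primeIdealOf ⟨x, hU hx⟩).asIdeal.primeCompl (fun j ↦ Y.presheaf.germ U x hx (c j)) (by
      have e : ∑ j, c j • dSection π U (resO hU (t j)) = 0 := by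
        refine Eq.trans (Finset.sum_congr rfl fun j _ ↦ ?_) hc
        exact congrArg (c j • ·) (dSection_map π (homOfLE hU) (t j))
      refine Eq.trans (Finset.sum_congr rfl fun j _ ↦ ?_)
        (sum_germ_smul_D_eq_zero π hW (h (hU hx)) hx c _ e)
      rw [g])
  obtain ⟨U₁, hU₁, hx₁, δ, hδ⟩ := exists_le_forall_germ_eq hx d
  obtain ⟨U₂, hU₂, hx₂, e⟩ := exists_le_forall_resO_eq hx₁ (a := fun j ↦ resO hU₁ (c j))
    (b := fun j ↦ ∑ i, δ i * resO (hU₁.trans hU) (a i j)) (fun j ↦ by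
      rw [map_sum]
      refine ((TopCat.Presheaf.germ_res_apply Y.presheaf (homOfLE hU₁) x hx₁ (c j)).trans
        (hd j)).trans (Finset.sum_congr rfl fun i _ ↦ ?_)
      rw [map_mul, hδ]
      exact congrArg (d i * ·) (TopCat.Presheaf.germ_res_apply Y.presheaf
        (homOfLE (hU₁.trans hU)) x hx₁ (a i j)).symm)
  refine ⟨U₂, hU₂.trans hU₁, hx₂, fun i ↦ resO hU₂ (δ i), fun j ↦ ?_⟩
  refine (resO_resO hU₁ hU₂ (c j)).symm.trans ((e j).trans ?_)
  rw [map_sum]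
  refine Finset.sum_congr rfl fun i _ ↦ ?_
  rw [map_mul, resO_resO]

/-- A matrix of functions on an affine open whose rows are independent over the ring of functions has
independent rows over the functions on every smaller open. -/
lemma eq_zero_of_hasIndependentRows {V : Y.Opens} (hV : IsAffineOpen V) {r n : ℕ}
    {a : Fin r → Fin n → Γ(Y, V)} (ha : Matrix.HasIndependentRows a) {U : Y.Opens} (hU : U ≤ V)
    (d : Fin r → Γ(Y, U)) (hd : ∀ j, ∑ i, d i * resO hU (a i j) = 0) : d = 0 := by
  funext i
  refine TopCat.Presheaf.section_ext Y.sheaf U _ _ fun x hx ↦ ?_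
  let : Algebra Γ(Y, V) (Y.presheaf.stalk x) := Y.presheaf.algebra_section_stalk ⟨x, hU hx⟩
  have := hV.isLocalization_stalk ⟨x, hU hx⟩
  refine (ha.of_isLocalization (hV.primeIdealOf ⟨x, hU hx⟩).asIdeal.primeCompl
    (S := Y.presheaf.stalk x) (fun i ↦ Y.presheaf.germ U x hx (d i)) (fun j ↦ ?_) i).trans
    (map_zero (Y.presheaf.germ U x hx).hom).symm
  have e := congrArg (Y.presheaf.germ U x hx) (hd j)
  rw [map_sum, map_zero] at e
  refine Eq.trans (Finset.sum_congr rfl fun i _ ↦ ?_) e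
  rw [map_mul]
  exact congrArg (Y.presheaf.germ U x hx (d i) * ·)
    (TopCat.Presheaf.germ_res_apply Y.presheaf (homOfLE hU) x hx (a i j)).symm

/-- Over an affine open, a presentation of the module of differentials whose relations are
independent gives a presentation of the sheaf of differentials. -/
theorem exists_freePres {W : B.Opens} (hW : IsAffineOpen W) {V : Y.Opens} (hV : IsAffineOpen V)
    (h : V ≤ π ⁻¹ᵁ W) {r n : ℕ} {t : Fin n → Γ(Y, V)} {a : Fin r → Fin n → Γ(Y, V)}
    (hp : letI := sectionAlgebra π h; KaehlerDifferential.IsPresentedBy Γ(B, W) t a)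
    (ha : Matrix.HasIndependentRows a) :
    ∃ P : FreePres (kaehler π) V.ι r n,
      (∀ i, P.a.app ⊤ (P.e₁ i) = ∑ j,
        (show Γ((V : Scheme.{u}), ⊤) from resO (ι_image_top_le V) (a i j)) • P.e₀ j) ∧
      ∀ j, P.b.app ⊤ (P.e₀ j) = (kaehler π).res (ι_image_top_le V) (dSection π V (t j)) := by
  let := sectionAlgebra π h
  obtain ⟨φ, b, w, hφ, hb, hex, hepi⟩ := exists_restrict_presentation (T := kaehler π) (V := V)
    (s := fun j ↦ dSection π V (t j)) (A := a) (fun i ↦ by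
      have := dSection_eq_sum π h (0 : Γ(Y, V)) (a i) t (by
        let := sectionAlgebra π h
        exact (map_zero _).trans (hp.relation i).symm)
      exact this.symm.trans (map_zero _))
    (fun U hU z x hx ↦ exists_res_eq_sum_dSection π h hV hp.exists_eq_sum hU z hx)
    (fun U hU c hc x hx ↦ exists_resO_eq_sum π hW hV h hp hU c hc hx)
  have hmono : Mono φ := (isFreeOn_freeFinBasis r).mono (isFreeOn_freeFinBasis n) hφ
    fun U d hd ↦ eq_zero_of_hasIndependentRows (U := V.ι ''ᵁ U) hV ha
      (by rintro _ ⟨z, -, rfl⟩; exact z.2) d fun j ↦ by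
      refine Eq.trans (Finset.sum_congr rfl fun i _ ↦ ?_) (hd j)
      refine congrArg (d i * ·) ?_
      exact (resO_resO (ι_image_top_le V) (Scheme.Hom.image_mono V.ι le_top) (a i j)).symm
  exact ⟨⟨φ, b, w, ⟨hex⟩, freeFinBasis V r, freeFinBasis V n, isFreeOn_freeFinBasis r,
    isFreeOn_freeFinBasis n⟩, hφ, hb⟩

variable {X C : Scheme.{u}} {f : X ⟶ Y} {p : X ⟶ C} {g : C ⟶ B} {π}

lemma morphismRestrict_app_resO (f : X ⟶ Y) (V : Y.Opens) (a : Γ(Y, V)) :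
    (f ∣_ V).app ⊤ (show Γ((V : Scheme.{u}), ⊤) from resO (ι_image_top_le V) a) =
      (show Γ((f ⁻¹ᵁ V : Scheme.{u}), ⊤) from resO (ι_image_top_le (f ⁻¹ᵁ V)) (f.app V a)) := by
  have e₁ := congrArg (fun φ ↦ φ.hom (resO (ι_image_top_le V) a)) (morphismRestrict_app' f V ⊤)
  have e₂ := congrArg (fun φ ↦ φ.hom a) (f.map_appLE (image_morphismRestrict_preimage f V ⊤).le
    (homOfLE (ι_image_top_le V)).op)
  exact e₁.trans e₂

/-- Presentations of the sheaves of differentials given by corresponding functions are compatible. -/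
lemma nonempty_freePresHom (w : f ≫ π = p ≫ g) {V : Y.Opens} {r n : ℕ} {t : Fin n → Γ(Y, V)}
    {a : Fin r → Fin n → Γ(Y, V)} {P : FreePres (kaehler π) V.ι r n}
    {P' : FreePres (kaehler p) (f ⁻¹ᵁ V).ι r n}
    (ha : ∀ i, P.a.app ⊤ (P.e₁ i) = ∑ j,
        (show Γ((V : Scheme.{u}), ⊤) from resO (ι_image_top_le V) (a i j)) • P.e₀ j)
    (hb : ∀ j, P.b.app ⊤ (P.e₀ j) = (kaehler π).res (ι_image_top_le V) (dSection π V (t j)))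
    (ha' : ∀ i, P'.a.app ⊤ (P'.e₁ i) = ∑ j,
        (show Γ((f ⁻¹ᵁ V : Scheme.{u}), ⊤) from resO (ι_image_top_le (f ⁻¹ᵁ V)) (f.app V (a i j))) •
          P'.e₀ j)
    (hb' : ∀ j, P'.b.app ⊤ (P'.e₀ j) =
      (kaehler p).res (ι_image_top_le (f ⁻¹ᵁ V)) (dSection p (f ⁻¹ᵁ V) (f.app V (t j)))) :
    Nonempty (FreePresHom (morphismRestrict_ι f V) (kaehlerMap w) P P') := by
  obtain ⟨τ₁, h₁⟩ := P.free₁.exists_hom (M := (pushforward (f ∣_ V)).obj P'.E₁) P'.e₁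
  obtain ⟨τ₀, h₀⟩ := P.free₀.exists_hom (M := (pushforward (f ∣_ V)).obj P'.E₀) P'.e₀
  refine ⟨⟨τ₁, τ₀, ?_, ?_, h₁, h₀⟩⟩
  · refine P.free₁.hom_ext fun i ↦ ?_
    have e₁ : τ₀.app ⊤ (P.a.app ⊤ (P.e₁ i)) = P'.a.app ⊤ (P'.e₁ i) := by
      refine (congrArg (τ₀.app ⊤) (ha i)).trans (Eq.trans ?_ (ha' i).symm)
      refine (app_sum_smul _ _ _).trans (Finset.sum_congr rfl fun j _ ↦ ?_)
      refine (congrArg (_ • ·) (h₀ j)).trans ?_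
      exact congrArg (fun z : Γ((f ⁻¹ᵁ V : Scheme.{u}), ⊤) ↦ z • P'.e₀ j)
        (morphismRestrict_app_resO f V (a i j))
    have e₂ : (τ₁ ≫ (pushforward (f ∣_ V)).map P'.a).app ⊤ (P.e₁ i) = P'.a.app ⊤ (P'.e₁ i) :=
      congrArg (P'.a.app ⊤) (h₁ i)
    exact e₁.trans e₂.symm
  · refine P.free₀.hom_ext fun j ↦ ?_
    have e₁ : (τ₀ ≫ (pushforward (f ∣_ V)).map P'.b).app ⊤ (P.e₀ j) = P'.b.app ⊤ (P'.e₀ j) :=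
      congrArg (P'.b.app ⊤) (h₀ j)
    refine e₁.trans ((hb' j).trans ?_)
    refine Eq.trans ?_ (congrArg ((restrictMapAlong (morphismRestrict_ι f V) (kaehlerMap w)).app ⊤)
      (hb j)).symm
    refine Eq.trans ?_ (restrictMapAlong_app _ _ ⊤ _).symm
    refine Eq.trans ?_ (congrArg ((kaehler p).res _) (((kaehlerMap w).app_res _ _).trans
      (congrArg _ (kaehlerMap_app_dSection w V (t j))))).symm
    exact ((kaehler p).res_res _ _ _).symm

end
end AlgebraicGeometry.Scheme.Modules

/-! ### Generic smoothness of the fibres at minimal primes -/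

noncomputable section

/-- A dense open subset of the spectrum of a noetherian ring contains the minimal primes. -/
lemma PrimeSpectrum.mem_of_dense_of_mem_minimalPrimes {A : Type*} [CommRing A] [IsNoetherianRing A]
    {U : Set (PrimeSpectrum A)} (hU : IsOpen U) (hd : Dense U) (q : PrimeSpectrum A)
    (hq : q.asIdeal ∈ minimalPrimes A) : q ∈ U := by
  have hZ : closure {q} ∈ irreducibleComponents (PrimeSpectrum A) := by
    rwa [← vanishingIdeal_mem_minimalPrimes, vanishingIdeal_singleton]
  -- Some nonempty open set lies inside the component with generic point `q`. It meets the dense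
  -- open set at a specialization of `q`.
  obtain ⟨V, hV, hne, hVq⟩ := NoetherianSpace.exists_isOpen_nonempty_subset_irreducibleComponent _ hZ
  obtain ⟨y, hyV, hyU⟩ := hd.inter_open_nonempty V hV hne
  exact (specializes_iff_mem_closure.2 (hVq hyV)).mem_open hU hyU

namespace AlgebraicGeometry

/-- A basic open neighbourhood of `q` inside `U` has a coordinate ring smooth over `k`, of which the
local ring at `q` is a localization. -/
lemma formallySmooth_localization_of_isOpen {k A : Type u} [CommRing k] [CommRing A] [Algebra k A]
    {U : (Spec (.of A)).Opens} (hU : Smooth (U.ι ≫ Spec.map (CommRingCat.ofHom (algebraMap k A))))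
    (q : Ideal A) [hq : q.IsPrime] (hqU : (⟨q, hq⟩ : PrimeSpectrum A) ∈ U) :
    Algebra.FormallySmooth k (Localization.AtPrime q) := by
  obtain ⟨_, ⟨x, rfl⟩, hx, hxU⟩ := PrimeSpectrum.isTopologicalBasis_basic_opens.exists_subset_of_mem_open
    (show (⟨q, hq⟩ : PrimeSpectrum A) ∈ (U.1 : Set (PrimeSpectrum A)) from hqU) U.2
  let S := Localization.Away x
  let j : Spec (.of S) ⟶ Spec (.of A) := Spec.map (CommRingCat.ofHom (algebraMap A S))
  have hj : IsOpenImmersion j := inferInstance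
  have hr : Set.range j ⊆ Set.range U.ι := by
    rw [Scheme.Opens.range_ι]
    refine (PrimeSpectrum.localization_away_comap_range S x).le.trans hxU
  have e : Spec.map (CommRingCat.ofHom (algebraMap k S)) =
      IsOpenImmersion.lift U.ι j hr ≫ U.ι ≫ Spec.map (CommRingCat.ofHom (algebraMap k A)) := by
    rw [IsOpenImmersion.lift_fac_assoc, ← Spec.map_comp, ← CommRingCat.ofHom_comp,
      ← IsScalarTower.algebraMap_eq]
  have hl : IsOpenImmersion (IsOpenImmersion.lift U.ι j hr) := inferInstance
  have hs : Smooth (Spec.map (CommRingCat.ofHom (algebraMap k S))) := by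
    rw [e]
    infer_instance
  rw [HasRingHomProperty.Spec_iff (P := @Smooth)] at hs
  have : Algebra.Smooth k S := RingHom.smooth_algebraMap.1 hs
  have hle : Submonoid.powers x ≤ q.primeCompl := Submonoid.powers_le.2 hx
  let := IsLocalization.localizationAlgebraOfSubmonoidLe S (Localization.AtPrime q) _ _ hle
  have : IsScalarTower A S (Localization.AtPrime q) :=
    IsLocalization.localization_isScalarTower_of_submonoid_le S _ _ _ hle
  have := IsLocalization.isLocalization_of_submonoid_le S (Localization.AtPrime q) _ _ hle
  have : IsScalarTower k S (Localization.AtPrime q) := .of_algebraMap_eq fun c ↦ by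
    rw [IsScalarTower.algebraMap_apply k A S, ← IsScalarTower.algebraMap_apply A S,
      ← IsScalarTower.algebraMap_apply]
  have : Algebra.FormallySmooth S (Localization.AtPrime q) :=
    .of_isLocalization (q.primeCompl.map (algebraMap A S))
  exact .comp k S _

lemma formallySmooth_localization_of_genericallySmooth {k A : Type u} [CommRing k] [CommRing A]
    [Algebra k A] [IsNoetherianRing A]
    (h : GenericallySmooth (Spec.map (CommRingCat.ofHom (algebraMap k A)))) (q : Ideal A)
    (hq : q ∈ minimalPrimes A) [hq' : q.IsPrime] :
    Algebra.FormallySmooth k (Localization.AtPrime q) := by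
  obtain ⟨U, hd, hU⟩ := h
  exact formallySmooth_localization_of_isOpen hU q
    (PrimeSpectrum.mem_of_dense_of_mem_minimalPrimes U.2 hd ⟨q, hq'⟩ hq)

lemma GenericallySmooth.comp_left {Z W T : Scheme.{u}} {q : Z ⟶ W} (h : GenericallySmooth q)
    (j : T ⟶ Z) [IsOpenImmersion j] : GenericallySmooth (j ≫ q) := by
  obtain ⟨U, hd, hU⟩ := h
  refine ⟨j ⁻¹ᵁ U, hd.preimage j.isOpenEmbedding.isOpenMap, ?_⟩
  rw [← morphismRestrict_ι_assoc]
  infer_instance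

lemma GenericallySmooth.comp_right {Z W T : Scheme.{u}} {q : Z ⟶ W} (h : GenericallySmooth q)
    (j : W ⟶ T) [Smooth j] : GenericallySmooth (q ≫ j) := by
  obtain ⟨U, hd, hU⟩ := h
  refine ⟨U, hd, ?_⟩
  rw [← Category.assoc]
  infer_instance

/-- The fibre of `V ⟶ W` over `p` is open in the fibre of `π` over the corresponding point of `B`,
and the residue fields agree because `W` is open in `B`. Generic smoothness passes to open
subschemes. -/
lemma GenericallySmooth.fiber {Y B : Scheme.{u}} {π : Y ⟶ B} (hπ : HasGenericallySmoothFibers π)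
    {W : B.Opens} (hW : IsAffineOpen W) {V : Y.Opens} (hV : IsAffineOpen V) (h : V ≤ π ⁻¹ᵁ W)
    (p : Ideal Γ(B, W)) [hp : p.IsPrime] :
    letI := (π.appLE W V h).hom.toAlgebra
    GenericallySmooth (Spec.map (CommRingCat.ofHom
      (algebraMap p.ResidueField (p.Fiber Γ(Y, V))))) := by
  let := (π.appLE W V h).hom.toAlgebra
  let x : Spec Γ(B, W) := (⟨p, hp⟩ : PrimeSpectrum Γ(B, W))
  have w : Spec.map (π.appLE W V h) ≫ hW.fromSpec = hV.fromSpec ≫ π :=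
    IsAffineOpen.SpecMap_appLE_fromSpec π hW hV h
  have h₁ : GenericallySmooth ((Spec.map (π.appLE W V h)).fiberToSpecResidueField x ≫
      Spec.map (hW.fromSpec.residueFieldMap x)) := by
    have e₁ : (Spec Γ(B, W)).fromSpecResidueField x ≫ hW.fromSpec =
        Spec.map (hW.fromSpec.residueFieldMap x) ≫ B.fromSpecResidueField (hW.fromSpec x) :=
      (hW.fromSpec.SpecMap_residueFieldMap_fromSpecResidueField x).symm
    have i₁ : IsIso (hW.fromSpec.residueFieldMap x) := inferInstance
    have i₂ : IsOpenImmersion (Spec.map (hW.fromSpec.residueFieldMap x)) := inferInstance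
    have i₃ : IsOpenImmersion hV.fromSpec := inferInstance
    have i₄ : Mono hW.fromSpec := inferInstance
    have i₅ := Scheme.pullback_map_isOpenImmersion (Spec.map (π.appLE W V h))
      ((Spec Γ(B, W)).fromSpecResidueField x) π (B.fromSpecResidueField (hW.fromSpec x))
      hV.fromSpec (Spec.map (hW.fromSpec.residueFieldMap x)) hW.fromSpec w e₁
    have := @GenericallySmooth.comp_left _ _ _ _ (hπ (hW.fromSpec x)) _ i₅
    exact (congrArg GenericallySmooth (pullback.lift_snd _ _ _)).mp this
  have h₂ := h₁.comp_right (inv (Spec.map (hW.fromSpec.residueFieldMap x)))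
  rw [Category.assoc, IsIso.hom_inv_id, Category.comp_id] at h₂
  let e := Spec.fiberToSpecResidueFieldIso Γ(B, W) Γ(Y, V) ⟨p, hp⟩
  have h₃ := (h₂.comp_left e.inv.left).comp_right e.hom.right
  have h₄ : (e.inv.left ≫ (Spec.map (π.appLE W V h)).fiberToSpecResidueField x) ≫ e.hom.right =
    Spec.map (CommRingCat.ofHom (algebraMap p.ResidueField (p.Fiber Γ(Y, V)))) := by
    have h₅ : e.inv.left ≫ (Spec.map (π.appLE W V h)).fiberToSpecResidueField x =
        Spec.map (CommRingCat.ofHom (algebraMap p.ResidueField (p.Fiber Γ(Y, V)))) ≫ e.inv.right :=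
      e.inv.w
    have h₆ : e.inv.right ≫ e.hom.right = 𝟙 _ := congrArg CommaMorphism.right e.inv_hom_id
    exact (congrArg (· ≫ e.hom.right) h₅).trans ((Category.assoc _ _ _).trans
      ((congrArg (_ ≫ ·) h₆).trans (Category.comp_id _)))
  rwa [h₄] at h₃

end AlgebraicGeometry
end

/-! ### Local form of a flat local complete intersection -/

namespace AlgebraicGeometry.Scheme.Modules
noncomputable section
open RingTheory.Sequence TensorProduct

variable {Y B : Scheme.{u}} {π : Y ⟶ B}

lemma isWeaklyRegular_basicOpen {M : Scheme.{u}} {P : M.Opens} (hP : IsAffineOpen P) (a : Γ(M, P))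
    {rs : List Γ(M, P)} (h : IsWeaklyRegular Γ(M, P) rs) :
    IsWeaklyRegular Γ(M, M.basicOpen a) (rs.map (resO (M.basicOpen_le a))) := by
  have := hP.isLocalization_basicOpen a
  exact h.of_isLocalization _ (Submonoid.powers a)

/-- Locally on the source, a local complete intersection is a quotient of a standard smooth algebra by
a regular sequence. -/
lemma _root_.AlgebraicGeometry.IsLCI.exists_surjective (hπ : IsLCI π) (y : Y) :
    ∃ (W : B.Opens) (_ : IsAffineOpen W) (V : Y.Opens) (_ : IsAffineOpen V) (h : V ≤ π ⁻¹ᵁ W)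
      (P : CommRingCat.{u}) (φ : Γ(B, W) ⟶ P) (g : P ⟶ Γ(Y, V)) (rs : List P), y ∈ V ∧
      φ ≫ g = π.appLE W V h ∧ φ.hom.IsStandardSmooth ∧ Function.Surjective g ∧
      IsWeaklyRegular P rs ∧ RingHom.ker g.hom = Ideal.ofList rs := by
  obtain ⟨U, hyU, M, i, s, ⟨hi, hreg⟩, hs, -, e⟩ := hπ.exists_factorization y
  obtain ⟨P, hP, hzP, rs, hrs, hker⟩ := hreg ⟨y, hyU⟩
  obtain ⟨W, hW, V', hV', hzV', e', hst⟩ := Smooth.exists_isStandardSmooth s (i ⟨y, hyU⟩)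
  -- An open set that is basic in both affine opens: the regular sequence is inherited from `P` and
  -- standard smoothness from `V'`.
  obtain ⟨a, b, hab, hza⟩ := exists_basicOpen_le_affine_inter hP hV' (i ⟨y, hyU⟩) ⟨hzP, hzV'⟩
  have hle : M.basicOpen a ≤ V' := hab.le.trans (M.basicOpen_le b)
  let N : (U : Scheme.{u}).Opens := i ⁻¹ᵁ M.basicOpen a
  have hN : IsAffineOpen N := (hP.basicOpen a).preimage i
  have hVW : U.ι ''ᵁ N ≤ π ⁻¹ᵁ W := by
    rintro _ ⟨z, hz, rfl⟩
    have hz' : s (i z) ∈ W := e' (hle hz)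
    have e₁ : s (i z) = π (U.ι z) := congrArg (fun q : (U : Scheme.{u}) ⟶ B ↦ q z) e
    exact (congrArg (· ∈ W) e₁).mp hz'
  refine ⟨W, hW, U.ι ''ᵁ N, hN.image_of_isOpenImmersion U.ι, hVW, Γ(M, M.basicOpen a),
    s.appLE W _ (hle.trans e'), i.app _ ≫ (U.ι.appIso N).inv, rs.map (resO (M.basicOpen_le a)),
    ⟨⟨y, hyU⟩, hza, rfl⟩, ?_, ?_, ?_, isWeaklyRegular_basicOpen hP a hrs.1, ?_⟩
  · rw [← cancel_mono (U.ι.appIso N).hom, Category.assoc, Category.assoc, Iso.inv_hom_id,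
      Category.comp_id, Scheme.Hom.appIso_hom', Scheme.Hom.app_eq_appLE,
      Scheme.Hom.appLE_comp_appLE, Scheme.Hom.appLE_comp_appLE]
    simp only [e]
    rfl
  · let : Algebra Γ(M, V') Γ(M, M.basicOpen a) := (resO hle).toAlgebra
    have : IsLocalization.Away b Γ(M, M.basicOpen a) :=
      hV'.isLocalization_of_eq_basicOpen b (homOfLE hle) hab
    have h₁ := RingHom.isStandardSmooth_stableUnderCompositionWithLocalizationAway.right
      (S := Γ(M, V')) (T := Γ(M, M.basicOpen a)) b _ hst
    have h₂ : s.appLE W (M.basicOpen a) (hle.trans e') =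
      s.appLE W V' e' ≫ M.presheaf.map (homOfLE hle).op := (s.appLE_map _ _).symm
    rw [h₂]
    exact h₁
  · exact ((ConcreteCategory.bijective_of_isIso (U.ι.appIso N).inv).surjective).comp
      (i.app_surjective _ (hP.basicOpen a))
  · have h₁ := i.ker.map_ideal_basicOpen ⟨P, hP⟩ a
    rw [Scheme.Hom.ker_apply, Scheme.Hom.ker_apply, hker] at h₁
    refine Eq.trans ?_ (h₁.symm.trans (Ideal.map_ofList _ _))
    ext x
    exact ((ConcreteCategory.bijective_of_isIso (U.ι.appIso N).inv).injective).eq_iff'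
      (map_zero (U.ι.appIso N).inv.hom)

/-- A flat local complete intersection with generically smooth fibres has, locally, presentations
of its differentials whose relations are independent after every finite base change. -/
theorem exists_isPresentedBy [IsNoetherian B] [Flat π] (hπ : IsLCI π)
    (hsm : HasGenericallySmoothFibers π) (y : Y) :
    ∃ (W : B.Opens) (_ : IsAffineOpen W) (V : Y.Opens) (_ : IsAffineOpen V) (h : V ≤ π ⁻¹ᵁ W)
      (r n : ℕ) (t : Fin n → Γ(Y, V)) (a : Fin r → Fin n → Γ(Y, V)), y ∈ V ∧
      letI := sectionAlgebra π h
      KaehlerDifferential.IsPresentedBy Γ(B, W) t a ∧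
      ∀ (E : Type u) [CommRing E] [Algebra Γ(B, W) E] [Module.Finite Γ(B, W) E],
        Matrix.HasIndependentRows fun i j ↦ (1 : E) ⊗ₜ[Γ(B, W)] a i j := by
  obtain ⟨W, hW, V, hV, h, P, φ, g, rs, hy, hφg, hφ, hg, hrs, hker⟩ := hπ.exists_surjective y
  have hR : IsNoetherianRing Γ(B, W) := IsLocallyNoetherian.component_noetherian ⟨W, hW⟩
  let := sectionAlgebra π h
  let := φ.hom.toAlgebra
  have : Algebra.IsStandardSmooth Γ(B, W) P := hφ
  have : Module.Flat Γ(B, W) Γ(Y, V) := π.flat_appLE hW hV h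
  let γ : P →ₐ[Γ(B, W)] Γ(Y, V) :=
    { g.hom with commutes' b := congrArg (fun ψ ↦ ψ.hom b) hφg }
  have hγ : RingHom.ker γ = Ideal.span (Set.range rs.get) := by
    refine Eq.trans hker ?_
    rw [Ideal.ofList, Set.range_list_get]
  obtain ⟨n, t, b, hb⟩ := Algebra.IsStandardSmooth.exists_basis_kaehlerDifferential Γ(B, W) P
  have ha (i) : KaehlerDifferential.D Γ(B, W) P (rs.get i) =
      ∑ j, b.repr (KaehlerDifferential.D Γ(B, W) P (rs.get i)) j •
        KaehlerDifferential.D Γ(B, W) P (t j) := by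
    simp only [← hb]
    exact (b.sum_repr _).symm
  have : IsNoetherianRing P := Algebra.FiniteType.isNoetherianRing Γ(B, W) P
  have : Algebra.FiniteType Γ(B, W) Γ(Y, V) := .of_surjective γ hg
  refine ⟨W, hW, V, hV, h, rs.length, n, fun j ↦ γ (t j), fun i j ↦ γ _, hy,
    KaehlerDifferential.isPresentedBy_of_basis γ hg hγ b hb ha, fun E _ _ _ ↦
      Algebra.IsStandardSmooth.hasIndependentRows γ hg hγ (by rwa [List.ofFn_get]) ?_ ha E⟩
  intro p _ q hq _
  have : IsNoetherianRing (p.Fiber Γ(Y, V)) :=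
    Algebra.FiniteType.isNoetherianRing p.ResidueField _
  exact formallySmooth_localization_of_genericallySmooth
    (GenericallySmooth.fiber hsm hW hV h p) q hq

end
end AlgebraicGeometry.Scheme.Modules

/-! ### Compatible presentations for the base change, and the theorem -/

namespace AlgebraicGeometry.Scheme.Modules
noncomputable section
open TensorProduct

lemma _root_.Matrix.HasIndependentRows.of_one_tmul {R R' A A' : Type*} [CommRing R] [CommRing R']
    [CommRing A] [CommRing A'] [Algebra R A] [Algebra R R'] [Algebra R A'] [Algebra A A']
    [Algebra R' A'] [IsScalarTower R A A'] [IsScalarTower R R' A'] [Algebra.IsPushout R R' A A']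
    {r n : ℕ} {a : Fin r → Fin n → A}
    (h : Matrix.HasIndependentRows fun i j ↦ (1 : R') ⊗ₜ[R] a i j) :
    Matrix.HasIndependentRows fun i j ↦ algebraMap A A' (a i j) := by
  let e := Algebra.IsPushout.equiv R R' A A'
  refine .of_injective (e.symm : A' →+* R' ⊗[R] A) e.symm.injective ?_
  convert h using 3 with i j
  refine e.symm_apply_eq.2 ?_
  simp [e, Algebra.IsPushout.equiv_tmul]

variable {X Y B C : Scheme.{u}} {f : X ⟶ Y} {p : X ⟶ C} {π : Y ⟶ B} {g : C ⟶ B}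

/-- For the base change along a closed immersion of a flat local complete intersection with
generically smooth fibres, the canonical map of differentials has compatible presentations. -/
theorem hasCompatiblePres_kaehlerMap [IsNoetherian B] [Flat π] (hπ : IsLCI π)
    (hsm : HasGenericallySmoothFibers π) [IsClosedImmersion g] [IsClosedImmersion f]
    (sq : IsPullback f p π g) : HasCompatiblePres (kaehlerMap sq.w) := by
  intro y
  obtain ⟨W, hW, V, hV, h, r, n, t, a, hy, hp, ha⟩ := exists_isPresentedBy hπ hsm y
  have hW' : IsAffineOpen (g ⁻¹ᵁ W) := hW.preimage g
  have hV' : IsAffineOpen (f ⁻¹ᵁ V) := hV.preimage f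
  have h' : f ⁻¹ᵁ V ≤ p ⁻¹ᵁ (g ⁻¹ᵁ W) := by
    intro x hx
    have e : π (f x) = g (p x) := congrArg (fun q : X ⟶ B ↦ q x) sq.w
    exact (congrArg (· ∈ W) e).mp (h hx)
  -- As all the opens are affine, `Γ(X, f⁻¹V)` is the tensor product of `Γ(Y, V)` and `Γ(C, g⁻¹W)`
  -- over `Γ(B, W)`.
  have hpush := (isIso_pushoutSection_iff sq le_rfl h (left_eq_inf.2 h')).1
    (isIso_pushoutSection_of_isAffineOpen sq le_rfl h (left_eq_inf.2 h') hW hW' hV)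
  let := sectionAlgebra π h
  let := sectionAlgebra p h'
  let : Algebra Γ(B, W) Γ(C, g ⁻¹ᵁ W) := (g.app W).hom.toAlgebra
  let : Algebra Γ(Y, V) Γ(X, f ⁻¹ᵁ V) := (f.app V).hom.toAlgebra
  let : Algebra Γ(B, W) Γ(X, f ⁻¹ᵁ V) := (π.appLE W V h ≫ f.app V).hom.toAlgebra
  rw [← Scheme.Hom.app_eq_appLE, ← Scheme.Hom.app_eq_appLE] at hpush
  have : IsScalarTower Γ(B, W) Γ(Y, V) Γ(X, f ⁻¹ᵁ V) := .of_algebraMap_eq' rfl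
  have : IsScalarTower Γ(B, W) Γ(C, g ⁻¹ᵁ W) Γ(X, f ⁻¹ᵁ V) :=
    .of_algebraMap_eq' (congrArg CommRingCat.Hom.hom hpush.w)
  have : Algebra.IsPushout Γ(B, W) Γ(C, g ⁻¹ᵁ W) Γ(Y, V) Γ(X, f ⁻¹ᵁ V) :=
    CommRingCat.isPushout_iff_isPushout.1 hpush.flip
  -- Since `g` is a closed embedding, `Γ(C, g⁻¹W)` is a quotient of `Γ(B, W)`, so the rows stay
  -- independent after this base change.
  have : Module.Finite Γ(B, W) Γ(C, g ⁻¹ᵁ W) := .of_surjective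
    (Algebra.linearMap Γ(B, W) Γ(C, g ⁻¹ᵁ W)) (g.app_surjective W hW)
  -- One matrix serves on both sides, with `E = Γ(B, W)` for `Y` and `E = Γ(C, g⁻¹W)` for `X`.
  obtain ⟨P, hPa, hPb⟩ := exists_freePres π hW hV h hp (ha Γ(B, W)).of_one_tmul
  obtain ⟨P', hPa', hPb'⟩ := exists_freePres p hW' hV' h'
    (KaehlerDifferential.IsPresentedBy.of_isPushout hp) (ha Γ(C, g ⁻¹ᵁ W)).of_one_tmul
  exact ⟨V, hy, r, n, P, P', nonempty_freePresHom sq.w hPa hPb hPa' hPb'⟩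

end
end AlgebraicGeometry.Scheme.Modules

theorem mainTheorem3 {X Y B C : Scheme.{u}} (π : Y ⟶ B) (g : C ⟶ B) (f : X ⟶ Y) (p : X ⟶ C)
    [IsNoetherian B] [Flat π] (hπ : IsLCI π) (hsm : HasGenericallySmoothFibers π)
    [IsClosedImmersion g] (sq : IsPullback f p π g) :
    Scheme.Modules.IsCoherent ((Scheme.Modules.pullback f).obj (Scheme.Modules.tOne π)) ∧
      Scheme.Modules.IsCoherent (Scheme.Modules.tOne p) ∧
      ∃! e : (Scheme.Modules.pullback f).obj (Scheme.Modules.tOne π) ≅ Scheme.Modules.tOne p,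
        Scheme.Modules.IsBaseChangeMap sq.w e.hom := by
  have : IsClosedImmersion f := MorphismProperty.of_isPullback sq.flip inferInstance
  have hκ := Scheme.Modules.hasCompatiblePres_kaehlerMap hπ hsm sq
  have he := Scheme.Modules.existsUnique_isBaseChangeMap sq.w hκ
  -- The presentations of `Ω_p` give coherence of `T¹_p`, which passes to the pullback along the
  -- isomorphism.
  have hp : Scheme.Modules.IsCoherent (Scheme.Modules.tOne p) := by
    refine Scheme.Modules.isCoherent_sheafExt fun x ↦ ?_
    obtain ⟨V, hx, r, n, -, P', -⟩ := hκ (f x)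
    exact ⟨f ⁻¹ᵁ V, hx, r, n, ⟨P'⟩⟩
  obtain ⟨e, -⟩ := he.exists
  exact ⟨Scheme.Modules.IsCoherent.of_iso e hp, hp, he⟩
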